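/- Let $\Bbbk$ be an arbitrary field, $n\ge 0$, and $w\in S_n$. **Notation.** Let $Z=(z_{ij})_{i,j=1}^n$ be the matrix of variables of the polynomial ring $\Bbbk[\mathbf z]$. For $1\le q,p\le n$ put $r_{qp}(w)=\#\{i\le q \mid w(i)\le p\}$, and for an $n\times n$ matrix $Y$ let $Y_{q\times p}$ denote its northwest $q\times p$ submatrix. * The *Schubert determinantal ideal* $I_w\subset\Bbbk[\mathbf z]$ is generated by all minors of size $1+r_{qp}(w)$ of $Z_{q\times p}$, for all $q,p$. The *matrix Schubert variety* $\overline X_w$ is the set of the matrices $Y$ with $\operatorname{rank}(Y_{q\times p})\le r_{qp}(w)$ for all $q,p$. Its points are taken over an infinite extension field $K$ of $\Bbbk$ (for instance $K=\Bbbk$ if $\Bbbk$ is infinite, or an algebraic closure of $\Bbbk$), and $I(\overline X_w)$ is the ideal of the polynomials in $\Bbbk[\mathbf z]$ that vanish on it. * Let $s_i$ be the transposition of $i$ and $i+1$, let $w_0=n\cdots 21$, and let $\operatorname{length}$ be the number of inversions. For a polynomial $f$ in $\mathbf x=x_1,\dots,x_n$ over a commutative ring put $\partial_i f=\dfrac{f-s_if}{x_i-x_{i+1}}$,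 where $s_i f$ is $f$ with $x_i,x_{i+1}$ interchanged, and $\overline\partial_i f=-\partial_i(x_{i+1}f)$. The *Schubert polynomials* $\mathfrak S_w(\mathbf x)$ and *double Schubert polynomials* $\mathfrak S_w(\mathbf x,\mathbf y)$ are defined by $\mathfrak S_{ws_i}=\partial_i\mathfrak S_w$ whenever $\operatorname{length}(ws_i)<\operatorname{length}(w)$, starting from $\mathfrak S_{w_0}(\mathbf x)=\prod_{i=1}^n x_i^{n-i}$ and $\mathfrak S_{w_0}(\mathbf x,\mathbf y)=\prod_{i+j\le n}(x_i-y_j)$. The *Grothendieck polynomials* $\mathcal G_w(\mathbf x)$ and *double Grothendieck polynomials* $\mathcal G_w(\mathbf x,\mathbf y)$ are defined by $\mathcal G_{ws_i}=\overline\partial_i\mathcal G_w$ whenever $\operatorname{length}(ws_i)<\operatorname{length}(w)$, starting from $\mathcal G_{w_0}(\mathbf x)=\prod_{i=1}^n(1-x_i)^{n-i}$ and $\mathcal G_{w_0}(\mathbf x,\mathbf y)=\prod_{i+j\le n}(1-x_iy_j^{-1})$. All operators act on the $\mathbf x$ variables only. * Let each variable of $\Bbbk[\mathbf z]$ have a degree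 in $\mathbb Z^d$. The *$K$-polynomial* of a finitely generated $\mathbb Z^d$-graded $\Bbbk[\mathbf z]$-module $\Gamma$ is $\mathcal K(\Gamma;\mathbf t)=\sum_i(-1)^i\sum_j\mathbf t^{\mathbf b_{ij}}$ for any finite graded free resolution of $\Gamma$ with terms $\bigoplus_j\Bbbk[\mathbf z](-\mathbf b_{ij})$ in homological degree $i$. The *multidegree* of $\Gamma$ is the sum of the terms of lowest degree of the power series $\mathcal K(\Gamma;\mathbf 1-\mathbf t)$ obtained by substituting $1-t_j$ for each $t_j$. The $K$-polynomial $\mathcal K(\overline X_w)$ and the multidegree $[\overline X_w]$ of $\overline X_w$ are those of $\Bbbk[\mathbf z]/I(\overline X_w)$. In the $\mathbb Z^n$-grading $z_{ij}$ has exponential weight $x_i$; in the $\mathbb Z^{2n}$-grading it has exponential weight $x_i/y_j$. **Theorem.** The ideal $I_w$ is prime, and $I_w=I(\overline X_w)$. The quotient $\Bbbk[\mathbf z]/I(\overline X_w)$ is graded in both gradings, its $\mathbb Z^n$-graded and $\mathbb Z^{2n}$-graded $K$-polynomials exist and do not depend on the resolution, and $$\mathcal K(\overline X_w;\mathbf x)=\mathcal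 G_w(\mathbf x)\quad\text{and}\quad \mathcal K(\overline X_w;\mathbf x,\mathbf y)=\mathcal G_w(\mathbf x,\mathbf y).$$ The corresponding multidegrees are $$[\overline X_w]_{\mathbb Z^n}=\mathfrak S_w(\mathbf x)\quad\text{and}\quad[\overline X_w]_{\mathbb Z^{2n}}=\mathfrak S_w(\mathbf x,\mathbf y).$$ -/

import Mathlib

open MvPolynomial

noncomputable section

namespace MatrixSchubert

/-! ## Permutations: positions `i`, `i + 1`, adjacent transpositions, length -/

section Permutations

variable {n : ℕ}

/-- The position `i` (the indices `i : Fin (n - 1)` number the adjacent pairs of positions). -/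
def lo (i : Fin (n - 1)) : Fin n := ⟨i.1, by omega⟩

/-- The position `i + 1`. -/
def hi (i : Fin (n - 1)) : Fin n := ⟨i.1 + 1, by omega⟩

/-- The adjacent transposition `s_i`. -/
def simple (i : Fin (n - 1)) : Equiv.Perm (Fin n) := Equiv.swap (lo i) (hi i)

/-- The set of inversions of `w`. -/
def inversions (w : Equiv.Perm (Fin n)) : Finset (Fin n × Fin n) :=
  Finset.univ.filter fun p => p.1 < p.2 ∧ w p.2 < w p.1

/-- The length of `w`, i.e. its number of inversions. -/
def length (w : Equiv.Perm (Fin n)) : ℕ := (inversions w).card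

/-- The recursion shared by all the families of polynomials below: `f` is obtained at `w` if it
arises from `top` at the long permutation `w₀ = n ⋯ 2 1` by steps that pass from `g` at `v` to
`T i g` at `v s_i`, where `length (v s_i) < length v`. -/
inductive ObtainedFrom {A : Type*} (T : Fin (n - 1) → A → A) (top : A) :
    Equiv.Perm (Fin n) → A → Prop
  | long : ObtainedFrom T top Fin.revPerm top
  | step (v : Equiv.Perm (Fin n)) (i : Fin (n - 1)) (g : A) :
      ObtainedFrom T top v g → length (v * simple i) < length v →
      ObtainedFrom T top (v * simple i) (T i g)

/-- The Coxeter relations for a family of operators. -/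
structure CoxeterRelations {A : Type*} (T : Fin (n - 1) → A → A) : Prop where
  braid : ∀ i j : Fin (n - 1), i.1 + 1 = j.1 → ∀ f, T i (T j (T i f)) = T j (T i (T j f))
  comm : ∀ i j : Fin (n - 1), i.1 + 1 < j.1 → ∀ f, T i (T j f) = T j (T i f)

lemma lo_lt_hi (i : Fin (n - 1)) : lo i < hi i := by
  simp [lo, hi, Fin.lt_def]

lemma simple_lt {i : Fin (n - 1)} {a b : Fin n} (h : a < b) (hne : ¬ (a = lo i ∧ b = hi i)) :
    simple i a < simple i b := by
  simp only [simple, Equiv.swap_apply_def]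
  simp only [lo, hi, Fin.ext_iff, Fin.lt_def] at *
  split_ifs <;> simp_all <;> omega

@[simp] lemma simple_lo (i : Fin (n - 1)) : simple i (lo i) = hi i := by simp [simple]
@[simp] lemma simple_hi (i : Fin (n - 1)) : simple i (hi i) = lo i := by simp [simple]
@[simp] lemma simple_mul_self (i : Fin (n - 1)) : simple i * simple i = 1 := by simp [simple]
@[simp] lemma mul_simple_simple (w : Equiv.Perm (Fin n)) (i : Fin (n - 1)) :
    w * simple i * simple i = w := by rw [mul_assoc, simple_mul_self, mul_one]
@[simp] lemma simple_simple (i : Fin (n - 1)) (a : Fin n) : simple i (simple i a) = a := by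
  simp [simple]

lemma length_lt_of_ascent {w : Equiv.Perm (Fin n)} {i : Fin (n - 1)} (h : w (lo i) < w (hi i)) :
    length w < length (w * simple i) := by
  have hsub : (inversions w).map ((simple i).prodCongr (simple i)).toEmbedding ⊂
      inversions (w * simple i) := by
    rw [Finset.ssubset_iff_of_subset]
    · refine ⟨(lo i, hi i), ?_, ?_⟩
      · simp only [inversions, Finset.mem_filter, Finset.mem_univ, true_and]
        exact ⟨lo_lt_hi i, by simpa using h⟩
      · simp only [Finset.mem_map, not_exists, not_and]
        rintro ⟨a, b⟩ hab heq
        simp only [inversions, Finset.mem_filter] at hab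
        simp only [Equiv.coe_toEmbedding, Equiv.prodCongr_apply, Prod.map, Prod.mk.injEq] at heq
        have ha : a = hi i := by rw [← simple_simple i a, heq.1, simple_lo]
        have hb : b = lo i := by rw [← simple_simple i b, heq.2, simple_hi]
        subst ha hb
        exact absurd hab.2.1 (lo_lt_hi i).asymm
    · intro p hp
      simp only [Finset.mem_map] at hp
      obtain ⟨⟨a, b⟩, hab, rfl⟩ := hp
      simp only [inversions, Finset.mem_filter, Finset.mem_univ, true_and] at hab ⊢
      refine ⟨simple_lt hab.1 ?_, ?_⟩
      · rintro ⟨rfl, rfl⟩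
        exact absurd hab.2 h.asymm
      · simpa using hab.2
  have := Finset.card_lt_card hsub
  simpa [length] using this

lemma length_lt_iff {w : Equiv.Perm (Fin n)} {i : Fin (n - 1)} :
    length (w * simple i) < length w ↔ w (hi i) < w (lo i) := by
  constructor
  · intro h
    by_contra hc
    have hne : w (lo i) ≠ w (hi i) := fun he => (lo_lt_hi i).ne (w.injective he)
    exact absurd (length_lt_of_ascent (lt_of_le_of_ne (not_lt.1 hc) hne)) h.asymm
  · intro h
    have := length_lt_of_ascent (w := w * simple i) (i := i) (by simpa using h)
    simpa using this

lemma length_le (w : Equiv.Perm (Fin n)) : length w ≤ n * n := by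
  simpa [length] using Finset.card_le_univ (inversions w)

lemma eq_revPerm_of_no_ascent {w : Equiv.Perm (Fin n)} (h : ∀ i, w (hi i) < w (lo i)) :
    w = Fin.revPerm := by
  obtain _ | m := n
  · exact Subsingleton.elim _ _
  have hanti : StrictAnti w := by
    rw [Fin.strictAnti_iff_succ_lt]
    intro i
    exact h i
  have hmono : StrictMono (w ∘ Fin.rev) := hanti.comp Fin.rev_strictAnti
  have hid : w ∘ Fin.rev = id := by
    have hsub := Subsingleton.elim (hmono.orderIsoOfSurjective _
      (w.surjective.comp Fin.rev_surjective)) (OrderIso.refl _)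
    funext a
    exact congrArg (fun e : Fin (m + 1) ≃o Fin (m + 1) => e a) hsub
  ext a
  have := congrFun hid a.rev
  simp only [Function.comp, Fin.rev_rev, id] at this
  simp [this]

lemma exists_obtainedFrom {A : Type*} (T : Fin (n - 1) → A → A) (top : A) :
    ∀ (d : ℕ) (w : Equiv.Perm (Fin n)), n * n - length w ≤ d → ∃ f, ObtainedFrom T top w f := by
  intro d
  induction d with
  | zero =>
    intro w hw
    have hall : ∀ i, w (hi i) < w (lo i) := by
      intro i
      by_contra hc
      have hne : w (lo i) ≠ w (hi i) := fun he => (lo_lt_hi i).ne (w.injective he)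
      have h1 := length_lt_of_ascent (lt_of_le_of_ne (not_lt.1 hc) hne)
      have h2 := length_le (w * simple i)
      omega
    rw [eq_revPerm_of_no_ascent hall]
    exact ⟨top, .long⟩
  | succ d ih =>
    intro w hw
    by_cases hall : ∀ i, w (hi i) < w (lo i)
    · rw [eq_revPerm_of_no_ascent hall]
      exact ⟨top, .long⟩
    · push Not at hall
      obtain ⟨i, hi'⟩ := hall
      have hne : w (lo i) ≠ w (hi i) := fun he => (lo_lt_hi i).ne (w.injective he)
      have h1 := length_lt_of_ascent (lt_of_le_of_ne hi' hne)
      have h2 := length_le (w * simple i)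
      obtain ⟨f, hf⟩ := ih (w * simple i) (by omega)
      refine ⟨T i f, ?_⟩
      have := ObtainedFrom.step (w * simple i) i f hf (by simpa using h1)
      simpa using this

lemma exists_obtained {A : Type*} (T : Fin (n - 1) → A → A) (top : A) (w : Equiv.Perm (Fin n)) :
    ∃ f, ObtainedFrom T top w f := exists_obtainedFrom T top _ w le_rfl

/-- Inversion of the recursion. -/
lemma obtainedFrom_cases {A : Type*} {T : Fin (n - 1) → A → A} {top : A}
    {w : Equiv.Perm (Fin n)} {f : A} (h : ObtainedFrom T top w f) :
    (w = Fin.revPerm ∧ f = top) ∨ ∃ i g, w (lo i) < w (hi i) ∧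
      ObtainedFrom T top (w * simple i) g ∧ f = T i g := by
  cases h with
  | long => exact .inl ⟨rfl, rfl⟩
  | step v i g hv hl =>
    refine .inr ⟨i, g, ?_, by simpa using hv, rfl⟩
    simpa using length_lt_iff.1 hl

lemma obtainedFrom_up {A : Type*} {T : Fin (n - 1) → A → A} {top : A}
    {w : Equiv.Perm (Fin n)} {i : Fin (n - 1)} {g : A} (hw : w (lo i) < w (hi i))
    (h : ObtainedFrom T top (w * simple i) g) : ObtainedFrom T top w (T i g) := by
  have := ObtainedFrom.step (w * simple i) i g h (by simpa using length_lt_of_ascent hw)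
  simpa using this

lemma simple_of_ne {i : Fin (n - 1)} {a : Fin n} (h1 : a ≠ lo i) (h2 : a ≠ hi i) :
    simple i a = a := Equiv.swap_apply_of_ne_of_ne h1 h2

lemma obtainedFrom_unique_aux {A : Type*} {T : Fin (n - 1) → A → A} (hT : CoxeterRelations T)
    (top : A) : ∀ (d : ℕ) (w : Equiv.Perm (Fin n)), n * n - length w ≤ d →
      ∀ f g, ObtainedFrom T top w f → ObtainedFrom T top w g → f = g := by
  intro d
  induction d with
  | zero =>
    intro w hw f g hf hg
    have hno : ∀ i, ¬ w (lo i) < w (hi i) := by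
      intro i hc
      have h1 := length_lt_of_ascent hc
      have h2 := length_le (w * simple i)
      omega
    rcases obtainedFrom_cases hf with ⟨-, rfl⟩ | ⟨i, _, hi', _⟩
    · rcases obtainedFrom_cases hg with ⟨-, rfl⟩ | ⟨i, _, hi', _⟩
      · rfl
      · exact absurd hi' (hno i)
    · exact absurd hi' (hno i)
  | succ d ih =>
    have key : ∀ (w : Equiv.Perm (Fin n)), n * n - length w ≤ d + 1 → ∀ i j : Fin (n - 1),
        i.1 < j.1 → w (lo i) < w (hi i) → w (lo j) < w (hi j) → ∀ f g,
        ObtainedFrom T top (w * simple i) f → ObtainedFrom T top (w * simple j) g →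
        T i f = T j g := by
      intro w hw i j hij hi' hj' f g hf hg
      have li := length_lt_of_ascent hi'
      have lj := length_lt_of_ascent hj'
      have bi := length_le (w * simple i)
      have bj := length_le (w * simple j)
      have ui := ih (w * simple i) (by omega)
      have uj := ih (w * simple j) (by omega)
      rcases Nat.lt_or_ge (i.1 + 1) j.1 with hfar | hnear
      · -- commuting case
        have e1 : simple j (lo i) = lo i := simple_of_ne
          (by simp only [lo, ne_eq, Fin.mk.injEq]; omega)
          (by simp only [lo, hi, ne_eq, Fin.mk.injEq]; omega)
        have e2 : simple j (hi i) = hi i := simple_of_ne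
          (by simp only [lo, hi, ne_eq, Fin.mk.injEq]; omega)
          (by simp only [hi, ne_eq, Fin.mk.injEq]; omega)
        have e3 : simple i (lo j) = lo j := simple_of_ne
          (by simp only [lo, ne_eq, Fin.mk.injEq]; omega)
          (by simp only [lo, hi, ne_eq, Fin.mk.injEq]; omega)
        have e4 : simple i (hi j) = hi j := simple_of_ne
          (by simp only [lo, hi, ne_eq, Fin.mk.injEq]; omega)
          (by simp only [hi, ne_eq, Fin.mk.injEq]; omega)
        have hc : simple i * simple j = simple j * simple i := by
          apply Equiv.Perm.Disjoint.commute
          intro a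
          by_cases ha : a = lo i ∨ a = hi i
          · right
            rcases ha with rfl | rfl
            · exact e1
            · exact e2
          · left
            push Not at ha
            exact simple_of_ne ha.1 ha.2
        obtain ⟨p, hp⟩ := exists_obtained T top (w * simple i * simple j)
        have h1 : ObtainedFrom T top (w * simple i) (T j p) :=
          obtainedFrom_up (by simpa [e3, e4] using hj') hp
        have h2 : ObtainedFrom T top (w * simple j) (T i p) :=
          obtainedFrom_up (by simpa [e1, e2] using hi')
            (by rw [mul_assoc, ← hc, ← mul_assoc]; exact hp)
        rw [ui _ _ hf h1, uj _ _ hg h2, hT.comm i j hfar]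
      · -- braid case
        have hj : hi i = lo j := by simp only [lo, hi, Fin.mk.injEq]; omega
        have hne1 : lo i ≠ lo j := by simp only [lo, ne_eq, Fin.mk.injEq]; omega
        have hne2 : lo i ≠ hi j := by simp only [lo, hi, ne_eq, Fin.mk.injEq]; omega
        have hne3 : lo j ≠ hi j := (lo_lt_hi j).ne
        have e1 : simple j (lo i) = lo i := simple_of_ne hne1 hne2
        have e4 : simple i (hi j) = hi j :=
          simple_of_ne hne2.symm (by rw [hj]; exact hne3.symm)
        have e5 : simple i (lo j) = lo i := by rw [← hj, simple_hi]
        have e6 : simple i (lo i) = lo j := by rw [simple_lo, hj]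
        have hbr : simple i * simple j * simple i = simple j * simple i * simple j := by
          ext a
          congr 1
          by_cases h1 : a = lo i
          · subst h1; simp [e1, e6, e4]
          by_cases h2 : a = lo j
          · subst h2; simp [e1, e5, e6, e4]
          by_cases h3 : a = hi j
          · subst h3; simp [e1, e5, e4]
          have f1 : simple i a = a := simple_of_ne h1 (by rwa [hj])
          have f2 : simple j a = a := simple_of_ne h2 h3
          simp [f1, f2]
        rw [hj] at hi'
        obtain ⟨p, hp⟩ := exists_obtained T top (w * simple i * simple j * simple i)
        have h1 : ObtainedFrom T top (w * simple i) (T j (T i p)) := by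
          refine obtainedFrom_up ?_ (obtainedFrom_up ?_ hp)
          · simp only [Equiv.Perm.mul_apply, e5, e4]
            exact hi'.trans hj'
          · simp only [Equiv.Perm.mul_apply, hj, e1, simple_lo, e6, e4]
            exact hj'
        have h2 : ObtainedFrom T top (w * simple j) (T i (T j p)) := by
          refine obtainedFrom_up ?_ (obtainedFrom_up ?_ (i := j) ?_)
          · simp only [Equiv.Perm.mul_apply, hj, e1, simple_lo]
            exact hi'.trans hj'
          · simp only [Equiv.Perm.mul_apply, e5, e1, e4, simple_hi]
            exact hi'
          · have : w * simple j * simple i * simple j = w * simple i * simple j * simple i := by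
              simp only [mul_assoc] at hbr ⊢
              rw [hbr]
            rw [this]; exact hp
        rw [ui _ _ hf h1, uj _ _ hg h2, hT.braid i j (by omega)]
    intro w hw f g hf hg
    have hrev : ∀ i : Fin (n - 1),
        ¬ (Fin.revPerm : Equiv.Perm (Fin n)) (lo i) < Fin.revPerm (hi i) := by
      intro i
      simpa using (lo_lt_hi i).le
    rcases obtainedFrom_cases hf with ⟨rfl, rfl⟩ | ⟨i, f', hi', hf', rfl⟩
    · rcases obtainedFrom_cases hg with ⟨-, rfl⟩ | ⟨i, _, hi', _⟩
      · rfl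
      · exact absurd hi' (hrev i)
    · rcases obtainedFrom_cases hg with ⟨rfl, -⟩ | ⟨j, g', hj', hg', rfl⟩
      · exact absurd hi' (hrev i)
      · rcases lt_trichotomy i.1 j.1 with h | h | h
        · exact key w hw i j h hi' hj' f' g' hf' hg'
        · obtain rfl : i = j := Fin.ext h
          have li := length_lt_of_ascent hi'
          have bi := length_le (w * simple i)
          rw [ih _ (by omega) _ _ hf' hg']
        · exact (key w hw j i h hj' hi' g' f' hg' hf').symm

lemma existsUnique_obtainedFrom {A : Type*} {T : Fin (n - 1) → A → A} (hT : CoxeterRelations T)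
    (top : A) (w : Equiv.Perm (Fin n)) : ∃! f, ObtainedFrom T top w f := by
  obtain ⟨f, hf⟩ := exists_obtained T top w
  exact ⟨f, hf, fun g hg => obtainedFrom_unique_aux hT top _ w le_rfl _ _ hg hf⟩

end Permutations

/-! ## Divided differences and Demazure operators -/

section Operators

variable {n : ℕ} {R : Type*} [CommRing R]

/-- Interchange the variables `x_i` and `x_{i+1}`. -/
def swapVars (i : Fin (n - 1)) : MvPolynomial (Fin n) R →ₐ[R] MvPolynomial (Fin n) R :=
  rename (simple i)

lemma sub_dvd_sub_swapVars (i : Fin (n - 1)) (f : MvPolynomial (Fin n) R) :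
    (X (lo i) - X (hi i) : MvPolynomial (Fin n) R) ∣ f - swapVars i f := by
  rw [← Ideal.mem_span_singleton, ← Ideal.Quotient.eq]
  set I := Ideal.span {(X (lo i) - X (hi i) : MvPolynomial (Fin n) R)} with hI
  have hx : Ideal.Quotient.mk I (X (lo i)) = Ideal.Quotient.mk I (X (hi i)) := by
    rw [Ideal.Quotient.eq, hI]
    exact Ideal.mem_span_singleton_self _
  have h : Ideal.Quotient.mk I =
      (Ideal.Quotient.mk I).comp (swapVars i : _ →ₐ[R] MvPolynomial (Fin n) R).toRingHom := by
    refine MvPolynomial.ringHom_ext (fun r => ?_) (fun j => ?_)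
    · simp [swapVars]
    · simp only [swapVars, RingHom.comp_apply, AlgHom.toRingHom_eq_coe, RingHom.coe_coe, rename_X]
      by_cases h1 : j = lo i
      · subst h1; simpa using hx
      by_cases h2 : j = hi i
      · subst h2; simpa using hx.symm
      · rw [simple_of_ne h1 h2]
  exact congrArg (fun φ : MvPolynomial (Fin n) R →+* _ => φ f) h

/-- The divided difference `∂_i f = (f - s_i f) / (x_i - x_{i+1})`. -/
def dividedDifference (i : Fin (n - 1)) (f : MvPolynomial (Fin n) R) : MvPolynomial (Fin n) R :=
  (sub_dvd_sub_swapVars i f).choose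

/-- The equation that determines `∂_i f` (uniquely, as `x_i - x_{i+1}` is not a zero divisor). -/
lemma mul_dividedDifference (i : Fin (n - 1)) (f : MvPolynomial (Fin n) R) :
    (X (lo i) - X (hi i)) * dividedDifference i f = f - swapVars i f :=
  (sub_dvd_sub_swapVars i f).choose_spec.symm

/-- The Demazure operator `f ↦ -∂_i (x_{i+1} f)`. -/
def demazure (i : Fin (n - 1)) (f : MvPolynomial (Fin n) R) : MvPolynomial (Fin n) R :=
  -dividedDifference i (X (hi i) * f)

lemma swapVars_swapVars (i : Fin (n - 1)) (f : MvPolynomial (Fin n) R) :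
    swapVars i (swapVars i f) = f := by
  have h : (simple i ∘ simple i : Fin n → Fin n) = id := by funext a; simp
  rw [swapVars, rename_rename, h, rename_id_apply]

@[simp] lemma swapVars_X (i : Fin (n - 1)) (a : Fin n) :
    swapVars i (X a : MvPolynomial (Fin n) R) = X (simple i a) := by simp [swapVars]

lemma mul_demazure (i : Fin (n - 1)) (f : MvPolynomial (Fin n) R) :
    (X (lo i) - X (hi i)) * demazure i f = X (lo i) * swapVars i f - X (hi i) * f := by
  have h := mul_dividedDifference i (X (hi i) * f)
  rw [map_mul, swapVars_X, simple_hi] at h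
  rw [demazure]
  linear_combination -h

section Indices

lemma hi_eq_lo {i j : Fin (n - 1)} (h : i.1 + 1 = j.1) : hi i = lo j := by
  simp only [lo, hi, Fin.mk.injEq]; omega

lemma simple_lo_of_lt {i j : Fin (n - 1)} (h : i.1 < j.1) : simple j (lo i) = lo i :=
  simple_of_ne (by simp only [lo, ne_eq, Fin.mk.injEq]; omega)
    (by simp only [lo, hi, ne_eq, Fin.mk.injEq]; omega)

lemma simple_hi_of_lt {i j : Fin (n - 1)} (h : i.1 < j.1) : simple i (hi j) = hi j :=
  simple_of_ne (by simp only [lo, hi, ne_eq, Fin.mk.injEq]; omega)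
    (by simp only [hi, ne_eq, Fin.mk.injEq]; omega)

lemma simple_braid {i j : Fin (n - 1)} (h : i.1 + 1 = j.1) (a : Fin n) :
    simple i (simple j (simple i a)) = simple j (simple i (simple j a)) := by
  have hj := hi_eq_lo h
  have e1 : simple j (lo i) = lo i := simple_lo_of_lt (by omega)
  have e4 : simple i (hi j) = hi j := simple_hi_of_lt (by omega)
  have e5 : simple i (lo j) = lo i := by rw [← hj, simple_hi]
  have e6 : simple i (lo i) = lo j := by rw [simple_lo, hj]
  by_cases h1 : a = lo i
  · subst h1; simp [e1, e6, e4]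
  by_cases h2 : a = lo j
  · subst h2; simp [e1, e5, e6, e4]
  by_cases h3 : a = hi j
  · subst h3; simp [e1, e5, e4]
  have f1 : simple i a = a := simple_of_ne h1 (by rwa [hj])
  have f2 : simple j a = a := simple_of_ne h2 h3
  simp [f1, f2]

lemma simple_comm {i j : Fin (n - 1)} (h : i.1 + 1 < j.1) (a : Fin n) :
    simple i (simple j a) = simple j (simple i a) := by
  have e1 : simple j (lo i) = lo i := simple_lo_of_lt (by omega)
  have e4 : simple i (hi j) = hi j := simple_hi_of_lt (by omega)
  have e2 : simple j (hi i) = hi i := simple_of_ne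
    (by simp only [lo, hi, ne_eq, Fin.mk.injEq]; omega)
    (by simp only [hi, ne_eq, Fin.mk.injEq]; omega)
  have e3 : simple i (lo j) = lo j := simple_of_ne
    (by simp only [lo, ne_eq, Fin.mk.injEq]; omega)
    (by simp only [lo, hi, ne_eq, Fin.mk.injEq]; omega)
  by_cases h1 : a = lo i
  · subst h1; simp [e1, e2]
  by_cases h2 : a = hi i
  · subst h2; simp [e1, e2]
  by_cases h3 : a = lo j
  · subst h3; simp [e3, e4]
  by_cases h4 : a = hi j
  · subst h4; simp [e3, e4]
  rw [simple_of_ne h3 h4, simple_of_ne h1 h2, simple_of_ne h3 h4]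

end Indices

lemma swapVars_braid {i j : Fin (n - 1)} (h : i.1 + 1 = j.1) (f : MvPolynomial (Fin n) R) :
    swapVars i (swapVars j (swapVars i f)) = swapVars j (swapVars i (swapVars j f)) := by
  simp only [swapVars, rename_rename]
  congr 2
  funext a
  exact simple_braid h a

lemma swapVars_comm {i j : Fin (n - 1)} (h : i.1 + 1 < j.1) (f : MvPolynomial (Fin n) R) :
    swapVars i (swapVars j f) = swapVars j (swapVars i f) := by
  simp only [swapVars, rename_rename]
  congr 2
  funext a
  exact simple_comm h a

variable [IsDomain R]

lemma X_sub_X_ne_zero {a b : Fin n} (h : a ≠ b) : (X a - X b : MvPolynomial (Fin n) R) ≠ 0 :=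
  sub_ne_zero.2 fun he => h (X_injective he)

lemma swapVars_dividedDifference (i : Fin (n - 1)) (f : MvPolynomial (Fin n) R) :
    swapVars i (dividedDifference i f) = dividedDifference i f := by
  have h := mul_dividedDifference i f
  have h' := congrArg (swapVars i) h
  simp only [map_mul, map_sub, swapVars_X, simple_lo, simple_hi, swapVars_swapVars] at h'
  refine mul_left_cancel₀ (X_sub_X_ne_zero (R := R) (lo_lt_hi i).ne) ?_
  linear_combination -h - h'

lemma swapVars_demazure (i : Fin (n - 1)) (f : MvPolynomial (Fin n) R) :
    swapVars i (demazure i f) = demazure i f := by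
  rw [demazure, map_neg, swapVars_dividedDifference]

lemma dividedDifference_coxeter :
    CoxeterRelations (dividedDifference : Fin (n - 1) → MvPolynomial (Fin n) R → _) where
  braid i j hij f := by
    have hj := hi_eq_lo hij
    have e1 : simple j (lo i) = lo i := simple_lo_of_lt (by omega)
    have e4 : simple i (hi j) = hi j := simple_hi_of_lt (by omega)
    have e5 : simple i (lo j) = lo i := by rw [← hj, simple_hi]
    have e6 : simple i (lo i) = lo j := by rw [simple_lo, hj]
    have D1 := fun f : MvPolynomial (Fin n) R => mul_dividedDifference i f
    have D2 := fun f : MvPolynomial (Fin n) R => mul_dividedDifference j f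
    rw [hj] at D1
    have S1 := fun f : MvPolynomial (Fin n) R => swapVars_dividedDifference i f
    have S2 := fun f : MvPolynomial (Fin n) R => swapVars_dividedDifference j f
    have T1 := fun f : MvPolynomial (Fin n) R => congrArg (swapVars i) (D2 f)
    have T2 := fun f : MvPolynomial (Fin n) R => congrArg (swapVars j) (D1 f)
    have T12 := fun f : MvPolynomial (Fin n) R => congrArg (swapVars i) (T2 f)
    have T21 := fun f : MvPolynomial (Fin n) R => congrArg (swapVars j) (T1 f)
    simp only [map_mul, map_sub, swapVars_X, e1, e4, e5, e6, simple_lo, simple_hi] at T1 T2 T12 T21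
    have hu : (X (lo i) - X (lo j) : MvPolynomial (Fin n) R) ≠ 0 :=
      X_sub_X_ne_zero (hj ▸ (lo_lt_hi i).ne)
    have hv : (X (lo j) - X (hi j) : MvPolynomial (Fin n) R) ≠ 0 :=
      X_sub_X_ne_zero (lo_lt_hi j).ne
    have ht : (X (lo i) - X (hi j) : MvPolynomial (Fin n) R) ≠ 0 :=
      X_sub_X_ne_zero (by simp only [lo, hi, ne_eq, Fin.mk.injEq]; omega)
    have hb := swapVars_braid hij f
    refine mul_left_cancel₀ (mul_ne_zero (mul_ne_zero hu hv) ht) ?_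
    generalize (X (lo i) : MvPolynomial (Fin n) R) = a at *
    generalize (X (lo j) : MvPolynomial (Fin n) R) = b at *
    generalize (X (hi j) : MvPolynomial (Fin n) R) = c at *
    have L : (a - b) * (b - c) * (a - c) *
        dividedDifference i (dividedDifference j (dividedDifference i f)) =
        f - swapVars i f - swapVars j f + swapVars j (swapVars i f) + swapVars i (swapVars j f)
          - swapVars i (swapVars j (swapVars i f)) := by
      set g := dividedDifference i f with hg
      have p1 := D1 (dividedDifference j g)
      have p2 := D2 g
      have p3 := T1 g
      rw [show swapVars i g = g from S1 f] at p3
      have p4 := D1 f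
      have p5 := T2 f
      have p6 := T12 f
      rw [← hg] at p4 p5 p6
      linear_combination (b - c) * (a - c) * p1 + (a - c) * p2 - (b - c) * p3 + p4 - p5 + p6
    have L' : (a - b) * (b - c) * (a - c) *
        dividedDifference j (dividedDifference i (dividedDifference j f)) =
        f - swapVars i f - swapVars j f + swapVars j (swapVars i f) + swapVars i (swapVars j f)
          - swapVars j (swapVars i (swapVars j f)) := by
      set g := dividedDifference j f with hg
      have p1 := D2 (dividedDifference i g)
      have p2 := D1 g
      have p3 := T2 g
      rw [show swapVars j g = g from S2 f] at p3
      have p4 := D2 f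
      have p5 := T1 f
      have p6 := T21 f
      rw [← hg] at p4 p5 p6
      linear_combination (a - b) * (a - c) * p1 + (a - c) * p2 - (a - b) * p3 + p4 - p5 + p6
    rw [L, L', hb]
  comm i j hij f := by
    have e1 : simple j (lo i) = lo i := simple_lo_of_lt (by omega)
    have e4 : simple i (hi j) = hi j := simple_hi_of_lt (by omega)
    have e2 : simple j (hi i) = hi i := simple_of_ne
      (by simp only [lo, hi, ne_eq, Fin.mk.injEq]; omega)
      (by simp only [hi, ne_eq, Fin.mk.injEq]; omega)
    have e3 : simple i (lo j) = lo j := simple_of_ne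
      (by simp only [lo, ne_eq, Fin.mk.injEq]; omega)
      (by simp only [lo, hi, ne_eq, Fin.mk.injEq]; omega)
    have p1 := mul_dividedDifference i (dividedDifference j f)
    have p2 := mul_dividedDifference j f
    have p3 := congrArg (swapVars i) p2
    have q1 := mul_dividedDifference j (dividedDifference i f)
    have q2 := mul_dividedDifference i f
    have q3 := congrArg (swapVars j) q2
    simp only [map_mul, map_sub, swapVars_X, e1, e2, e3, e4] at p3 q3
    have hb := swapVars_comm hij f
    refine mul_left_cancel₀ (mul_ne_zero (X_sub_X_ne_zero (R := R) (lo_lt_hi i).ne)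
      (X_sub_X_ne_zero (R := R) (lo_lt_hi j).ne)) ?_
    linear_combination (X (lo j) - X (hi j)) * p1 + p2 - p3
      - (X (lo i) - X (hi i)) * q1 - q2 + q3 + hb

lemma demazure_coxeter :
    CoxeterRelations (demazure : Fin (n - 1) → MvPolynomial (Fin n) R → _) where
  braid i j hij f := by
    have hj := hi_eq_lo hij
    have e1 : simple j (lo i) = lo i := simple_lo_of_lt (by omega)
    have e4 : simple i (hi j) = hi j := simple_hi_of_lt (by omega)
    have e5 : simple i (lo j) = lo i := by rw [← hj, simple_hi]
    have e6 : simple i (lo i) = lo j := by rw [simple_lo, hj]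
    have D1 := fun f : MvPolynomial (Fin n) R => mul_demazure i f
    have D2 := fun f : MvPolynomial (Fin n) R => mul_demazure j f
    rw [hj] at D1
    have S1 := fun f : MvPolynomial (Fin n) R => swapVars_demazure i f
    have S2 := fun f : MvPolynomial (Fin n) R => swapVars_demazure j f
    have T1 := fun f : MvPolynomial (Fin n) R => congrArg (swapVars i) (D2 f)
    have T2 := fun f : MvPolynomial (Fin n) R => congrArg (swapVars j) (D1 f)
    have T12 := fun f : MvPolynomial (Fin n) R => congrArg (swapVars i) (T2 f)
    have T21 := fun f : MvPolynomial (Fin n) R => congrArg (swapVars j) (T1 f)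
    simp only [map_mul, map_sub, swapVars_X, e1, e4, e5, e6, simple_lo, simple_hi] at T1 T2 T12 T21
    have hu : (X (lo i) - X (lo j) : MvPolynomial (Fin n) R) ≠ 0 :=
      X_sub_X_ne_zero (hj ▸ (lo_lt_hi i).ne)
    have hv : (X (lo j) - X (hi j) : MvPolynomial (Fin n) R) ≠ 0 :=
      X_sub_X_ne_zero (lo_lt_hi j).ne
    have ht : (X (lo i) - X (hi j) : MvPolynomial (Fin n) R) ≠ 0 :=
      X_sub_X_ne_zero (by simp only [lo, hi, ne_eq, Fin.mk.injEq]; omega)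
    have hb := swapVars_braid hij f
    refine mul_left_cancel₀ (mul_ne_zero (mul_ne_zero hu hv) ht) ?_
    generalize (X (lo i) : MvPolynomial (Fin n) R) = a at *
    generalize (X (lo j) : MvPolynomial (Fin n) R) = b at *
    generalize (X (hi j) : MvPolynomial (Fin n) R) = c at *
    have L : (a - b) * (b - c) * (a - c) * demazure i (demazure j (demazure i f)) =
        a ^ 2 * b * swapVars i (swapVars j (swapVars i f)) - a ^ 2 * c * swapVars i (swapVars j f)
          - b ^ 2 * a * swapVars j (swapVars i f) + b ^ 2 * c * swapVars j f
          + c ^ 2 * a * swapVars i f - c ^ 2 * b * f := by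
      set g := demazure i f with hg
      have p1 := D1 (demazure j g)
      have p2 := D2 g
      have p3 := T1 g
      rw [show swapVars i g = g from S1 f] at p3
      have p4 := D1 f
      have p5 := T2 f
      have p6 := T12 f
      rw [← hg] at p4 p5 p6
      linear_combination (b - c) * (a - c) * p1 + a * (b - c) * p3 - b * (a - c) * p2
        + c ^ 2 * p4 - b ^ 2 * p5 + a ^ 2 * p6
    have L' : (a - b) * (b - c) * (a - c) * demazure j (demazure i (demazure j f)) =
        a ^ 2 * b * swapVars j (swapVars i (swapVars j f)) - a ^ 2 * c * swapVars i (swapVars j f)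
          - b ^ 2 * a * swapVars j (swapVars i f) + b ^ 2 * c * swapVars j f
          + c ^ 2 * a * swapVars i f - c ^ 2 * b * f := by
      set g := demazure j f with hg
      have p1 := D2 (demazure i g)
      have p2 := D1 g
      have p3 := T2 g
      rw [show swapVars j g = g from S2 f] at p3
      have p4 := D2 f
      have p5 := T1 f
      have p6 := T21 f
      rw [← hg] at p4 p5 p6
      linear_combination (a - b) * (a - c) * p1 + b * (a - b) * p3 - c * (a - c) * p2
        + b * c * p4 - a * c * p5 + a * b * p6
    rw [L, L', hb]
  comm i j hij f := by
    have e1 : simple j (lo i) = lo i := simple_lo_of_lt (by omega)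
    have e4 : simple i (hi j) = hi j := simple_hi_of_lt (by omega)
    have e2 : simple j (hi i) = hi i := simple_of_ne
      (by simp only [lo, hi, ne_eq, Fin.mk.injEq]; omega)
      (by simp only [hi, ne_eq, Fin.mk.injEq]; omega)
    have e3 : simple i (lo j) = lo j := simple_of_ne
      (by simp only [lo, ne_eq, Fin.mk.injEq]; omega)
      (by simp only [lo, hi, ne_eq, Fin.mk.injEq]; omega)
    have p1 := mul_demazure i (demazure j f)
    have p2 := mul_demazure j f
    have p3 := congrArg (swapVars i) p2
    have q1 := mul_demazure j (demazure i f)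
    have q2 := mul_demazure i f
    have q3 := congrArg (swapVars j) q2
    simp only [map_mul, map_sub, swapVars_X, e1, e2, e3, e4] at p3 q3
    have hb := swapVars_comm hij f
    refine mul_left_cancel₀ (mul_ne_zero (X_sub_X_ne_zero (R := R) (lo_lt_hi i).ne)
      (X_sub_X_ne_zero (R := R) (lo_lt_hi j).ne)) ?_
    linear_combination (X (lo j) - X (hi j)) * p1 - X (hi i) * p2 + X (lo i) * p3
      - (X (lo i) - X (hi i)) * q1 + X (hi j) * q2 - X (lo j) * q3 + X (lo i) * X (lo j) * hb

/-- The member at `w` of the family that starts with `top` at `w₀` and satisfies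
`f_{w s_i} = ∂_i f_w` whenever `length (w s_i) < length w`. -/
def dividedDifferenceFamily (top : MvPolynomial (Fin n) R) (w : Equiv.Perm (Fin n)) :
    MvPolynomial (Fin n) R :=
  (existsUnique_obtainedFrom dividedDifference_coxeter top w).choose

/-- The member at `w` of the family that starts with `top` at `w₀` and whose member at `w s_i` is
the `i`-th Demazure operator applied to its member at `w` whenever `length (w s_i) < length w`. -/
def demazureFamily (top : MvPolynomial (Fin n) R) (w : Equiv.Perm (Fin n)) :
    MvPolynomial (Fin n) R :=
  (existsUnique_obtainedFrom demazure_coxeter top w).choose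

lemma dividedDifferenceFamily_long (top : MvPolynomial (Fin n) R) :
    dividedDifferenceFamily top Fin.revPerm = top :=
  ((existsUnique_obtainedFrom dividedDifference_coxeter top _).choose_spec.2 _ .long).symm

lemma dividedDifferenceFamily_step (top : MvPolynomial (Fin n) R) {w : Equiv.Perm (Fin n)}
    {i : Fin (n - 1)} (h : length (w * simple i) < length w) :
    dividedDifferenceFamily top (w * simple i) =
      dividedDifference i (dividedDifferenceFamily top w) :=
  ((existsUnique_obtainedFrom dividedDifference_coxeter top _).choose_spec.2 _
    (.step w i _ (existsUnique_obtainedFrom dividedDifference_coxeter top w).choose_spec.1 h)).symm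

lemma demazureFamily_long (top : MvPolynomial (Fin n) R) :
    demazureFamily top Fin.revPerm = top :=
  ((existsUnique_obtainedFrom demazure_coxeter top _).choose_spec.2 _ .long).symm

lemma demazureFamily_step (top : MvPolynomial (Fin n) R) {w : Equiv.Perm (Fin n)}
    {i : Fin (n - 1)} (h : length (w * simple i) < length w) :
    demazureFamily top (w * simple i) = demazure i (demazureFamily top w) :=
  ((existsUnique_obtainedFrom demazure_coxeter top _).choose_spec.2 _
    (.step w i _ (existsUnique_obtainedFrom demazure_coxeter top w).choose_spec.1 h)).symm

end Operators

/-! ## Schubert and Grothendieck polynomials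

Indices run through `Fin n = {0, …, n - 1}`, so that the mathematical index of `i` is `i + 1`. -/

section Polynomials

variable {n : ℕ}

/-- The Laurent polynomials `ℤ[t^{±1}]`, i.e. the group ring of `ℤ^ι`. -/
abbrev Laurent (ι : Type*) : Type _ := AddMonoidAlgebra ℤ (ι → ℤ)

/-- The Laurent monomial `t^a`. -/
def laurentMonomial {ι : Type*} (a : ι → ℤ) : Laurent ι := AddMonoidAlgebra.single a 1

/-- The Schubert polynomial `𝔖_w(x)`, with `𝔖_{w₀} = ∏ x_i^{n-i}`. -/
def schubert (w : Equiv.Perm (Fin n)) : MvPolynomial (Fin n) ℤ :=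
  dividedDifferenceFamily (∏ i : Fin n, X i ^ (n - (i.1 + 1))) w

/-- The double Schubert polynomial `𝔖_w(x, y)` in `ℤ[y][x]`, with
`𝔖_{w₀} = ∏_{i + j ≤ n} (x_i - y_j)`. -/
def doubleSchubert (w : Equiv.Perm (Fin n)) : MvPolynomial (Fin n) (MvPolynomial (Fin n) ℤ) :=
  dividedDifferenceFamily
    (∏ p : Fin n × Fin n with (p.1.1 + 1) + (p.2.1 + 1) ≤ n, (X p.1 - C (X p.2))) w

/-- The Grothendieck polynomial `𝒢_w(x)`, with `𝒢_{w₀} = ∏ (1 - x_i)^{n-i}`. -/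
def grothendieck (w : Equiv.Perm (Fin n)) : MvPolynomial (Fin n) ℤ :=
  demazureFamily (∏ i : Fin n, (1 - X i) ^ (n - (i.1 + 1))) w

/-- The double Grothendieck polynomial `𝒢_w(x, y)` in `ℤ[y^{±1}][x]`, with
`𝒢_{w₀} = ∏_{i + j ≤ n} (1 - x_i y_j⁻¹)`. -/
def doubleGrothendieck (w : Equiv.Perm (Fin n)) : MvPolynomial (Fin n) (Laurent (Fin n)) :=
  demazureFamily
    (∏ p : Fin n × Fin n with (p.1.1 + 1) + (p.2.1 + 1) ≤ n,
      (1 - X p.1 * C (laurentMonomial (-Pi.single p.2 1)))) w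

/-- The inclusion `ℤ[x] → ℤ[x^{±1}]`. -/
def toLaurent : MvPolynomial (Fin n) ℤ →+* Laurent (Fin n) :=
  (aeval fun i => laurentMonomial (Pi.single i 1)).toRingHom

/-- The inclusion `ℤ^n → ℤ^{2n}` of the exponents of the variables `y`. -/
def yExponents : (Fin n → ℤ) →+ (Fin n ⊕ Fin n → ℤ) where
  toFun a := Sum.elim 0 a
  map_zero' := by ext (i | i) <;> rfl
  map_add' a b := by ext (i | i) <;> simp

/-- The inclusion `ℤ[y^{±1}][x] → ℤ[x^{±1}, y^{±1}]`; on the right, `x_i` has index `Sum.inl i`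
and `y_j` has index `Sum.inr j`. -/
def toDoubleLaurent : MvPolynomial (Fin n) (Laurent (Fin n)) →+* Laurent (Fin n ⊕ Fin n) :=
  eval₂Hom (AddMonoidAlgebra.mapDomainRingHom ℤ yExponents)
    fun i => laurentMonomial (Pi.single (Sum.inl i) 1)

/-- The identification of `ℤ[y][x]` with `ℤ[x, y]`. -/
def toDoublePolynomial :
    MvPolynomial (Fin n) (MvPolynomial (Fin n) ℤ) →+* MvPolynomial (Fin n ⊕ Fin n) ℤ :=
  (sumAlgEquiv ℤ (Fin n) (Fin n)).symm.toAlgHom.toRingHom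

end Polynomials

/-! ## Graded modules, `K`-polynomials and multidegrees -/

section Multidegrees

variable {k σ ι M : Type*} [Field k] [Fintype ι] [DecidableEq ι]
  [AddCommGroup M] [Module k M] [Module (MvPolynomial σ k) M]

/-- The family `𝒢` of subspaces is a `ℤ^ι`-grading of the `k[z]`-module `M`, where the variable
`z_s` has degree `a s`. -/
def IsGrading (a : σ → ι → ℤ) (𝒢 : (ι → ℤ) → Submodule k M) : Prop :=
  DirectSum.IsInternal 𝒢 ∧
    ∀ (α β : ι → ℤ) (p : MvPolynomial σ k) (m : M),
      IsWeightedHomogeneous a p α → m ∈ 𝒢 β → p • m ∈ 𝒢 (α + β)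

/-- The piece of degree `γ` of the graded free module `⨁_j k[z](-b_j)`. -/
def freePiece (a : σ → ι → ℤ) {r : ℕ} (b : Fin r → ι → ℤ) (γ : ι → ℤ) :
    Set (Fin r → MvPolynomial σ k) :=
  {v | ∀ j, IsWeightedHomogeneous a (v j) (γ - b j)}

/-- A finite graded free resolution
`0 ← M ← E_0 ← E_1 ← ⋯ ← E_len ← 0` with `E_i = ⨁_{j < rank i} k[z](-b i j)`. -/
structure GradedFreeResolution (a : σ → ι → ℤ) (𝒢 : (ι → ℤ) → Submodule k M) where
  /-- The length of the resolution. -/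
  len : ℕ
  /-- The ranks of the free modules. -/
  rank : ℕ → ℕ
  rank_eq_zero : ∀ i, len < i → rank i = 0
  /-- The degrees of the generators. -/
  b : ∀ i, Fin (rank i) → ι → ℤ
  /-- The differentials. -/
  d : ∀ i, (Fin (rank (i + 1)) → MvPolynomial σ k) →ₗ[MvPolynomial σ k]
    (Fin (rank i) → MvPolynomial σ k)
  /-- The augmentation. -/
  ε : (Fin (rank 0) → MvPolynomial σ k) →ₗ[MvPolynomial σ k] M
  d_graded : ∀ i γ, ∀ v ∈ freePiece a (b (i + 1)) γ, d i v ∈ freePiece a (b i) γ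
  ε_graded : ∀ γ, ∀ v ∈ freePiece a (b 0) γ, ε v ∈ 𝒢 γ
  ε_surjective : Function.Surjective ε
  exact_zero : Function.Exact (d 0) ε
  exact_succ : ∀ i, Function.Exact (d (i + 1)) (d i)

/-- The alternating sum `∑_i (-1)^i ∑_j t^{b i j}` of a graded free resolution. -/
def GradedFreeResolution.kPolynomial {a : σ → ι → ℤ} {𝒢 : (ι → ℤ) → Submodule k M}
    (E : GradedFreeResolution a 𝒢) : Laurent ι :=
  ∑ i ∈ Finset.range (E.len + 1), (-1) ^ i * ∑ j, laurentMonomial (E.b i j)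

/-- The Laurent polynomial `P` is the `K`-polynomial of the graded module `(M, 𝒢)`: the module is graded, it has a finite
graded free resolution, and every such resolution has the alternating sum `P`. -/
def IsKPolynomial (a : σ → ι → ℤ) (𝒢 : (ι → ℤ) → Submodule k M) (P : Laurent ι) : Prop :=
  IsGrading a 𝒢 ∧ (∃ E : GradedFreeResolution a 𝒢, E.kPolynomial = P) ∧
    ∀ E : GradedFreeResolution a 𝒢, E.kPolynomial = P

lemma isUnit_one_sub_X {τ : Type*} (j : τ) : IsUnit (1 - MvPowerSeries.X j : MvPowerSeries τ ℤ) := by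
  rw [MvPowerSeries.isUnit_iff_constantCoeff]
  simp

/-- `t^a ↦ ∏_j (1 - t_j)^{a_j}`, expanded as a formal power series. -/
def expandMonomial : Multiplicative (ι → ℤ) →* MvPowerSeries ι ℤ where
  toFun a := ((∏ j, (isUnit_one_sub_X j).unit ^ (a.toAdd j) : (MvPowerSeries ι ℤ)ˣ) :
    MvPowerSeries ι ℤ)
  map_one' := by simp
  map_mul' a b := by
    rw [← Units.val_mul, ← Finset.prod_mul_distrib]
    simp [zpow_add]

/-- The power series `P(1 - t)` obtained from a Laurent polynomial `P(t)`. -/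
def substOneSub : Laurent ι →ₐ[ℤ] MvPowerSeries ι ℤ :=
  AddMonoidAlgebra.lift ℤ (MvPowerSeries ι ℤ) (ι → ℤ) expandMonomial

/-- The sum of the terms of lowest degree of a power series (`0` for the power series `0`). -/
def lowestTerms (f : MvPowerSeries ι ℤ) : MvPowerSeries ι ℤ :=
  MvPowerSeries.homogeneousComponent f.order.toNat f

/-- The polynomial `Q` is the multidegree of the graded module `(M, 𝒢)`. -/
def IsMultidegree (a : σ → ι → ℤ) (𝒢 : (ι → ℤ) → Submodule k M) (Q : MvPolynomial ι ℤ) : Prop :=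
  ∃ P : Laurent ι, IsKPolynomial a 𝒢 P ∧ (Q : MvPowerSeries ι ℤ) = lowestTerms (substOneSub P)

/-- The grading of `k[z]/I` by the images of the homogeneous polynomials. -/
def quotientGrading (a : σ → ι → ℤ) (I : Ideal (MvPolynomial σ k)) (γ : ι → ℤ) :
    Submodule k (MvPolynomial σ k ⧸ I) :=
  (weightedHomogeneousSubmodule k a γ).map (Ideal.Quotient.mkₐ k I).toLinearMap

end Multidegrees

/-! ## Matrix Schubert varieties -/

section Varieties

variable {n : ℕ}

/-- The number of ones in the northwest submatrix of `wᵀ` with corner `(q, p)`; here `wᵀ` has its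
ones at the positions `(i, w i)`. -/
def nwRank (w : Equiv.Perm (Fin n)) (q p : Fin n) : ℕ :=
  (Finset.univ.filter fun i : Fin n => i ≤ q ∧ w i ≤ p).card

/-- The generic matrix `(z_{ij})`. -/
def genericMatrix (k : Type*) [Field k] (n : ℕ) :
    Matrix (Fin n) (Fin n) (MvPolynomial (Fin n × Fin n) k) :=
  Matrix.of fun i j => X (i, j)

/-- The Schubert determinantal ideal `I_w`: it is generated by the minors of size `1 + nwRank w q p`
of the northwest submatrix with corner `(q, p)` of the generic matrix, for all `q` and `p`. -/
def schubertIdeal (k : Type*) [Field k] (w : Equiv.Perm (Fin n)) :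
    Ideal (MvPolynomial (Fin n × Fin n) k) :=
  Ideal.span {f | ∃ (q p : Fin n) (r c : Fin (1 + nwRank w q p) ↪o Fin n),
    (∀ s, r s ≤ q) ∧ (∀ s, c s ≤ p) ∧ f = ((genericMatrix k n).submatrix r c).det}

/-- The northwest submatrix of `Z` with corner `(q, p)`. -/
def northwest {K : Type*} (Z : Matrix (Fin n) (Fin n) K) (q p : Fin n) :
    Matrix {i : Fin n // i ≤ q} {j : Fin n // j ≤ p} K :=
  Z.submatrix Subtype.val Subtype.val

/-- The matrix Schubert variety `X̄_w`, as a set of matrices over the field `K`. -/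
def matrixSchubertVariety (K : Type*) [Field K] (w : Equiv.Perm (Fin n)) :
    Set (Matrix (Fin n) (Fin n) K) :=
  {Z | ∀ q p, (northwest Z q p).rank ≤ nwRank w q p}

/-- The ideal in `k[z]` of a set of matrices over an extension field `K` of `k`. -/
def idealOfMatrices (k : Type*) {K : Type*} [Field k] [Field K] [Algebra k K]
    (S : Set (Matrix (Fin n) (Fin n) K)) : Ideal (MvPolynomial (Fin n × Fin n) k) :=
  vanishingIdeal k ((fun Z (s : Fin n × Fin n) => Z s.1 s.2) '' S)

/-- The ideal `I(X̄_w)` in `k[z]` of the matrix Schubert variety over the extension field `K`. -/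
def varietyIdeal (k K : Type*) [Field k] [Field K] [Algebra k K] (w : Equiv.Perm (Fin n)) :
    Ideal (MvPolynomial (Fin n × Fin n) k) :=
  idealOfMatrices k (matrixSchubertVariety K w)

/-- The `ℤ^n`-grading: `z_{ij}` has degree `x_i`. -/
def weightX (s : Fin n × Fin n) : Fin n → ℤ := Pi.single s.1 1

/-- The `ℤ^{2n}`-grading: `z_{ij}` has degree `x_i - y_j`. -/
def weightXY (s : Fin n × Fin n) : Fin n ⊕ Fin n → ℤ :=
  Pi.single (Sum.inl s.1) 1 - Pi.single (Sum.inr s.2) 1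

end Varieties

end MatrixSchubert

end

open MatrixSchubert

noncomputable section

namespace MatrixSchubert

/-! ### The ideal of an orbit closure, and a Gröbner basis proof that it equals I_w -/

/-! ## The parametrization of a matrix Schubert variety by `B₋ × B₊` -/

section Parametrization

variable {n : ℕ} {k K : Type*} [Field k] [Field K] [Algebra k K]

/-! Ideals. Let `orbitIdeal` be the kernel of Z ↦ L w U for generic triangular L and U. It is prime,
because its quotient embeds in a polynomial ring, and rank estimates give I_w ⊆ I(X̄_w) ⊆
`orbitIdeal`. Both statements about ideals therefore follow from `orbitIdeal` ⊆ I_w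
(`schubertIdeal_eq_orbitIdeal`). For an antidiagonal term order the leading monomial of a minor is
its antidiagonal. Division by the defining minors thus leaves a remainder whose monomials contain
none of these antidiagonals, and `eq_zero_of_mem_orbitIdeal` shows that such a remainder vanishes if
it lies in `orbitIdeal`.

That is an induction down from w₀ in Bruhat order. Let i be the first row where w differs from w₀,
and set z = z_{i,w(i)} to zero in the remainder. The result lies in the orbit ideal of w·(i j) for
every admissible j, where the claim is known. The combinatorial lemma
`exists_swap_not_hasAntidiagonal` provides a j for which the leading monomial contains no
antidiagonal, so the result is zero. Hence z divides the remainder. As z is outside the prime ideal,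
it can be cancelled, and the degree drops.

K-polynomials. A graded free resolution computes the Hilbert function as the translate-sum of the
Hilbert function of k[z] by the K-polynomial, and this determines the K-polynomial
(`GradedFreeResolution.finrank_piece`, `convolve_monomialCount_injective`). Resolutions exist by
Hilbert's syzygy theorem, proved with regular sequences. What remains is a recursion for Hilbert
series. Let v = w s_i be longer than w. The ideal I_w is stable under exchanging the rows i and i+1,
so H_w is symmetric in x_i, x_{i+1}. After pulling back to pairs (L, U), the images of I_v and of
s_i I_v agree up to the factors ℓ_{i+1,i} and ℓ_{i,i} (`orbitMap_exchange`), whence x_{i+1}(H_w −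
H_v) = x_i s_i(H_w − H_v). Together these say (x_i − x_{i+1}) H_w = x_i s_i H_v − x_{i+1} H_v, which
is the Demazure recursion. At w₀ the ideal is generated by the variables above the antidiagonal.

Multidegrees. Under x ↦ 1 − x the Demazure operator becomes the divided difference plus terms of
higher order, so the degree-`length w` part of the transformed Grothendieck polynomial is the
Schubert polynomial. It is nonzero, because divided differences take it down to the member at the
identity, which is 1. -/

/-- Lower triangular matrices. -/
def IsLower {R : Type*} [Zero R] (L : Matrix (Fin n) (Fin n) R) : Prop := ∀ x b, x < b → L x b = 0

/-- Upper triangular matrices. -/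
def IsUpper {R : Type*} [Zero R] (U : Matrix (Fin n) (Fin n) R) : Prop := ∀ c y, y < c → U c y = 0

/-- The polynomial ring in the entries of two `n × n` matrices. -/
abbrev PairRing (k : Type*) [Field k] (n : ℕ) : Type _ :=
  MvPolynomial ((Fin n × Fin n) ⊕ (Fin n × Fin n)) k

/-- The generic lower triangular matrix. -/
def genericLower (k : Type*) [Field k] (n : ℕ) : Matrix (Fin n) (Fin n) (PairRing k n) :=
  Matrix.of fun x b => if b ≤ x then X (Sum.inl (x, b)) else 0

/-- The generic upper triangular matrix. -/
def genericUpper (k : Type*) [Field k] (n : ℕ) : Matrix (Fin n) (Fin n) (PairRing k n) :=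
  Matrix.of fun c y => if c ≤ y then X (Sum.inr (c, y)) else 0

/-- Evaluation of a polynomial in `k[z]` at a matrix. -/
def evalAt {A : Type*} [CommRing A] [Algebra k A] (Z : Matrix (Fin n) (Fin n) A) :
    MvPolynomial (Fin n × Fin n) k →ₐ[k] A := aeval fun s => Z s.1 s.2

@[simp] lemma evalAt_X {A : Type*} [CommRing A] [Algebra k A] (Z : Matrix (Fin n) (Fin n) A)
    (s : Fin n × Fin n) : evalAt (k := k) Z (X s) = Z s.1 s.2 := by simp [evalAt]

/-- The map `k[z] → k[L, U]` that sends the generic matrix to the product `L w U`. -/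
def orbitMap (k : Type*) [Field k] (w : Equiv.Perm (Fin n)) :
    MvPolynomial (Fin n × Fin n) k →ₐ[k] PairRing k n :=
  evalAt (genericLower k n * (genericUpper k n).submatrix w id)

/-- The ideal of the closure of the orbit of `w` under pairs of triangular matrices. -/
def orbitIdeal (k : Type*) [Field k] (w : Equiv.Perm (Fin n)) :
    Ideal (MvPolynomial (Fin n × Fin n) k) := RingHom.ker (orbitMap k w)

lemma mem_orbitIdeal {w : Equiv.Perm (Fin n)} {f : MvPolynomial (Fin n × Fin n) k} :
    f ∈ orbitIdeal k w ↔ orbitMap k w f = 0 := RingHom.mem_ker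

instance orbitIdeal_isPrime (w : Equiv.Perm (Fin n)) : (orbitIdeal k w).IsPrime :=
  RingHom.ker_isPrime _

lemma isLower_genericLower : IsLower (genericLower k n) := fun x b h => by
  simp [genericLower, h.not_ge]

lemma isUpper_genericUpper : IsUpper (genericUpper k n) := fun x b h => by
  simp [genericUpper, h.not_ge]

lemma aeval_orbitMap (w : Equiv.Perm (Fin n)) (x : (Fin n × Fin n) ⊕ (Fin n × Fin n) → K)
    (f : MvPolynomial (Fin n × Fin n) k) :
    aeval x (orbitMap k w f) =
      evalAt ((Matrix.of fun a b => if b ≤ a then x (Sum.inl (a, b)) else 0) *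
        (Matrix.of fun c y => if c ≤ y then x (Sum.inr (c, y)) else 0).submatrix w id) f := by
  rw [orbitMap, evalAt, evalAt, ← AlgHom.comp_apply, comp_aeval]
  congr 2
  funext s
  simp only [Matrix.mul_apply, map_sum, map_mul, genericLower, genericUpper, Matrix.of_apply,
    Matrix.submatrix_apply, id]
  refine Finset.sum_congr rfl fun b _ => ?_
  split_ifs <;> simp

/-- A polynomial in the entries of L and U is zero as soon as it vanishes at all points over an
infinite field. This makes membership testable on actual matrices. -/
lemma mem_orbitIdeal_iff [Infinite K] {w : Equiv.Perm (Fin n)}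
    {f : MvPolynomial (Fin n × Fin n) k} :
    f ∈ orbitIdeal k w ↔ ∀ L U : Matrix (Fin n) (Fin n) K, IsLower L → IsUpper U →
      evalAt (L * U.submatrix w id) f = 0 := by
  rw [mem_orbitIdeal]
  constructor
  · intro h L U hL hU
    have := aeval_orbitMap w (Sum.elim (fun s => L s.1 s.2) (fun s => U s.1 s.2)) f
    rw [h, map_zero] at this
    rw [this]
    congr 2
    · congr 1
      · ext a b
        simp only [Matrix.of_apply, Sum.elim_inl]
        split_ifs with hab
        · rfl
        · exact hL _ _ (not_le.1 hab)
      · congr 1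
        ext a b
        simp only [Matrix.of_apply, Sum.elim_inr]
        split_ifs with hab
        · rfl
        · exact hU _ _ (not_le.1 hab)
  · intro h
    apply MvPolynomial.map_injective (algebraMap k K) (algebraMap k K).injective
    rw [map_zero]
    refine MvPolynomial.funext fun x => ?_
    rw [map_zero, eval_map, ← aeval_def, aeval_orbitMap]
    refine h _ _ (fun a b hab => ?_) (fun a b hab => ?_)
    · simp [hab.not_ge]
    · simp [hab.not_ge]

/-- A polynomial that vanishes at infinitely many points of a line vanishes on the line. -/
lemma evalAt_eq_zero_of_line {f : MvPolynomial (Fin n × Fin n) k}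
    {Z D : Matrix (Fin n) (Fin n) K} (h : {s : K | evalAt (Z + s • D) f = 0}.Infinite) :
    evalAt Z f = 0 := by
  set p : Polynomial K := evalAt (Z.map Polynomial.C +
    (Polynomial.X : Polynomial K) • D.map Polynomial.C) f with hp
  have key : ∀ s, p.eval s = evalAt (Z + s • D) f := by
    intro s
    have : ((Polynomial.aeval s).restrictScalars k).comp (evalAt (Z.map Polynomial.C +
        (Polynomial.X : Polynomial K) • D.map Polynomial.C)) =
        (evalAt (Z + s • D) : MvPolynomial (Fin n × Fin n) k →ₐ[k] K) := by
      apply MvPolynomial.algHom_ext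
      intro t
      simpa using mul_comm _ _
    rw [← this, hp]
    simp
  have hp0 : p = 0 := by
    apply Polynomial.eq_zero_of_infinite_isRoot
    refine h.mono fun s hs => ?_
    simp only [Set.mem_ofPred_eq] at hs ⊢
    rw [Polynomial.IsRoot, key, hs]
  have := key 0
  rw [hp0] at this
  simpa using this.symm

/-- One column operation makes A lower triangular: it subtracts t times column i from column j. The
inverse operation adds a multiple of row w(j) of U to row w(i), which keeps U upper triangular
because w(i) < w(j). So A w U is again a point L' w U' of the orbit parametrization. -/
lemma evalAt_eq_zero_of_columns [Infinite K] {w : Equiv.Perm (Fin n)}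
    {f : MvPolynomial (Fin n × Fin n) k} (hf : f ∈ orbitIdeal k w) {i j : Fin n} (hij : i < j)
    (hw : w i < w j) {A U : Matrix (Fin n) (Fin n) K} (hU : IsUpper U)
    (hA : ∀ b, b ≠ j → ∀ x, x < b → A x b = 0) (t : K) (hAj : ∀ x, x < j → A x j = t * A x i) :
    evalAt (A * U.submatrix w id) f = 0 := by
  -- Insert a transvection and its inverse between the two factors; the second one is then moved
  -- past w.
  have hmul : A * U.submatrix w id = (A * Matrix.transvection i j (-t)) *
      ((Matrix.transvection i j t * U.submatrix w id).submatrix w.symm id).submatrix w id := by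
    rw [Matrix.submatrix_submatrix]
    simp only [Equiv.symm_comp_self, Function.comp_id, Matrix.submatrix_id_id]
    rw [Matrix.mul_assoc, ← Matrix.mul_assoc (Matrix.transvection i j (-t)),
      Matrix.transvection_mul_transvection_same _ _ hij.ne]
    simp
  rw [hmul]
  refine (mem_orbitIdeal_iff (K := K)).1 hf _ _ ?_ ?_
  · intro x b hxb
    by_cases hb : b = j
    · subst hb
      rw [Matrix.mul_transvection_apply_same, hAj x hxb]
      ring
    · rw [Matrix.mul_transvection_apply_of_ne _ _ _ _ hb]
      exact hA b hb x hxb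
  · intro c y hyc
    obtain ⟨b, rfl⟩ := w.surjective c
    simp only [Matrix.submatrix_apply, Equiv.symm_apply_apply, id]
    by_cases hb : b = i
    · subst hb
      rw [Matrix.transvection_mul_apply_same]
      simp [hU _ _ hyc, hU _ _ (hyc.trans hw)]
    · rw [Matrix.transvection_mul_apply_of_ne _ _ _ _ hb]
      exact hU _ _ hyc

/-- The column condition may fail at A itself: it suffices that it holds on the line A + sD for all
s except one value s₀, and a polynomial in s with infinitely many zeros vanishes at s = 0. -/
lemma evalAt_eq_zero_of_columns_limit [Infinite K] {w : Equiv.Perm (Fin n)}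
    {f : MvPolynomial (Fin n × Fin n) k} (hf : f ∈ orbitIdeal k w) {i j : Fin n} (hij : i < j)
    (hw : w i < w j) {A D U : Matrix (Fin n) (Fin n) K} (hU : IsUpper U)
    (hA : ∀ b, b ≠ j → ∀ x, x < b → A x b = 0) (hD : ∀ b, b ≠ j → ∀ x, x < b → D x b = 0)
    (s₀ : K) (t : K → K)
    (hAj : ∀ s, s ≠ s₀ → ∀ x, x < j → (A + s • D) x j = t s * (A + s • D) x i) :
    evalAt (A * U.submatrix w id) f = 0 := by
  apply evalAt_eq_zero_of_line (D := D * U.submatrix w id)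
  refine Set.Infinite.mono (s := {s₀}ᶜ) (fun s hs => ?_) (Set.finite_singleton s₀).infinite_compl
  simp only [Set.mem_ofPred_eq]
  rw [← Matrix.smul_mul, ← Matrix.add_mul]
  refine evalAt_eq_zero_of_columns hf hij hw hU (fun b hb x hx => ?_) (t s) (hAj s hs)
  simp [hA b hb x hx, hD b hb x hx]

/-- The orbit of the Bruhat-larger permutation is in the closure of the orbit of w. Multiplying by
(i j) swaps two columns of L, and adding s times the old column i to the new column i makes column j
proportional to it above the diagonal, with factor s⁻¹. -/
lemma orbitIdeal_le_of_swap {w : Equiv.Perm (Fin n)} {i j : Fin n} (hij : i < j)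
    (hw : w i < w j) : orbitIdeal k w ≤ orbitIdeal k (w * Equiv.swap i j) := by
  intro f hf
  rw [mem_orbitIdeal_iff (K := AlgebraicClosure k)]
  intro L U hL hU
  have h : L * U.submatrix (w * Equiv.swap i j) id =
      L.submatrix id (Equiv.swap i j) * U.submatrix w id := by
    ext x y
    simp only [Matrix.mul_apply, Matrix.submatrix_apply, id]
    rw [← Equiv.sum_comp (Equiv.swap i j)]
    simp
  rw [h]
  refine evalAt_eq_zero_of_columns_limit hf hij hw hU (D := Matrix.of fun x b =>
    if b = i then L x i else 0) (fun b hb x hx => ?_) (fun b hb x hx => ?_) 0 (fun s => s⁻¹) ?_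
  · simp only [Matrix.submatrix_apply, id]
    by_cases hbi : b = i
    · subst hbi
      rw [Equiv.swap_apply_left]
      exact hL _ _ (hx.trans hij)
    · rw [Equiv.swap_apply_of_ne_of_ne hbi hb]
      exact hL _ _ hx
  · simp only [Matrix.of_apply]
    split_ifs with h
    · subst h; exact hL _ _ hx
    · rfl
  · intro s hs x hx
    simp [hij.ne', hL _ _ hx, inv_mul_cancel_left₀ hs]

/-- Interchange the rows `i` and `i + 1` of the generic matrix. -/
def swapRows (k : Type*) [Field k] (i : Fin (n - 1)) :
    MvPolynomial (Fin n × Fin n) k →ₐ[k] MvPolynomial (Fin n × Fin n) k :=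
  rename (Prod.map (simple i) id)

@[simp] lemma swapRows_swapRows (i : Fin (n - 1)) (f : MvPolynomial (Fin n × Fin n) k) :
    swapRows k i (swapRows k i f) = f := by
  rw [swapRows, rename_rename]
  have : (Prod.map (simple i) id ∘ Prod.map (simple i) id : Fin n × Fin n → _) = id := by
    funext s; simp [Prod.ext_iff]
  rw [this, rename_id_apply]

lemma evalAt_swapRows {A : Type*} [CommRing A] [Algebra k A] (Z : Matrix (Fin n) (Fin n) A)
    (i : Fin (n - 1)) (f : MvPolynomial (Fin n × Fin n) k) :
    evalAt Z (swapRows k i f) = evalAt (Z.submatrix (simple i) id) f := by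
  rw [evalAt, evalAt, swapRows, aeval_rename]
  rfl

lemma simple_lt_of_lt_of_ne {i : Fin (n - 1)} {x b : Fin n} (h : x < b) (hb : b ≠ hi i) :
    simple i x < b := by
  by_cases h1 : x = lo i
  · subst h1
    rw [simple_lo]
    refine lt_of_le_of_ne ?_ hb.symm
    simp only [lo, hi, Fin.lt_def, Fin.le_def] at *
    omega
  by_cases h2 : x = hi i
  · subst h2
    rw [simple_hi]
    exact (lo_lt_hi i).trans h
  · rwa [simple_of_ne h1 h2]

lemma eq_lo_or_lt_of_lt_hi {i : Fin (n - 1)} {x : Fin n} (h : x < hi i) : x = lo i ∨ x < lo i := by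
  simp only [lo, hi, Fin.lt_def, Fin.ext_iff] at *
  omega

/-- At an ascent the orbit closure is stable under exchanging the rows i and i+1. After the exchange
only one entry of L can lie above the diagonal, in row `lo i` and column `hi i`. It is a multiple of
the entry to its left once that entry, perturbed by s, is nonzero. -/
lemma swapRows_mem_orbitIdeal {w : Equiv.Perm (Fin n)} {i : Fin (n - 1)}
    (hw : w (lo i) < w (hi i)) {f : MvPolynomial (Fin n × Fin n) k} (hf : f ∈ orbitIdeal k w) :
    swapRows k i f ∈ orbitIdeal k w := by
  rw [mem_orbitIdeal_iff (K := AlgebraicClosure k)]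
  intro L U hL hU
  rw [evalAt_swapRows]
  have h : (L * U.submatrix w id).submatrix (simple i) id =
      L.submatrix (simple i) id * U.submatrix w id := by
    ext x y
    simp [Matrix.mul_apply]
  rw [h]
  refine evalAt_eq_zero_of_columns_limit hf (lo_lt_hi i) hw hU (D := Matrix.of fun x b =>
    if x = lo i ∧ b = lo i then 1 else 0) (fun b hb x hx => ?_) (fun b hb x hx => ?_)
    -- At this value of s the perturbed pivot L (hi i) (lo i) + s vanishes.
    (-L (hi i) (lo i)) (fun s => L (hi i) (hi i) / (L (hi i) (lo i) + s)) ?_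
  · exact hL _ _ (simple_lt_of_lt_of_ne hx hb)
  · simp only [Matrix.of_apply, ite_eq_right_iff, one_ne_zero, imp_false, not_and]
    rintro rfl rfl
    exact hx.false
  · intro s hs x hx
    have hs' : L (hi i) (lo i) + s ≠ 0 := fun h => hs (by linear_combination h)
    rcases eq_lo_or_lt_of_lt_hi hx with rfl | hx'
    · simp [(lo_lt_hi i).ne', div_mul_cancel₀ _ hs']
    · simp [hx'.ne, simple_of_ne hx'.ne hx.ne, hL _ _ hx, hL _ _ hx']

end Parametrization

/-! ## Ranks of northwest submatrices -/

section Ranks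

variable {n : ℕ} {k K : Type*} [Field k] [Field K] [Algebra k K]

lemma evalAt_minor {A : Type*} [CommRing A] [Algebra k A] (Z : Matrix (Fin n) (Fin n) A) {m : ℕ}
    (r c : Fin m → Fin n) :
    evalAt Z ((genericMatrix k n).submatrix r c).det = (Z.submatrix r c).det := by
  rw [AlgHom.map_det]
  congr 1
  ext a b
  simp [genericMatrix]

lemma schubertIdeal_le_varietyIdeal (w : Equiv.Perm (Fin n)) :
    schubertIdeal k w ≤ varietyIdeal k K w := by
  rw [schubertIdeal, Ideal.span_le]
  rintro f ⟨q, p, r, c, hr, hc, rfl⟩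
  rw [SetLike.mem_coe, varietyIdeal, idealOfMatrices, mem_vanishingIdeal_iff]
  rintro _ ⟨Z, hZ, rfl⟩
  refine (evalAt_minor (k := k) Z r c).trans ?_
  by_contra hdet
  have h1 := Matrix.rank_of_isUnit (Z.submatrix r c)
    ((Matrix.isUnit_iff_isUnit_det _).2 (isUnit_iff_ne_zero.2 hdet))
  have h2 := Matrix.rank_submatrix_le (northwest Z q p)
    (fun s => (⟨r s, hr s⟩ : {i // i ≤ q})) (fun s => (⟨c s, hc s⟩ : {j // j ≤ p}))
  have h3 := hZ q p
  rw [Fintype.card_fin] at h1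
  change (Z.submatrix r c).rank ≤ _ at h2
  omega

/-- In the northwest q × p part of L w U only the indices b ≤ q with w(b) ≤ p contribute, so the
product factors through that many dimensions. -/
lemma product_mem_matrixSchubertVariety (w : Equiv.Perm (Fin n)) {L U : Matrix (Fin n) (Fin n) K}
    (hL : IsLower L) (hU : IsUpper U) :
    L * U.submatrix w id ∈ matrixSchubertVariety K w := by
  intro q p
  have h : northwest (L * U.submatrix w id) q p =
      L.submatrix Subtype.val (Subtype.val : {b // b ≤ q ∧ w b ≤ p} → Fin n) *
        U.submatrix (fun b : {b // b ≤ q ∧ w b ≤ p} => w b.1) Subtype.val := by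
    ext x y
    simp only [northwest, Matrix.submatrix_apply, Matrix.mul_apply, id]
    rw [← Finset.sum_subtype (Finset.univ.filter fun b => b ≤ q ∧ w b ≤ p) (by simp)
      (fun b => L x b * U (w b) y)]
    refine (Finset.sum_subset (Finset.subset_univ _) fun b _ hb => ?_).symm
    simp only [Finset.mem_filter, Finset.mem_univ, true_and, not_and_or, not_le] at hb
    rcases hb with hb | hb
    · rw [hL _ _ (x.2.trans_lt hb), zero_mul]
    · rw [hU _ _ (lt_of_le_of_lt y.2 hb), mul_zero]
  rw [h]
  refine (Matrix.rank_mul_le_left _ _).trans ((Matrix.rank_le_card_width _).trans ?_)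
  rw [Fintype.card_subtype, nwRank]

lemma varietyIdeal_le_orbitIdeal [Infinite K] (w : Equiv.Perm (Fin n)) :
    varietyIdeal k K w ≤ orbitIdeal k w := by
  intro f hf
  rw [mem_orbitIdeal_iff (K := K)]
  intro L U hL hU
  exact hf _ ⟨_, product_mem_matrixSchubertVariety w hL hU, rfl⟩

lemma schubertIdeal_le_orbitIdeal (w : Equiv.Perm (Fin n)) :
    schubertIdeal k w ≤ orbitIdeal k w :=
  (schubertIdeal_le_varietyIdeal (K := AlgebraicClosure k) w).trans (varietyIdeal_le_orbitIdeal w)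

/-- Only the ones in rows i and j move, so the rank drops by exactly one on the rectangle between
them and is unchanged elsewhere. -/
lemma nwRank_swap {w : Equiv.Perm (Fin n)} {i j : Fin n} (hij : i < j) (hw : w i < w j)
    (q p : Fin n) :
    nwRank (w * Equiv.swap i j) q p + (if i ≤ q ∧ q < j ∧ w i ≤ p ∧ p < w j then 1 else 0) =
      nwRank w q p := by
  have hsum : ∀ v : Equiv.Perm (Fin n), nwRank v q p =
      (if i ≤ q ∧ v i ≤ p then 1 else 0) + ((if j ≤ q ∧ v j ≤ p then 1 else 0) +
        ∑ b ∈ (Finset.univ.erase i).erase j, if b ≤ q ∧ v b ≤ p then 1 else 0) := by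
    intro v
    rw [nwRank, Finset.card_filter, ← Finset.add_sum_erase _ _ (Finset.mem_univ i),
      ← Finset.add_sum_erase (Finset.univ.erase i) _
        (Finset.mem_erase.2 ⟨hij.ne', Finset.mem_univ j⟩)]
  have hrest : (∑ b ∈ (Finset.univ.erase i).erase j,
      if b ≤ q ∧ (w * Equiv.swap i j) b ≤ p then 1 else 0) =
      ∑ b ∈ (Finset.univ.erase i).erase j, if b ≤ q ∧ w b ≤ p then 1 else 0 := by
    refine Finset.sum_congr rfl fun b hb => ?_
    simp only [Finset.mem_erase] at hb
    rw [Equiv.Perm.mul_apply, Equiv.swap_apply_of_ne_of_ne hb.2.1 hb.1]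
  rw [hsum w, hsum, hrest]
  simp only [Equiv.Perm.mul_apply, Equiv.swap_apply_left, Equiv.swap_apply_right]
  generalize (∑ b ∈ (Finset.univ.erase i).erase j, if b ≤ q ∧ w b ≤ p then 1 else 0) = t
  simp only [Fin.lt_def, Fin.le_def] at *
  split_ifs <;> omega

/-- The sum of all ranks; it decreases in the Bruhat order. -/
def rankSum (w : Equiv.Perm (Fin n)) : ℕ := ∑ q, ∑ p, nwRank w q p

lemma rankSum_swap_lt {w : Equiv.Perm (Fin n)} {i j : Fin n} (hij : i < j) (hw : w i < w j) :
    rankSum (w * Equiv.swap i j) < rankSum w := by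
  have hle : ∀ q p, nwRank (w * Equiv.swap i j) q p ≤ nwRank w q p := fun q p => by
    have := nwRank_swap hij hw q p
    omega
  refine Finset.sum_lt_sum (fun q _ => Finset.sum_le_sum fun p _ => hle q p)
    ⟨i, Finset.mem_univ _, Finset.sum_lt_sum (fun p _ => hle i p) ⟨w i, Finset.mem_univ _, ?_⟩⟩
  have := nwRank_swap hij hw i (w i)
  rw [if_pos ⟨le_rfl, hij, le_rfl, hw⟩] at this
  omega

end Ranks

/-! ## Antidiagonals -/

section Antidiagonals

variable {n : ℕ}

/-- The set `S` of positions contains an antidiagonal of the form that occurs as the leading term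
of a generator of the Schubert determinantal ideal of `w`. -/
def HasAntidiagonal (w : Equiv.Perm (Fin n)) (S : Set (Fin n × Fin n)) : Prop :=
  ∃ (q p : Fin n) (m : ℕ) (r c : Fin m → Fin n), nwRank w q p < m ∧ StrictMono r ∧ StrictAnti c ∧
    (∀ t, r t ≤ q) ∧ (∀ t, c t ≤ p) ∧ ∀ t, (r t, c t) ∈ S

lemma HasAntidiagonal.mono {w : Equiv.Perm (Fin n)} {S T : Set (Fin n × Fin n)} (h : S ⊆ T) :
    HasAntidiagonal w S → HasAntidiagonal w T := by
  rintro ⟨q, p, m, r, c, h1, h2, h3, h4, h5, h6⟩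
  exact ⟨q, p, m, r, c, h1, h2, h3, h4, h5, fun t => h (h6 t)⟩

lemma nwRank_eq_zero {w : Equiv.Perm (Fin n)} {q p : Fin n} (h : ∀ b ≤ q, p < w b) :
    nwRank w q p = 0 := by
  rw [nwRank, Finset.card_eq_zero, Finset.filter_eq_empty_iff]
  rintro b - ⟨h1, h2⟩
  exact (h b h1).not_ge h2

lemma hasAntidiagonal_of_mem {w : Equiv.Perm (Fin n)} {S : Set (Fin n × Fin n)} {x y : Fin n}
    (h : (x, y) ∈ S) (h0 : ∀ b ≤ x, y < w b) : HasAntidiagonal w S :=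
  ⟨x, y, 1, fun _ => x, fun _ => y, by rw [nwRank_eq_zero h0]; exact one_pos,
    Subsingleton.strictMono _, Subsingleton.strictAnti _, fun _ => le_rfl, fun _ => le_rfl,
    fun _ => h⟩

lemma strictMono_fin_cons {m : ℕ} {α : Type*} [Preorder α] {a : α} {f : Fin m → α}
    (hf : StrictMono f) (ha : ∀ t, a < f t) : StrictMono (Fin.cons a f : Fin (m + 1) → α) := by
  intro s t hst
  induction t using Fin.cases with
  | zero => exact absurd hst (Fin.not_lt_zero s)
  | succ t =>
    induction s using Fin.cases with
    | zero => simpa using ha t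
    | succ s => simpa using hf (Fin.succ_lt_succ_iff.1 hst)

/-- The values above rev(i) are already taken by the positions before i. -/
lemma le_rev_of_le {w : Equiv.Perm (Fin n)} {i b : Fin n} (hlt : ∀ l < i, w l = Fin.rev l)
    (hb : i ≤ b) : w b ≤ Fin.rev i := by
  by_contra h
  have h1 : Fin.rev (w b) < i := by
    rw [← Fin.rev_lt_rev, Fin.rev_rev]; exact not_le.1 h
  have h2 := hlt _ h1
  rw [Fin.rev_rev] at h2
  have := w.injective h2
  exact absurd (this ▸ h1) hb.not_gt

/-- Above row i the set S avoids the corner, and in row i it starts to the right of column w(i). The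
row j is chosen so that an antidiagonal created by the swap lies strictly below row i and left of
the first element of S in row i. Prepending that element gives an antidiagonal for w itself; if
there is no such element, counting rows gives a contradiction. -/
lemma exists_swap_not_hasAntidiagonal {w : Equiv.Perm (Fin n)} {S : Set (Fin n × Fin n)}
    {i : Fin n} (hlt : ∀ l < i, w l = Fin.rev l) (hi : w i ≠ Fin.rev i)
    (hS : ¬ HasAntidiagonal w S) (hz : (i, w i) ∉ S) :
    ∃ j, i < j ∧ w i < w j ∧ ¬ HasAntidiagonal (w * Equiv.swap i j) S := by
  have hge : ∀ b, i ≤ b → w b ≤ Fin.rev i := fun b hb => le_rev_of_le hlt hb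
  -- The northwest box with corner (l, c) has rank zero, so a single element of S there is already
  -- an antidiagonal.
  have hA : ∀ l < i, ∀ c, c < Fin.rev l → (l, c) ∉ S := by
    intro l hl c hc hmem
    refine hS (hasAntidiagonal_of_mem hmem fun b hb => ?_)
    rw [hlt b (hb.trans_lt hl)]
    exact hc.trans_le (Fin.rev_le_rev.2 hb)
  have hB : ∀ c, c < w i → (i, c) ∉ S := by
    intro c hc hmem
    refine hS (hasAntidiagonal_of_mem hmem fun b hb => ?_)
    rcases hb.lt_or_eq with h | rfl
    · rw [hlt b h]
      exact hc.trans_le ((hge i le_rfl).trans (Fin.rev_le_rev.2 hb))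
    · exact hc
  -- u is the leftmost column of S in row i, capped at rev(i).
  obtain ⟨u, hu1, hu2, hu3, hu4⟩ : ∃ u, w i < u ∧ u ≤ Fin.rev i ∧ (∀ c < u, (i, c) ∉ S) ∧
      ((i, u) ∈ S ∨ u = Fin.rev i) := by
    by_cases h : ∃ c, c ≤ Fin.rev i ∧ (i, c) ∈ S
    · obtain ⟨u, ⟨hu, hmem⟩, hmin⟩ := wellFounded_lt.has_min {c | c ≤ Fin.rev i ∧ (i, c) ∈ S} h
      refine ⟨u, ?_, hu, fun c hc hcS => hmin c ⟨hc.le.trans hu, hcS⟩ hc, .inl hmem⟩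
      by_contra hc
      rcases (not_lt.1 hc).lt_or_eq with h1 | h1
      · exact hB u h1 hmem
      · exact hz (h1 ▸ hmem)
    · push Not at h
      exact ⟨Fin.rev i, lt_of_le_of_ne (hge i le_rfl) hi, le_rfl, fun c hc => h c hc.le, .inr rfl⟩
  -- j is the topmost row below i whose one lies in the columns (w(i), u]. The row with its one in
  -- column u qualifies, so j exists.
  obtain ⟨j, ⟨hj1, hj2, hj3⟩, hmin⟩ := wellFounded_lt.has_min
    {b | i < b ∧ w i < w b ∧ w b ≤ u} (by
      refine ⟨w.symm u, ?_, by simpa using hu1, by simp⟩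
      by_contra hc
      rcases (not_lt.1 hc).lt_or_eq with h1 | h1
      · have := hlt _ h1
        rw [Equiv.apply_symm_apply] at this
        rw [this, Fin.rev_le_rev] at hu2
        exact h1.not_ge hu2
      · rw [← h1] at hu1
        simp at hu1)
  refine ⟨j, hj1, hj2, ?_⟩
  rintro ⟨q, p, m, r, c, hm, hr, hc, hrq, hcp, hmem⟩
  -- Where the rank has not changed, the antidiagonal contradicts `hS`. So it lies in a box where
  -- the rank dropped by one.
  have hrank := nwRank_swap hj1 hj2 q p
  split_ifs at hrank with hcond
  swap
  · exact hS ⟨q, p, m, r, c, by omega, hr, hc, hrq, hcp, hmem⟩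
  obtain ⟨hiq, hqj, hip, hpj⟩ := hcond
  have hrow : ∀ t, i < r t := by
    intro t
    rcases lt_trichotomy (r t) i with h | h | h
    · refine absurd (hmem t) (hA _ h _ ?_)
      exact (((hcp t).trans_lt hpj).trans_le (hj3.trans hu2)).trans (Fin.rev_lt_rev.2 h)
    · refine absurd (hmem t) ?_
      rw [h]
      exact hu3 _ (((hcp t).trans_lt hpj).trans_le hj3)
    · exact h
  -- By minimality of j, no row up to q has its one in the columns (p, u]; the box can be widened
  -- from p to u without raising the rank.
  have hcol : ∀ b ≤ q, w b ≤ u → w b ≤ p := by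
    intro b hb hbu
    rcases lt_trichotomy b i with h | rfl | h
    · rw [hlt b h] at hbu
      exact absurd (hbu.trans hu2) (Fin.rev_lt_rev.2 h).not_ge
    · exact hip
    · by_contra hc
      exact hmin b ⟨h, hip.trans_lt (not_le.1 hc), hbu⟩ (hb.trans_lt hqj)
  rcases hu4 with hu4 | rfl
  -- Prepending (i, u) makes up for the rank that the swap lowered by one.
  · refine hS ⟨q, u, m + 1, Fin.cons i r, Fin.cons u c, ?_, strictMono_fin_cons hr hrow, ?_, ?_,
      ?_, ?_⟩
    · have : nwRank w q u ≤ nwRank w q p := by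
        refine Finset.card_le_card fun b hb => ?_
        simp only [Finset.mem_filter, Finset.mem_univ, true_and] at hb ⊢
        exact ⟨hb.1, hcol b hb.1 hb.2⟩
      omega
    · exact strictMono_fin_cons (α := (Fin n)ᵒᵈ) hc
        fun t => OrderDual.toDual_lt_toDual.2 (((hcp t).trans_lt hpj).trans_le hj3)
    · exact Fin.cases hiq hrq
    · exact Fin.cases le_rfl fun t => (((hcp t).trans_lt hpj).trans_le hj3).le
    · exact Fin.cases hu4 hmem
  -- Here the q − i + 1 rows from i to q all have their ones in columns ≤ p, so the rank is at least
  -- q − i + 1. It is also at most m, and the m rows of the antidiagonal lie in (i, q].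
  · have h1 : (Finset.Icc i q).card ≤ nwRank w q p := by
      refine Finset.card_le_card fun b hb => ?_
      simp only [Finset.mem_Icc, Finset.mem_filter, Finset.mem_univ, true_and] at hb ⊢
      exact ⟨hb.2, hcol b hb.2 (hge b hb.1)⟩
    have h2 : m ≤ (Finset.Ioc i q).card := by
      have := Finset.card_le_card_of_injOn (s := (Finset.univ : Finset (Fin m)))
        (t := Finset.Ioc i q) r (fun t _ => by simp [hrow t, hrq t]) hr.injective.injOn
      simpa using this
    rw [Fin.card_Icc] at h1
    rw [Fin.card_Ioc] at h2
    have : (i : ℕ) ≤ q := hiq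
    omega

end Antidiagonals

/-! ## Leading terms of minors -/

section LeadingTerms

variable {n : ℕ} {k : Type*} [Field k]

/-- The positions, ordered by rows and from right to left within a row. -/
def positionEquiv (n : ℕ) : Fin n × Fin n ≃ Fin n ×ₗ (Fin n)ᵒᵈ :=
  ((Equiv.refl _).prodCongr OrderDual.toDual).trans toLex

/-- An antidiagonal term order: the lexicographic order for which the variables decrease along the
rows from right to left, and from the first to the last row. -/
def antidiagonalOrder (n : ℕ) : MonomialOrder (Fin n × Fin n) where
  syn := (MonomialOrder.lex (σ := Fin n ×ₗ (Fin n)ᵒᵈ)).syn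
  toSyn := (Finsupp.domCongr (positionEquiv n)).trans
    (MonomialOrder.lex (σ := Fin n ×ₗ (Fin n)ᵒᵈ)).toSyn
  toSyn_monotone := fun a b hab => by
    have h : Finsupp.domCongr (positionEquiv n) a ≤ Finsupp.domCongr (positionEquiv n) b :=
      fun s => by simpa using hab ((positionEquiv n).symm s)
    exact (MonomialOrder.lex (σ := Fin n ×ₗ (Fin n)ᵒᵈ)).toSyn_monotone h

lemma antidiagonalOrder_lt {c d : Fin n × Fin n →₀ ℕ} (x y : Fin n)
    (h : ∀ x' y', (x' < x ∨ x' = x ∧ y < y') → c (x', y') = d (x', y'))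
    (hlt : c (x, y) < d (x, y)) :
    (antidiagonalOrder n).toSyn c < (antidiagonalOrder n).toSyn d := by
  change MonomialOrder.lex.toSyn (Finsupp.domCongr (positionEquiv n) c) <
    MonomialOrder.lex.toSyn (Finsupp.domCongr (positionEquiv n) d)
  rw [MonomialOrder.lex_lt_iff, Finsupp.Lex.lt_iff]
  refine ⟨positionEquiv n (x, y), fun t ht => ?_, by simpa using hlt⟩
  obtain ⟨⟨x', y'⟩, rfl⟩ := (positionEquiv n).surjective t
  have : x' < x ∨ x' = x ∧ y < y' := by
    simpa [positionEquiv, Prod.Lex.toLex_lt_toLex] using ht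
  simpa using h x' y' this

/-- The exponent of the term of a minor that belongs to the permutation `π`. -/
def minorExponent {m : ℕ} (r c : Fin m → Fin n) (π : Fin m → Fin m) : Fin n × Fin n →₀ ℕ :=
  ∑ t, Finsupp.single (r t, c (π t)) 1

lemma minorExponent_apply {m : ℕ} {r c : Fin m → Fin n} (hr : Function.Injective r)
    (π : Fin m → Fin m) (t : Fin m) (y : Fin n) :
    minorExponent r c π (r t, y) = if c (π t) = y then 1 else 0 := by
  rw [minorExponent, Finsupp.finsetSum_apply, Finset.sum_eq_single t]
  · simp [Finsupp.single_apply]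
  · intro s _ hs
    rw [Finsupp.single_apply, if_neg]
    intro h
    exact hs (hr (Prod.ext_iff.1 h).1)
  · simp

lemma minorExponent_apply_of_notMem {m : ℕ} {r c : Fin m → Fin n} (π : Fin m → Fin m) {x : Fin n}
    (hx : x ∉ Set.range r) (y : Fin n) : minorExponent r c π (x, y) = 0 := by
  rw [minorExponent, Finsupp.finsetSum_apply]
  refine Finset.sum_eq_zero fun s _ => ?_
  rw [Finsupp.single_apply, if_neg]
  intro h
  exact hx ⟨s, (Prod.ext_iff.1 h).1⟩

/-- At the first row where π leaves the reversal, π picks a column further left. The reversal then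
has the larger variable in that row, and the order compares that variable first. -/
lemma minorExponent_lt {m : ℕ} {r c : Fin m → Fin n} (hr : StrictMono r) (hc : StrictMono c)
    {π : Equiv.Perm (Fin m)} (hπ : π ≠ Fin.revPerm) :
    (antidiagonalOrder n).toSyn (minorExponent r c π) <
      (antidiagonalOrder n).toSyn (minorExponent r c Fin.rev) := by
  obtain ⟨t, ht, hmin⟩ := wellFounded_lt.has_min {t | π t ≠ Fin.rev t} (by
    by_contra h
    refine hπ (Equiv.ext fun t => ?_)
    by_contra ht
    exact h ⟨t, ht⟩)
  have hlt : ∀ l < t, π l = Fin.rev l := fun l hl => by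
    by_contra h
    exact hmin l h hl
  have h1 : π t < Fin.rev t := lt_of_le_of_ne (le_rev_of_le hlt le_rfl) ht
  refine antidiagonalOrder_lt (r t) (c (Fin.rev t)) ?_ ?_
  · intro x' y' h
    by_cases hx : x' ∈ Set.range r
    · obtain ⟨s, rfl⟩ := hx
      rw [minorExponent_apply hr.injective, minorExponent_apply hr.injective]
      rcases h with h | ⟨h, h'⟩
      · rw [hlt s (hr.lt_iff_lt.1 h)]
      · obtain rfl := hr.injective h
        rw [if_neg ((hc h1).trans h').ne, if_neg h'.ne]
    · rw [minorExponent_apply_of_notMem _ hx, minorExponent_apply_of_notMem _ hx]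
  · rw [minorExponent_apply hr.injective, minorExponent_apply hr.injective, if_pos rfl,
      if_neg (hc h1).ne]
    exact one_pos

lemma minor_eq_sum {m : ℕ} (r c : Fin m → Fin n) :
    ((genericMatrix k n).submatrix r c).det =
      ∑ π : Equiv.Perm (Fin m), monomial (minorExponent r c π) ((Equiv.Perm.sign π : ℤ) : k) := by
  rw [← Matrix.det_transpose, Matrix.det_apply']
  refine Finset.sum_congr rfl fun π _ => ?_
  simp only [Matrix.transpose_apply, Matrix.submatrix_apply, genericMatrix, Matrix.of_apply]
  rw [minorExponent, monomial_sum_index]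
  simp [X, mul_comm]

lemma coeff_minor {m : ℕ} {r c : Fin m → Fin n} (hr : StrictMono r) (hc : StrictMono c) :
    coeff (minorExponent r c Fin.rev) ((genericMatrix k n).submatrix r c).det =
      ((Equiv.Perm.sign (Fin.revPerm : Equiv.Perm (Fin m)) : ℤ) : k) := by
  rw [minor_eq_sum, coeff_sum, Finset.sum_eq_single Fin.revPerm]
  · exact coeff_monomial _ _ _ |>.trans (if_pos rfl)
  · intro π _ hπ
    rw [coeff_monomial, if_neg]
    intro h
    exact (minorExponent_lt hr hc hπ).ne (by rw [h])
  · simp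

lemma sign_ne_zero {m : ℕ} (π : Equiv.Perm (Fin m)) : ((Equiv.Perm.sign π : ℤ) : k) ≠ 0 := by
  rcases Int.units_eq_one_or (Equiv.Perm.sign π) with h | h <;> simp [h]

lemma degree_minor {m : ℕ} {r c : Fin m → Fin n} (hr : StrictMono r) (hc : StrictMono c) :
    (antidiagonalOrder n).degree ((genericMatrix k n).submatrix r c).det =
      minorExponent r c Fin.rev := by
  apply (antidiagonalOrder n).toSyn.injective
  apply le_antisymm
  · rw [MonomialOrder.degree_le_iff]
    intro d hd
    rw [mem_support_iff, minor_eq_sum, coeff_sum] at hd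
    obtain ⟨π, -, hπ⟩ := Finset.exists_ne_zero_of_sum_ne_zero hd
    rw [coeff_monomial] at hπ
    obtain rfl : minorExponent r c π = d := by
      by_contra h
      exact hπ (if_neg h)
    by_cases h : π = Fin.revPerm
    · subst h; exact le_rfl
    · exact (minorExponent_lt hr hc h).le
  · refine MonomialOrder.le_degree ?_
    rw [mem_support_iff, coeff_minor hr hc]
    exact sign_ne_zero _

/-- The generators of the Schubert determinantal ideal. -/
def schubertGenerators (k : Type*) [Field k] (w : Equiv.Perm (Fin n)) :
    Set (MvPolynomial (Fin n × Fin n) k) :=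
  {f | ∃ (q p : Fin n) (r c : Fin (1 + nwRank w q p) ↪o Fin n),
    (∀ s, r s ≤ q) ∧ (∀ s, c s ≤ p) ∧ f = ((genericMatrix k n).submatrix r c).det}

lemma schubertIdeal_eq_span (w : Equiv.Perm (Fin n)) :
    schubertIdeal k w = Ideal.span (schubertGenerators k w) := rfl

lemma isUnit_leadingCoeff {w : Equiv.Perm (Fin n)} {b : MvPolynomial (Fin n × Fin n) k}
    (hb : b ∈ schubertGenerators k w) : IsUnit ((antidiagonalOrder n).leadingCoeff b) := by
  obtain ⟨q, p, r, c, -, -, rfl⟩ := hb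
  rw [MonomialOrder.leadingCoeff, degree_minor r.strictMono c.strictMono,
    coeff_minor r.strictMono c.strictMono]
  exact (sign_ne_zero _).isUnit

lemma hasAntidiagonal_of_degree_le {w : Equiv.Perm (Fin n)} {b : MvPolynomial (Fin n × Fin n) k}
    (hb : b ∈ schubertGenerators k w) {d : Fin n × Fin n →₀ ℕ}
    (h : (antidiagonalOrder n).degree b ≤ d) : HasAntidiagonal w d.support := by
  obtain ⟨q, p, r, c, hr, hc, rfl⟩ := hb
  rw [degree_minor r.strictMono c.strictMono] at h
  refine ⟨q, p, 1 + nwRank w q p, r, c ∘ Fin.rev, by omega, r.strictMono,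
    c.strictMono.comp_strictAnti Fin.rev_strictAnti, hr, fun t => hc _, fun t => ?_⟩
  have := h (r t, c (Fin.rev t))
  rw [minorExponent_apply r.injective, if_pos rfl] at this
  simp only [Function.comp_apply, Finset.mem_coe, Finsupp.mem_support_iff]
  omega

/-- With `hasAntidiagonal_of_degree_le`, this says that containing an antidiagonal means
divisibility by the leading monomial of a generator. -/
lemma exists_degree_le_of_hasAntidiagonal {w : Equiv.Perm (Fin n)} {d : Fin n × Fin n →₀ ℕ}
    (h : HasAntidiagonal w d.support) :
    ∃ b ∈ schubertGenerators k w, (antidiagonalOrder n).degree b ≤ d := by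
  obtain ⟨q, p, m, r, c, hm, hr, hc, hrq, hcp, hmem⟩ := h
  -- The antidiagonal may be longer than the generators; its first 1 + rank entries suffice.
  have hle : 1 + nwRank w q p ≤ m := by omega
  have hr' : StrictMono (r ∘ Fin.castLE hle) := hr.comp (Fin.strictMono_castLE hle)
  have hc' : StrictMono (c ∘ Fin.castLE hle ∘ Fin.rev) :=
    hc.comp ((Fin.strictMono_castLE hle).comp_strictAnti Fin.rev_strictAnti)
  refine ⟨_, ⟨q, p, OrderEmbedding.ofStrictMono _ hr', OrderEmbedding.ofStrictMono _ hc',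
    fun s => hrq _, fun s => hcp _, rfl⟩, ?_⟩
  rw [degree_minor (OrderEmbedding.strictMono _) (OrderEmbedding.strictMono _)]
  rintro ⟨x, y⟩
  by_cases hx : x ∈ Set.range (r ∘ Fin.castLE hle)
  · obtain ⟨t, rfl⟩ := hx
    refine (minorExponent_apply hr'.injective _ t y).le.trans ?_
    split_ifs with hy
    · have := hmem (Fin.castLE hle t)
      simp only [OrderEmbedding.coe_ofStrictMono, Function.comp_apply, Fin.rev_rev] at hy
      rw [hy, Finset.mem_coe, Finsupp.mem_support_iff] at this
      exact Nat.one_le_iff_ne_zero.2 this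
    · exact Nat.zero_le _
  · exact (minorExponent_apply_of_notMem _ hx y).le.trans (Nat.zero_le _)

end LeadingTerms

/-! ## Setting variables to zero -/

section SetZero

variable {σ k : Type*} [Field k]

open Classical in
/-- Set the variables in `V` to zero. -/
def setZero (k : Type*) [Field k] (V : Set σ) : MvPolynomial σ k →ₐ[k] MvPolynomial σ k :=
  aeval fun s => if s ∈ V then 0 else X s

open Classical in
lemma setZero_monomial (V : Set σ) (d : σ →₀ ℕ) (a : k) :
    setZero k V (monomial d a) = if ∀ s ∈ V, d s = 0 then monomial d a else 0 := by
  rw [setZero, aeval_monomial]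
  split_ifs with h
  · rw [monomial_eq]
    congr 1
    refine Finset.prod_congr rfl fun s hs => ?_
    simp only [if_neg fun hV => Finsupp.mem_support_iff.1 hs (h s hV)]
  · push Not at h
    obtain ⟨s, hV, hs⟩ := h
    rw [Finsupp.prod, Finset.prod_eq_zero (Finsupp.mem_support_iff.2 hs), mul_zero]
    rw [if_pos hV, zero_pow hs]

open Classical in
lemma coeff_setZero (V : Set σ) (f : MvPolynomial σ k) (d : σ →₀ ℕ) :
    coeff d (setZero k V f) = if ∀ s ∈ V, d s = 0 then coeff d f else 0 := by
  induction f using MvPolynomial.induction_on' with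
  | monomial e a =>
    rw [setZero_monomial]
    by_cases hed : e = d
    · subst hed
      split_ifs <;> simp
    · split_ifs <;> simp [coeff_monomial, hed]
  | add p q hp hq =>
    rw [map_add, coeff_add, hp, hq, coeff_add]
    split_ifs <;> simp

lemma sub_setZero_mem (V : Set σ) (f : MvPolynomial σ k) :
    f - setZero k V f ∈ Ideal.span (X '' V : Set (MvPolynomial σ k)) := by
  rw [← Ideal.Quotient.eq]
  have h : (Ideal.Quotient.mkₐ k (Ideal.span (X '' V : Set (MvPolynomial σ k)))) =
      (Ideal.Quotient.mkₐ k _).comp (setZero k V) := by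
    refine MvPolynomial.algHom_ext fun s => ?_
    simp only [AlgHom.comp_apply, setZero, aeval_X, Ideal.Quotient.mkₐ_eq_mk]
    split_ifs with hs
    · rw [map_zero, Ideal.Quotient.eq_zero_iff_mem]
      exact Ideal.subset_span ⟨s, hs, rfl⟩
    · rfl
  exact congrArg (fun φ : MvPolynomial σ k →ₐ[k] _ => φ f) h

lemma ker_setZero (V : Set σ) :
    RingHom.ker (setZero k V) = Ideal.span (X '' V : Set (MvPolynomial σ k)) := by
  apply le_antisymm
  · intro f hf
    have := sub_setZero_mem V f
    rwa [RingHom.mem_ker.1 hf, sub_zero] at this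
  · rw [Ideal.span_le]
    rintro _ ⟨s, hs, rfl⟩
    simp [setZero, hs]

end SetZero

/-! ## Schubert determinantal ideals are prime -/

section Prime

variable {n : ℕ} {k K : Type*} [Field k] [Field K] [Algebra k K]

/-- Division by the minors, whose leading coefficients are units. The last clause records the degree
bound of the division: when the remainder is zero, the leading monomial of f is a multiple of the
leading monomial of some generator. -/
lemma exists_remainder (w : Equiv.Perm (Fin n)) (f : MvPolynomial (Fin n × Fin n) k) :
    ∃ g ∈ schubertIdeal k w, (∀ d ∈ (f - g).support, ¬ HasAntidiagonal w d.support) ∧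
      (f = g → f ≠ 0 → HasAntidiagonal w ((antidiagonalOrder n).degree f).support) := by
  obtain ⟨q, r, hf, hq, hr⟩ := (antidiagonalOrder n).div_set
    (B := schubertGenerators k w) (fun b hb => isUnit_leadingCoeff hb) f
  refine ⟨f - r, ?_, ?_, ?_⟩
  · rw [hf, add_sub_cancel_right, Finsupp.linearCombination_apply]
    exact Ideal.sum_mem _ fun b _ => Ideal.mul_mem_left _ _ (Ideal.subset_span b.2)
  · intro d hd h
    rw [sub_sub_cancel] at hd
    obtain ⟨b, hb, hbd⟩ := exists_degree_le_of_hasAntidiagonal (k := k) h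
    exact hr d hd b hb hbd
  · intro h hf0
    have hr0 : r = 0 := by linear_combination h
    rw [hr0, add_zero, Finsupp.linearCombination_apply, Finsupp.sum] at hf
    -- Some product of a quotient and a generator contributes to the leading coefficient of f. Its
    -- degree is at most that of f, hence equal to it.
    have hcoeff := MonomialOrder.coeff_degree_ne_zero_iff (m := antidiagonalOrder n).2 hf0
    nth_rw 2 [hf] at hcoeff
    rw [coeff_sum] at hcoeff
    obtain ⟨b, -, hb⟩ := Finset.exists_ne_zero_of_sum_ne_zero hcoeff
    rw [smul_eq_mul, mul_comm] at hb
    have h1 := MonomialOrder.le_degree (m := antidiagonalOrder n) (mem_support_iff.2 hb)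
    have h2 := (antidiagonalOrder n).toSyn.injective (le_antisymm h1 (hq b))
    have h3 : (b : MvPolynomial (Fin n × Fin n) k) * q b ≠ 0 := fun h => hb (by rw [h, coeff_zero])
    rw [h2]
    refine hasAntidiagonal_of_degree_le b.2 ?_
    rw [MonomialOrder.degree_mul' h3]
    exact le_self_add

lemma eq_zero_of_evalAt [Infinite K] {f : MvPolynomial (Fin n × Fin n) k}
    (h : ∀ Z : Matrix (Fin n) (Fin n) K, evalAt Z f = 0) : f = 0 := by
  apply MvPolynomial.map_injective (algebraMap k K) (algebraMap k K).injective
  rw [map_zero]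
  refine MvPolynomial.funext fun x => ?_
  rw [map_zero, eval_map, ← aeval_def]
  exact h fun a b => x (a, b)

/-- Every matrix that vanishes above the antidiagonal is L w₀ with L lower triangular, so f vanishes
on all of them. A polynomial without the corner variables is determined by its values there. -/
lemma eq_zero_of_setZero_eq {f : MvPolynomial (Fin n × Fin n) k}
    (hf : f ∈ orbitIdeal k (Fin.revPerm : Equiv.Perm (Fin n)))
    (hself : setZero k {s : Fin n × Fin n | s.2 < Fin.rev s.1} f = f) : f = 0 := by
  refine eq_zero_of_evalAt (K := AlgebraicClosure k) fun Z => ?_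
  have hZ : evalAt Z f = evalAt (Matrix.of fun x y => if y < Fin.rev x then 0 else Z x y) f := by
    conv_lhs => rw [← hself]
    rw [← AlgHom.comp_apply]
    congr 1
    refine MvPolynomial.algHom_ext fun s => ?_
    simp only [AlgHom.comp_apply, setZero, aeval_X, evalAt_X, Matrix.of_apply, Set.mem_ofPred_eq]
    split_ifs <;> simp
  rw [hZ]
  set Z' : Matrix (Fin n) (Fin n) (AlgebraicClosure k) :=
    Matrix.of fun x y => if y < Fin.rev x then 0 else Z x y with hZ'
  -- Reversing the columns of `Z'` gives a lower triangular matrix, and w₀ reverses them back; take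
  -- U = 1.
  have := (mem_orbitIdeal_iff (K := AlgebraicClosure k)).1 hf (Z'.submatrix id Fin.rev) 1
    (fun x b hxb => by simp [hZ', Fin.rev_lt_rev.2 hxb])
    (fun c y hcy => Matrix.one_apply_ne hcy.ne')
  convert! this using 2
  congr 1
  ext x y
  rw [Matrix.mul_apply, Finset.sum_eq_single (Fin.rev y)]
  · have h1 : (1 : Matrix (Fin n) (Fin n) (AlgebraicClosure k)).submatrix Fin.revPerm id
        (Fin.rev y) y = 1 := by
      rw [Matrix.submatrix_apply, Fin.revPerm_apply, Fin.rev_rev]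
      exact Matrix.one_apply_eq y
    rw [h1, mul_one, Matrix.submatrix_apply, Fin.rev_rev]
    rfl
  · intro b _ hb
    rw [Matrix.submatrix_apply, Matrix.submatrix_apply, Matrix.one_apply_ne, mul_zero]
    intro h
    exact hb (by rw [← show Fin.revPerm b = y from h]; simp)
  · simp

lemma eq_zero_of_mem_orbitIdeal_long {f : MvPolynomial (Fin n × Fin n) k}
    (hf : f ∈ orbitIdeal k (Fin.revPerm : Equiv.Perm (Fin n)))
    (hstd : ∀ d ∈ f.support, ¬ HasAntidiagonal Fin.revPerm (d.support : Set (Fin n × Fin n))) :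
    f = 0 := by
  refine eq_zero_of_setZero_eq hf ?_
  ext d
  rw [coeff_setZero]
  split_ifs with h
  · rfl
  · by_contra hne
    push Not at h
    obtain ⟨⟨x, y⟩, hs, hd⟩ := h
    refine hstd d (mem_support_iff.2 (Ne.symm hne)) (hasAntidiagonal_of_mem (x := x) (y := y)
      (by simpa using hd) fun b hb => ?_)
    exact lt_of_lt_of_le hs (Fin.rev_le_rev.2 hb)

lemma X_notMem_orbitIdeal (w : Equiv.Perm (Fin n)) (i : Fin n) :
    (X (i, w i) : MvPolynomial (Fin n × Fin n) k) ∉ orbitIdeal k w := by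
  intro h
  have := (mem_orbitIdeal_iff (K := AlgebraicClosure k)).1 h 1 1
    (fun x b hxb => Matrix.one_apply_ne hxb.ne) (fun c y hcy => Matrix.one_apply_ne hcy.ne')
  simp only [evalAt_X, Matrix.one_mul] at this
  exact one_ne_zero ((Matrix.one_apply_eq (w i)).symm.trans this)

lemma X_mem_orbitIdeal {w : Equiv.Perm (Fin n)} {x y : Fin n} (h : ∀ b ≤ x, y < w b) :
    (X (x, y) : MvPolynomial (Fin n × Fin n) k) ∈ orbitIdeal k w := by
  rw [mem_orbitIdeal, orbitMap, evalAt_X, Matrix.mul_apply]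
  refine Finset.sum_eq_zero fun b _ => ?_
  by_cases hb : b ≤ x
  · rw [Matrix.submatrix_apply, id, isUpper_genericUpper _ _ (h b hb), mul_zero]
  · rw [isLower_genericLower _ _ (not_le.1 hb), zero_mul]

/-- The inductive heart of the Gröbner basis argument: an outer induction on `rankSum` towards w₀,
and for fixed w an inner induction on the degree, which cancels the variable z_{i,w(i)} of the first
row where w differs from w₀. -/
lemma eq_zero_of_mem_orbitIdeal : ∀ (N : ℕ) (w : Equiv.Perm (Fin n)), rankSum w ≤ N →
    ∀ f : MvPolynomial (Fin n × Fin n) k, f ∈ orbitIdeal k w →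
      (∀ d ∈ f.support, ¬ HasAntidiagonal w (d.support : Set (Fin n × Fin n))) → f = 0 := by
  intro N
  induction N using Nat.strong_induction_on with
  | _ N IH =>
  intro w hN
  by_cases hw : w = Fin.revPerm
  · subst hw
    exact fun f => eq_zero_of_mem_orbitIdeal_long
  obtain ⟨i, hi, hmin⟩ := wellFounded_lt.has_min {i | w i ≠ Fin.rev i} (by
    by_contra h
    refine hw (Equiv.ext fun t => ?_)
    by_contra ht
    exact h ⟨t, ht⟩)
  have hlt : ∀ l < i, w l = Fin.rev l := fun l hl => by
    by_contra h
    exact hmin l h hl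
  have hdeg : ∀ D (f : MvPolynomial (Fin n × Fin n) k), f.totalDegree < D → f ∈ orbitIdeal k w →
      (∀ d ∈ f.support, ¬ HasAntidiagonal w (d.support : Set (Fin n × Fin n))) → f = 0 := by
    intro D
    induction D with
    | zero => intro f hf; omega
    | succ D ihD =>
      intro f hfD hf hstd
      -- Otherwise its leading monomial omits z_{i,w(i)} and so has no antidiagonal for some larger
      -- w·(i j). But the polynomial lies in that orbit ideal, where the induction hypothesis makes
      -- its remainder zero and forces an antidiagonal.
      have hf0 : setZero k {(i, w i)} f = 0 := by
        by_contra hne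
        have hsupp := MonomialOrder.degree_mem_support (m := antidiagonalOrder n) hne
        set d := (antidiagonalOrder n).degree (setZero k {(i, w i)} f) with hd
        rw [mem_support_iff, coeff_setZero] at hsupp
        split_ifs at hsupp with hz
        swap
        · exact hsupp rfl
        obtain ⟨j, hj, hwj, hanti⟩ := exists_swap_not_hasAntidiagonal hlt hi
          (hstd d (mem_support_iff.2 hsupp)) (by simpa using hz)
        have hX : (X (i, w i) : MvPolynomial (Fin n × Fin n) k) ∈
            orbitIdeal k (w * Equiv.swap i j) := by
          -- After the swap no row up to i has its one in a column ≤ w(i): earlier rows agree with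
          -- w₀, and row i has it in column w(j).
          refine X_mem_orbitIdeal fun b hb => ?_
          rcases hb.lt_or_eq with h | rfl
          · rw [Equiv.Perm.mul_apply, Equiv.swap_apply_of_ne_of_ne h.ne (h.trans hj).ne, hlt b h]
            exact (le_rev_of_le hlt le_rfl).trans_lt (Fin.rev_lt_rev.2 h)
          · simpa using hwj
        have hmem : setZero k {(i, w i)} f ∈ orbitIdeal k (w * Equiv.swap i j) := by
          have h1 := sub_setZero_mem {(i, w i)} f
          rw [Set.image_singleton] at h1
          have h2 := (Ideal.span_singleton_le_iff_mem _).2 hX h1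
          have h3 := orbitIdeal_le_of_swap hj hwj hf
          simpa using sub_mem h3 h2
        obtain ⟨g, hg, hrem, hlead⟩ := exists_remainder (w * Equiv.swap i j)
          (setZero k {(i, w i)} f)
        have := IH _ ((rankSum_swap_lt hj hwj).trans_le hN) _ le_rfl _
          (sub_mem hmem (schubertIdeal_le_orbitIdeal _ hg)) hrem
        exact hanti (hlead (sub_eq_zero.1 this) hne)
      -- Now divide by z_{i,w(i)}, which is not in the prime orbit ideal; dividing only shrinks the
      -- supports of the monomials.
      have hdvd : X (i, w i) ∣ f := by
        have h1 := sub_setZero_mem {(i, w i)} f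
        rwa [hf0, sub_zero, Set.image_singleton, Ideal.mem_span_singleton] at h1
      obtain ⟨g, rfl⟩ := hdvd
      by_contra hne
      have hg0 : g ≠ 0 := fun h => hne (by rw [h, mul_zero])
      refine hg0 (ihD g ?_ ?_ ?_)
      · rw [totalDegree_mul_of_isDomain (X_ne_zero _) hg0, totalDegree_X] at hfD
        omega
      · exact ((orbitIdeal_isPrime w).mem_or_mem hf).resolve_left (X_notMem_orbitIdeal w i)
      · intro d hd h
        refine hstd (Finsupp.single (i, w i) 1 + d) ?_ (h.mono ?_)
        · rw [mem_support_iff, coeff_X_mul]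
          exact mem_support_iff.1 hd
        · intro s hs
          simp only [Finset.mem_coe, Finsupp.mem_support_iff, Finsupp.add_apply] at hs ⊢
          omega
  exact fun f => hdeg _ f (Nat.lt_succ_self _)

/-- The Schubert determinantal ideal is the ideal of the closure of an orbit. -/
theorem schubertIdeal_eq_orbitIdeal (w : Equiv.Perm (Fin n)) :
    schubertIdeal k w = orbitIdeal k w := by
  refine le_antisymm (schubertIdeal_le_orbitIdeal w) fun f hf => ?_
  obtain ⟨g, hg, hrem, -⟩ := exists_remainder w f
  have := eq_zero_of_mem_orbitIdeal _ w le_rfl _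
    (sub_mem hf (schubertIdeal_le_orbitIdeal _ hg)) hrem
  rwa [sub_eq_zero.1 this]

theorem schubertIdeal_eq_varietyIdeal [Infinite K] (w : Equiv.Perm (Fin n)) :
    schubertIdeal k w = varietyIdeal k K w := by
  refine le_antisymm (schubertIdeal_le_varietyIdeal w) ?_
  rw [schubertIdeal_eq_orbitIdeal]
  exact varietyIdeal_le_orbitIdeal w

end Prime

/-! ### Hilbert functions determine K-polynomials -/

/-! ## Functions on `ℤ^ι` as a module over the Laurent polynomials -/

section Convolution

variable {σ ι : Type*}

/-- The translation of functions on `ℤ^ι`. -/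
def shift : Multiplicative (ι → ℤ) →* Module.End ℤ ((ι → ℤ) → ℤ) where
  toFun b := LinearMap.funLeft ℤ ℤ fun γ => γ - b.toAdd
  map_one' := by
    ext F γ
    simp [LinearMap.funLeft_apply]
  map_mul' a b := by
    ext F γ
    simp only [LinearMap.funLeft_apply, toAdd_mul, Module.End.mul_apply]
    congr 1
    abel

/-- The action of the Laurent polynomials on the functions on `ℤ^ι` by translations. -/
def convolve : Laurent ι →ₐ[ℤ] Module.End ℤ ((ι → ℤ) → ℤ) :=
  AddMonoidAlgebra.lift ℤ (Module.End ℤ ((ι → ℤ) → ℤ)) (ι → ℤ) shift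

@[simp] lemma convolve_laurentMonomial (b : ι → ℤ) (F : (ι → ℤ) → ℤ) (γ : ι → ℤ) :
    convolve (laurentMonomial b) F γ = F (γ - b) := by
  rw [convolve, laurentMonomial, AddMonoidAlgebra.lift_single, one_smul]
  rfl

lemma laurentMonomial_add (a b : ι → ℤ) :
    laurentMonomial (a + b) = laurentMonomial a * laurentMonomial b := by
  rw [laurentMonomial, laurentMonomial, laurentMonomial, AddMonoidAlgebra.single_mul_single,
    one_mul]

lemma single_eq_smul (b : ι → ℤ) (c : ℤ) :
    (AddMonoidAlgebra.single b c : Laurent ι) = c • laurentMonomial b := by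
  rw [laurentMonomial, AddMonoidAlgebra.smul_single, smul_eq_mul, mul_one]

open Classical in
lemma convolve_delta (P : Laurent ι) (γ : ι → ℤ) :
    convolve P (fun γ => if γ = 0 then 1 else 0) γ = P.coeff γ := by
  induction P using AddMonoidAlgebra.induction_linear with
  | zero => simp
  | add p q hp hq => simp [hp, hq]
  | single m r =>
    rw [single_eq_smul, map_smul, LinearMap.smul_apply, Pi.smul_apply, convolve_laurentMonomial,
      laurentMonomial, AddMonoidAlgebra.coeff_smul, Finsupp.smul_apply,
      AddMonoidAlgebra.coeff_single, Finsupp.single_apply]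
    simp only [sub_eq_zero, eq_comm]

end Convolution

/-! ## Counting monomials -/

section Counting

variable {σ ι : Type*}

/-- The monomials of degree `γ` that avoid the variables in `V`. -/
def gradedMonomials (a : σ → ι → ℤ) (V : Finset σ) (γ : ι → ℤ) : Set (σ →₀ ℕ) :=
  {d | Finsupp.weight a d = γ ∧ ∀ s ∈ V, d s = 0}

/-- The grading of the variables by `a` refines the standard grading. -/
def RefinesStandard (a : σ → ι → ℤ) : Prop := ∃ ℓ : (ι → ℤ) →+ ℤ, ∀ s, ℓ (a s) = 1

lemma RefinesStandard.exists_degree {a : σ → ι → ℤ} (ha : RefinesStandard a) :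
    ∃ ℓ : (ι → ℤ) →+ ℤ, ∀ d : σ →₀ ℕ, ℓ (Finsupp.weight a d) = (Finsupp.degree d : ℕ) := by
  obtain ⟨ℓ, hℓ⟩ := ha
  refine ⟨ℓ, fun d => ?_⟩
  induction d using Finsupp.induction_linear with
  | zero => simp
  | add f g hf hg => simp [hf, hg]
  | single s n => rw [Finsupp.weight_single, map_nsmul, hℓ]; simp

lemma RefinesStandard.eq_zero_of_weight {a : σ → ι → ℤ} (ha : RefinesStandard a) {d : σ →₀ ℕ}
    (h : Finsupp.weight a d = 0) : d = 0 := by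
  obtain ⟨ℓ, hℓ⟩ := ha.exists_degree
  have := hℓ d
  rw [h, map_zero] at this
  exact (Finsupp.degree_eq_zero_iff d).1 (by exact_mod_cast this.symm)

variable [Finite σ]

/-- The linear form ℓ bounds the total degree. Finiteness keeps the cardinalities and dimensions
below from taking their default value 0. -/
lemma finite_gradedMonomials {a : σ → ι → ℤ} (ha : RefinesStandard a) (V : Finset σ)
    (γ : ι → ℤ) : (gradedMonomials a V γ).Finite := by
  obtain ⟨ℓ, hℓ⟩ := ha.exists_degree
  refine (Finsupp.finite_of_degree_le (ℓ γ).toNat).subset fun d hd => ?_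
  have := hℓ d
  rw [hd.1] at this
  simp only [Set.mem_ofPred_eq]
  omega

/-- The number of monomials of degree `γ` that avoid the variables in `V`. -/
def monomialCount (a : σ → ι → ℤ) (V : Finset σ) (γ : ι → ℤ) : ℤ := (gradedMonomials a V γ).ncard

open Classical in
-- A monomial that avoids V either avoids s too or is z_s times a monomial that avoids V. Each
-- factor 1 − t^{a_s} thus removes one variable.
lemma monomialCount_insert {a : σ → ι → ℤ} (ha : RefinesStandard a) {V : Finset σ} {s : σ}
    (hs : s ∉ V) (γ : ι → ℤ) :
    monomialCount a (insert s V) γ = monomialCount a V γ - monomialCount a V (γ - a s) := by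
  have h : gradedMonomials a V γ = gradedMonomials a (insert s V) γ ∪
      (fun d => d + Finsupp.single s 1) '' gradedMonomials a V (γ - a s) := by
    ext d
    simp only [gradedMonomials, Set.mem_ofPred_eq, Set.mem_union, Finset.forall_mem_insert,
      Set.mem_image]
    constructor
    · rintro ⟨hd, hV⟩
      by_cases h0 : d s = 0
      · exact .inl ⟨hd, h0, hV⟩
      · have hle : Finsupp.single s 1 ≤ d := by
          rw [Finsupp.single_le_iff]; exact Nat.one_le_iff_ne_zero.2 h0
        refine .inr ⟨d - Finsupp.single s 1, ⟨?_, fun t ht => ?_⟩, tsub_add_cancel_of_le hle⟩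
        · rw [eq_sub_iff_add_eq, ← hd]
          conv_rhs => rw [← tsub_add_cancel_of_le hle]
          rw [map_add, Finsupp.weight_single, one_smul]
        · simp [hV t ht]
    · rintro (⟨hd, -, hV⟩ | ⟨e, ⟨he, hV⟩, rfl⟩)
      · exact ⟨hd, hV⟩
      · refine ⟨by rw [map_add, he, Finsupp.weight_single, one_smul, sub_add_cancel],
          fun t ht => ?_⟩
        rw [Finsupp.add_apply, hV t ht, Finsupp.single_apply,
          if_neg (by rintro rfl; exact hs ht), add_zero]
  have hdisj : Disjoint (gradedMonomials a (insert s V) γ)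
      ((fun d => d + Finsupp.single s 1) '' gradedMonomials a V (γ - a s)) := by
    rw [Set.disjoint_left]
    rintro _ ⟨-, h1⟩ ⟨e, -, rfl⟩
    simpa using h1 s (Finset.mem_insert_self _ _)
  have hcard := Set.ncard_union_eq hdisj (finite_gradedMonomials ha _ _)
    ((finite_gradedMonomials ha _ _).image _)
  rw [← h, Set.ncard_image_of_injective _ (add_left_injective _)] at hcard
  simp only [monomialCount]
  omega

lemma convolve_prod_monomialCount {a : σ → ι → ℤ} (ha : RefinesStandard a) (V : Finset σ) :
    convolve (∏ s ∈ V, (1 - laurentMonomial (a s))) (monomialCount a ∅) = monomialCount a V := by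
  classical
  induction V using Finset.induction_on with
  | empty => simp
  | insert s V hs ih =>
    rw [Finset.prod_insert hs, map_mul, Module.End.mul_apply, ih]
    funext γ
    rw [monomialCount_insert ha hs]
    simp

/-- The Hilbert series of k[z] is inverted by ∏(1 − t^{a_s}): applying that product leaves the delta
function at 0, and convolving the delta with P returns the coefficients of P. -/
lemma convolve_monomialCount_injective {a : σ → ι → ℤ} (ha : RefinesStandard a) {P Q : Laurent ι}
    (h : convolve P (monomialCount a ∅) = convolve Q (monomialCount a ∅)) : P = Q := by
  classical
  have := Fintype.ofFinite σ
  have hdelta : monomialCount a Finset.univ = fun γ => if γ = 0 then 1 else 0 := by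
    funext γ
    rw [monomialCount]
    by_cases hγ : γ = 0
    · rw [if_pos hγ, Nat.cast_eq_one, Set.ncard_eq_one]
      refine ⟨0, Set.eq_singleton_iff_unique_mem.2 ⟨by simp [gradedMonomials, hγ], ?_⟩⟩
      rintro d ⟨-, hd⟩
      ext s
      exact hd s (Finset.mem_univ s)
    · rw [if_neg hγ, Nat.cast_eq_zero, Set.ncard_eq_zero (finite_gradedMonomials ha _ _),
        Set.eq_empty_iff_forall_notMem]
      rintro d ⟨h1, hd⟩
      obtain rfl : d = 0 := Finsupp.ext fun s => hd s (Finset.mem_univ s)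
      exact hγ (by rw [← h1, map_zero])
  have key : ∀ P : Laurent ι, convolve (∏ s : σ, (1 - laurentMonomial (a s)))
      (convolve P (monomialCount a ∅)) = fun γ => P.coeff γ := by
    intro P
    rw [← Module.End.mul_apply, ← map_mul, mul_comm, map_mul, Module.End.mul_apply,
      convolve_prod_monomialCount ha, hdelta]
    funext γ
    convert! convolve_delta P γ
  apply AddMonoidAlgebra.ext
  ext γ
  rw [← congrFun (key P) γ, h, key]

end Counting

/-! ## Hilbert functions -/

section Hilbert

variable {k σ ι : Type*} [Field k]

lemma finrank_restrictSupport (s : Set (σ →₀ ℕ)) :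
    Module.finrank k (restrictSupport k s) = s.ncard := by
  rw [Module.finrank_eq_nat_card_basis (basisRestrictSupport k s), Set.ncard_def,
    Set.encard, Nat.card]
  rfl

lemma finite_restrictSupport {s : Set (σ →₀ ℕ)} (hs : s.Finite) :
    Module.Finite k (restrictSupport k s) := by
  have := hs.to_subtype
  exact Module.Finite.of_basis (basisRestrictSupport k s)

lemma weightedHomogeneousSubmodule_eq_restrictSupport (a : σ → ι → ℤ) (γ : ι → ℤ) :
    weightedHomogeneousSubmodule k a γ = restrictSupport k (gradedMonomials a ∅ γ) := by
  ext f
  rw [mem_weightedHomogeneousSubmodule, mem_restrictSupport_iff]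
  constructor
  · intro h d hd
    exact ⟨h (mem_support_iff.1 hd), by simp⟩
  · intro h d hd
    exact (h (mem_support_iff.2 hd)).1

lemma finrank_weightedHomogeneousSubmodule (a : σ → ι → ℤ) (γ : ι → ℤ) :
    (Module.finrank k (weightedHomogeneousSubmodule k a γ) : ℤ) = monomialCount a ∅ γ := by
  rw [weightedHomogeneousSubmodule_eq_restrictSupport, finrank_restrictSupport]
  rfl

lemma finrank_map_add_finrank_inf_ker {V W : Type*} [AddCommGroup V] [Module k V] [AddCommGroup W]
    [Module k W] (p : Submodule k V) [Module.Finite k p] (φ : V →ₗ[k] W) :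
    Module.finrank k (p.map φ) + Module.finrank k (p ⊓ φ.ker : Submodule k V) =
      Module.finrank k p := by
  rw [← LinearMap.finrank_range_add_finrank_ker (φ.domRestrict p), LinearMap.range_domRestrict,
    LinearMap.ker_domRestrict, ← Submodule.finrank_map_subtype_eq, Submodule.map_comap_subtype]

/-- The Hilbert function of `k[z]/I`. -/
def hilbert (a : σ → ι → ℤ) (I : Ideal (MvPolynomial σ k)) (γ : ι → ℤ) : ℤ :=
  Module.finrank k (quotientGrading a I γ)

/-- The homogeneous elements of degree `γ` of the ideal `I`. -/
def idealPiece (a : σ → ι → ℤ) (I : Ideal (MvPolynomial σ k)) (γ : ι → ℤ) :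
    Submodule k (MvPolynomial σ k) :=
  weightedHomogeneousSubmodule k a γ ⊓ I.restrictScalars k

variable [Finite σ]

lemma finite_weightedHomogeneousSubmodule {a : σ → ι → ℤ} (ha : RefinesStandard a) (γ : ι → ℤ) :
    Module.Finite k (weightedHomogeneousSubmodule k a γ) := by
  rw [weightedHomogeneousSubmodule_eq_restrictSupport]
  exact finite_restrictSupport (finite_gradedMonomials ha _ _)

lemma hilbert_add_finrank_idealPiece {a : σ → ι → ℤ} (ha : RefinesStandard a)
    (I : Ideal (MvPolynomial σ k)) (γ : ι → ℤ) :
    hilbert a I γ + Module.finrank k (idealPiece a I γ) = monomialCount a ∅ γ := by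
  have := finite_weightedHomogeneousSubmodule (k := k) ha γ
  have h := finrank_map_add_finrank_inf_ker (weightedHomogeneousSubmodule k a γ)
    (Ideal.Quotient.mkₐ k I).toLinearMap
  have hker : (Ideal.Quotient.mkₐ k I).toLinearMap.ker = I.restrictScalars k := by
    ext f
    simp [Ideal.Quotient.eq_zero_iff_mem]
  rw [hker] at h
  rw [← finrank_weightedHomogeneousSubmodule (k := k), ← h]
  push_cast
  rfl

/-- Any linear map with kernel I may replace the quotient map. Different maps with this kernel later
yield the symmetries of the Hilbert function. -/
lemma hilbert_eq_finrank_map {W : Type*} [AddCommGroup W] [Module k W] {a : σ → ι → ℤ}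
    (ha : RefinesStandard a) (I : Ideal (MvPolynomial σ k)) (φ : MvPolynomial σ k →ₗ[k] W)
    (hφ : φ.ker = I.restrictScalars k) (γ : ι → ℤ) :
    hilbert a I γ = Module.finrank k ((weightedHomogeneousSubmodule k a γ).map φ) := by
  have := finite_weightedHomogeneousSubmodule (k := k) ha γ
  have h1 := hilbert_add_finrank_idealPiece ha I γ
  have h2 := finrank_map_add_finrank_inf_ker (weightedHomogeneousSubmodule k a γ) φ
  rw [hφ] at h2
  rw [← finrank_weightedHomogeneousSubmodule (k := k), ← h2, idealPiece] at h1
  push_cast at h1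
  linarith

lemma hilbert_span_X {a : σ → ι → ℤ} (ha : RefinesStandard a) (V : Finset σ) :
    hilbert a (Ideal.span (X '' (V : Set σ) : Set (MvPolynomial σ k))) = monomialCount a V := by
  funext γ
  rw [hilbert_eq_finrank_map ha _ (setZero k (V : Set σ)).toLinearMap
    (by rw [← ker_setZero]; rfl), monomialCount, ← finrank_restrictSupport (k := k)]
  suffices h : (weightedHomogeneousSubmodule k a γ).map (setZero k (V : Set σ)).toLinearMap =
      restrictSupport k (gradedMonomials a V γ) by rw [h]
  ext f
  simp only [Submodule.mem_map, mem_weightedHomogeneousSubmodule, mem_restrictSupport_iff]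
  constructor
  · rintro ⟨g, hg, rfl⟩ d hd
    rw [Finset.mem_coe, mem_support_iff, AlgHom.toLinearMap_apply, coeff_setZero] at hd
    split_ifs at hd with h
    · exact ⟨hg hd, h⟩
    · exact absurd rfl hd
  · intro h
    refine ⟨f, fun d hd => (h (mem_support_iff.2 hd)).1, ?_⟩
    ext d
    rw [AlgHom.toLinearMap_apply, coeff_setZero]
    split_ifs with hV
    · rfl
    · by_contra hd
      exact hV (h (mem_support_iff.2 (Ne.symm hd))).2

lemma hilbert_bot {a : σ → ι → ℤ} (ha : RefinesStandard a) :
    hilbert a (⊥ : Ideal (MvPolynomial σ k)) = monomialCount a ∅ := by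
  rw [← hilbert_span_X (k := k) ha ∅]
  simp

end Hilbert

/-! ## Graded pieces of free modules -/

section FreePieces

variable {k σ ι : Type*} [Field k]

/-- The graded pieces of a graded free module, as subspaces. -/
def freePieceSubmodule (k : Type*) [Field k] (a : σ → ι → ℤ) {r : ℕ} (b : Fin r → ι → ℤ)
    (γ : ι → ℤ) : Submodule k (Fin r → MvPolynomial σ k) :=
  Submodule.pi Set.univ fun j => weightedHomogeneousSubmodule k a (γ - b j)

lemma mem_freePieceSubmodule {a : σ → ι → ℤ} {r : ℕ} {b : Fin r → ι → ℤ} {γ : ι → ℤ}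
    {v : Fin r → MvPolynomial σ k} :
    v ∈ freePieceSubmodule k a b γ ↔ ∀ j, IsWeightedHomogeneous a (v j) (γ - b j) := by
  simp [freePieceSubmodule, Submodule.mem_pi]

/-- The homogeneous components of the elements of a graded free module. -/
def freeComponent (a : σ → ι → ℤ) {r : ℕ} (b : Fin r → ι → ℤ) (γ : ι → ℤ) :
    (Fin r → MvPolynomial σ k) →ₗ[k] (Fin r → MvPolynomial σ k) :=
  LinearMap.pi fun j => (weightedHomogeneousComponent a (γ - b j)).comp (LinearMap.proj j)

@[simp] lemma freeComponent_apply (a : σ → ι → ℤ) {r : ℕ} (b : Fin r → ι → ℤ) (γ : ι → ℤ)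
    (v : Fin r → MvPolynomial σ k) (j : Fin r) :
    freeComponent a b γ v j = weightedHomogeneousComponent a (γ - b j) (v j) := rfl

lemma freeComponent_mem (a : σ → ι → ℤ) {r : ℕ} (b : Fin r → ι → ℤ) (γ : ι → ℤ)
    (v : Fin r → MvPolynomial σ k) : freeComponent a b γ v ∈ freePieceSubmodule k a b γ :=
  mem_freePieceSubmodule.2 fun _ => weightedHomogeneousComponent_isWeightedHomogeneous _ _

lemma freeComponent_of_mem {a : σ → ι → ℤ} {r : ℕ} {b : Fin r → ι → ℤ} {γ : ι → ℤ}
    {v : Fin r → MvPolynomial σ k} (hv : v ∈ freePieceSubmodule k a b γ) :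
    freeComponent a b γ v = v :=
  funext fun j => (mem_freePieceSubmodule.1 hv j).weightedHomogeneousComponent_same

lemma freeComponent_of_mem_ne {a : σ → ι → ℤ} {r : ℕ} {b : Fin r → ι → ℤ} {γ δ : ι → ℤ}
    (hγ : δ ≠ γ) {v : Fin r → MvPolynomial σ k} (hv : v ∈ freePieceSubmodule k a b δ) :
    freeComponent a b γ v = 0 :=
  funext fun j => (mem_freePieceSubmodule.1 hv j).weightedHomogeneousComponent_ne _
    fun h => hγ (sub_left_inj.1 h).symm

lemma single_monomial_mem (a : σ → ι → ℤ) {r : ℕ} (b : Fin r → ι → ℤ) (j : Fin r) (d : σ →₀ ℕ)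
    (c : k) : Pi.single j (monomial d c) ∈ freePieceSubmodule k a b (Finsupp.weight a d + b j) := by
  refine mem_freePieceSubmodule.2 fun i => ?_
  by_cases hij : i = j
  · subst hij
    rw [Pi.single_eq_same]
    exact isWeightedHomogeneous_monomial _ _ _ (by simp)
  · rw [Pi.single_eq_of_ne hij]
    exact isWeightedHomogeneous_zero _ _ _

/-- Two linear maps on a free module agree if they agree on its homogeneous elements. -/
lemma linearMap_ext_of_freePiece {W : Type*} [AddCommGroup W] [Module k W] (a : σ → ι → ℤ) {r : ℕ}
    (b : Fin r → ι → ℤ) {φ ψ : (Fin r → MvPolynomial σ k) →ₗ[k] W}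
    (h : ∀ δ, ∀ v ∈ freePieceSubmodule k a b δ, φ v = ψ v) : φ = ψ := by
  refine LinearMap.pi_ext' fun j => MvPolynomial.linearMap_ext fun d => LinearMap.ext fun c => ?_
  exact h _ _ (single_monomial_mem a b j d c)

open Classical in
-- A homogeneous map commutes with taking components. The target is left abstract so that this
-- covers both the differentials and the augmentation.
lemma map_freeComponent {W : Type*} [AddCommGroup W] [Module k W] {a : σ → ι → ℤ} {r : ℕ}
    {b : Fin r → ι → ℤ} {𝒲 : (ι → ℤ) → Submodule k W} {π : (ι → ℤ) → W →ₗ[k] W}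
    (hsame : ∀ γ, ∀ x ∈ 𝒲 γ, π γ x = x) (hne : ∀ γ δ, δ ≠ γ → ∀ x ∈ 𝒲 δ, π γ x = 0)
    (φ : (Fin r → MvPolynomial σ k) →ₗ[k] W)
    (hφ : ∀ γ, ∀ v ∈ freePieceSubmodule k a b γ, φ v ∈ 𝒲 γ) (γ : ι → ℤ)
    (v : Fin r → MvPolynomial σ k) : φ (freeComponent a b γ v) = π γ (φ v) := by
  suffices h : φ.comp (freeComponent a b γ) = (π γ).comp φ from LinearMap.congr_fun h v
  refine linearMap_ext_of_freePiece a b fun δ x hx => ?_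
  simp only [LinearMap.comp_apply]
  by_cases hδ : δ = γ
  · subst hδ
    rw [freeComponent_of_mem hx, hsame _ _ (hφ _ _ hx)]
  · rw [freeComponent_of_mem_ne hδ hx, map_zero, hne _ _ hδ _ (hφ _ _ hx)]

lemma finrank_freePieceSubmodule [Finite σ] {a : σ → ι → ℤ} (ha : RefinesStandard a) {r : ℕ}
    (b : Fin r → ι → ℤ) (γ : ι → ℤ) :
    (Module.finrank k (freePieceSubmodule k a b γ) : ℤ) =
      convolve (∑ j, laurentMonomial (b j)) (monomialCount a ∅) γ := by
  have := fun γ => finite_weightedHomogeneousSubmodule (k := k) ha γ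
  let e : freePieceSubmodule k a b γ ≃ₗ[k]
      ∀ j, weightedHomogeneousSubmodule k a (γ - b j) :=
    { toFun := fun v j => ⟨v.1 j, mem_freePieceSubmodule.1 v.2 j⟩
      invFun := fun v => ⟨fun j => v j, mem_freePieceSubmodule.2 fun j => (v j).2⟩
      map_add' := fun _ _ => rfl
      map_smul' := fun _ _ => rfl
      left_inv := fun _ => rfl
      right_inv := fun _ => rfl }
  rw [e.finrank_eq, Module.finrank_pi_fintype, map_sum, LinearMap.sum_apply, Finset.sum_apply]
  push_cast
  simp only [finrank_weightedHomogeneousSubmodule, convolve_laurentMonomial]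

lemma finite_freePieceSubmodule [Finite σ] {a : σ → ι → ℤ} (ha : RefinesStandard a) {r : ℕ}
    (b : Fin r → ι → ℤ) (γ : ι → ℤ) : Module.Finite k (freePieceSubmodule k a b γ) := by
  have := fun γ => finite_weightedHomogeneousSubmodule (k := k) ha γ
  exact Module.Finite.of_injective (LinearMap.pi fun j =>
    ((LinearMap.proj j).comp (freePieceSubmodule k a b γ).subtype).codRestrict
      (weightedHomogeneousSubmodule k a (γ - b j)) fun v => mem_freePieceSubmodule.1 v.2 j)
    fun v w h => Subtype.ext (funext fun j => congrArg Subtype.val (congrFun h j))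

end FreePieces

/-! ## The Hilbert function and the `K`-polynomial -/

section Euler

variable {k σ ι M : Type*} [Field k] [AddCommGroup M] [Module k M]

open Classical in
lemma exists_projections {𝒢 : (ι → ℤ) → Submodule k M} (h : DirectSum.IsInternal 𝒢) :
    ∃ π : (ι → ℤ) → M →ₗ[k] M, (∀ γ, ∀ x ∈ 𝒢 γ, π γ x = x) ∧
      ∀ γ δ, δ ≠ γ → ∀ x ∈ 𝒢 δ, π γ x = 0 := by
  let := h.chooseDecomposition
  refine ⟨fun γ => (𝒢 γ).subtype.comp ((DirectSum.component k _ _ γ).comp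
    (DirectSum.decomposeLinearEquiv 𝒢).toLinearMap), fun γ x hx => ?_, fun γ δ hδ x hx => ?_⟩
  · exact DirectSum.decompose_of_mem_same 𝒢 hx
  · exact DirectSum.decompose_of_mem_ne 𝒢 hx hδ

variable [Fintype ι] [Module (MvPolynomial σ k) M] [Finite σ] [IsScalarTower k (MvPolynomial σ k) M]

/-- The resolution stays exact in each degree, so the alternating sum of the dimensions is the
dimension of the piece of M. Since the right-hand side determines the K-polynomial, the latter does
not depend on the resolution. -/
lemma GradedFreeResolution.finrank_piece {a : σ → ι → ℤ} (ha : RefinesStandard a)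
    {𝒢 : (ι → ℤ) → Submodule k M} (h𝒢 : DirectSum.IsInternal 𝒢) (E : GradedFreeResolution a 𝒢)
    (γ : ι → ℤ) :
    (Module.finrank k (𝒢 γ) : ℤ) = convolve E.kPolynomial (monomialCount a ∅) γ := by
  obtain ⟨π, hsame, hne⟩ := exists_projections (by convert! h𝒢)
  set F : ∀ i, Submodule k (Fin (E.rank i) → MvPolynomial σ k) :=
    fun i => freePieceSubmodule k a (E.b i) γ with hF
  have hfin : ∀ i, Module.Finite k (F i) := fun i => finite_freePieceSubmodule ha _ _
  set ε : (Fin (E.rank 0) → MvPolynomial σ k) →ₗ[k] M := E.ε.restrictScalars k with hε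
  set d : ∀ i, (Fin (E.rank (i + 1)) → MvPolynomial σ k) →ₗ[k] _ :=
    fun i => (E.d i).restrictScalars k with hd
  have hεF : ∀ γ, ∀ v ∈ freePieceSubmodule k a (E.b 0) γ, ε v ∈ 𝒢 γ :=
    fun γ v hv => E.ε_graded γ v (mem_freePieceSubmodule.1 hv)
  have hdF : ∀ i γ, ∀ v ∈ freePieceSubmodule k a (E.b (i + 1)) γ,
      d i v ∈ freePieceSubmodule k a (E.b i) γ :=
    fun i γ v hv => mem_freePieceSubmodule.2 (E.d_graded i γ v (mem_freePieceSubmodule.1 hv))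
  have hεmap : (F 0).map ε = 𝒢 γ := by
    apply le_antisymm
    · rintro _ ⟨v, hv, rfl⟩
      exact hεF γ v hv
    · intro m hm
      obtain ⟨v, hv⟩ := E.ε_surjective m
      refine ⟨freeComponent a (E.b 0) γ v, freeComponent_mem _ _ _ _, ?_⟩
      rw [map_freeComponent hsame hne ε hεF]
      change π γ (E.ε v) = m
      rw [hv, hsame γ m hm]
  have hcomp : ∀ i v, d i (freeComponent a (E.b (i + 1)) γ v) =
      freeComponent a (E.b i) γ (d i v) := fun i v =>
    map_freeComponent (𝒲 := freePieceSubmodule k a (E.b i)) (π := freeComponent a (E.b i))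
      (fun _ _ => freeComponent_of_mem) (fun _ _ hδ _ => freeComponent_of_mem_ne hδ) (d i)
      (hdF i) γ v
  have hd0 : (F 1).map (d 0) = F 0 ⊓ ε.ker := by
    apply le_antisymm
    · rintro _ ⟨v, hv, rfl⟩
      exact ⟨hdF 0 γ v hv, LinearMap.mem_ker.2 ((E.exact_zero _).2 ⟨v, rfl⟩)⟩
    · rintro u ⟨hu, hu0⟩
      obtain ⟨v, hv⟩ := (E.exact_zero u).1 (LinearMap.mem_ker.1 hu0)
      refine ⟨freeComponent a (E.b 1) γ v, freeComponent_mem _ _ _ _, ?_⟩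
      rw [hcomp]
      change freeComponent a (E.b 0) γ (E.d 0 v) = u
      rw [hv, freeComponent_of_mem hu]
  have hdsucc : ∀ i, (F (i + 2)).map (d (i + 1)) = F (i + 1) ⊓ (d i).ker := by
    intro i
    apply le_antisymm
    · rintro _ ⟨v, hv, rfl⟩
      exact ⟨hdF (i + 1) γ v hv, LinearMap.mem_ker.2 ((E.exact_succ i _).2 ⟨v, rfl⟩)⟩
    · rintro u ⟨hu, hu0⟩
      obtain ⟨v, hv⟩ := (E.exact_succ i u).1 (LinearMap.mem_ker.1 hu0)
      refine ⟨freeComponent a (E.b (i + 2)) γ v, freeComponent_mem _ _ _ _, ?_⟩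
      rw [hcomp]
      change freeComponent a (E.b (i + 1)) γ (E.d (i + 1) v) = u
      rw [hv, freeComponent_of_mem hu]
  -- Rank-nullity telescopes: the truncated sum misses the answer by the dimension of the image of
  -- the next differential.
  have hsum : ∀ N, ∑ i ∈ Finset.range (N.succ), (-1 : ℤ) ^ i * (Module.finrank k (F i) : ℤ) =
      Module.finrank k (𝒢 γ) + (-1) ^ N * Module.finrank k ((F (N + 1)).map (d N)) := by
    intro N
    induction N with
    | zero =>
      have := finrank_map_add_finrank_inf_ker (F 0) ε
      rw [hεmap, ← hd0] at this
      rw [Finset.sum_range_one, ← this]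
      push_cast
      ring
    | succ N ih =>
      have := finrank_map_add_finrank_inf_ker (F (N + 1)) (d N)
      rw [← hdsucc] at this
      rw [Finset.sum_range_succ, ih, ← this]
      push_cast
      ring
  -- The module after position `len` has rank zero.
  have hzero : (F (E.len + 1)).map (d E.len) = ⊥ := by
    have : IsEmpty (Fin (E.rank (E.len + 1))) := by
      rw [E.rank_eq_zero _ (Nat.lt_succ_self _)]; infer_instance
    rw [Submodule.eq_bot_iff]
    rintro _ ⟨v, -, rfl⟩
    rw [Subsingleton.elim v 0, map_zero]
  have := hsum E.len
  rw [hzero, finrank_bot, Nat.cast_zero, mul_zero, add_zero] at this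
  rw [← this, kPolynomial, map_sum, LinearMap.sum_apply, Finset.sum_apply]
  refine Finset.sum_congr rfl fun i _ => ?_
  rw [finrank_freePieceSubmodule ha]
  rcases Nat.even_or_odd i with hi | hi
  · rw [hi.neg_one_pow, hi.neg_one_pow, one_mul, one_mul]
  · rw [hi.neg_one_pow, hi.neg_one_pow, neg_one_mul, neg_one_mul, map_neg, LinearMap.neg_apply,
      Pi.neg_apply]

lemma isKPolynomial_of_convolve {a : σ → ι → ℤ} (ha : RefinesStandard a)
    {𝒢 : (ι → ℤ) → Submodule k M} (h𝒢 : IsGrading a 𝒢) (E : GradedFreeResolution a 𝒢)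
    {P : Laurent ι}
    (hP : convolve P (monomialCount a ∅) = fun γ => (Module.finrank k (𝒢 γ) : ℤ)) :
    IsKPolynomial a 𝒢 P := by
  have key : ∀ E : GradedFreeResolution a 𝒢, E.kPolynomial = P := by
    intro E
    refine convolve_monomialCount_injective ha ?_
    rw [hP]
    funext γ
    rw [E.finrank_piece ha h𝒢.1]
  exact ⟨h𝒢, ⟨E, key E⟩, key⟩

end Euler

/-! ## The grading of the quotient by a homogeneous ideal -/

section QuotientGrading

variable {k σ ι : Type*} [Field k]

/-- The ideal contains the homogeneous components of its elements. -/
def IsGradedIdeal (a : σ → ι → ℤ) (I : Ideal (MvPolynomial σ k)) : Prop :=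
  ∀ f ∈ I, ∀ γ, weightedHomogeneousComponent a γ f ∈ I

lemma weightedHomogeneousComponent_mul_X (a : σ → ι → ℤ) (γ : ι → ℤ) (f : MvPolynomial σ k)
    (s : σ) : weightedHomogeneousComponent a γ (f * X s) =
      weightedHomogeneousComponent a (γ - a s) f * X s := by
  classical
  induction f using MvPolynomial.induction_on' with
  | add p q hp hq => rw [add_mul, map_add, hp, hq, map_add, add_mul]
  | monomial d c =>
    rw [X, monomial_mul, mul_one]
    have h1 := weightedHomogeneousComponent_of_mem (m := γ) (isWeightedHomogeneous_monomial a
      (d + Finsupp.single s 1) c rfl)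
    have h2 := weightedHomogeneousComponent_of_mem (m := γ - a s)
      (isWeightedHomogeneous_monomial a d c rfl)
    rw [h1, h2]
    have h3 : (γ = Finsupp.weight a (d + Finsupp.single s 1)) ↔
        (γ - a s = Finsupp.weight a d) := by
      rw [map_add, Finsupp.weight_single, one_smul, sub_eq_iff_eq_add]
    split_ifs with h h' h'
    · rw [monomial_mul, mul_one]
    · exact absurd (h3.1 h) h'
    · exact absurd (h3.2 h') h
    · rw [zero_mul]

lemma isGradedIdeal_span {a : σ → ι → ℤ} {B : Set (MvPolynomial σ k)}
    (hB : ∀ f ∈ B, ∃ γ, IsWeightedHomogeneous a f γ) : IsGradedIdeal a (Ideal.span B) := by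
  intro f hf
  induction hf using Submodule.span_induction with
  | mem x hx =>
    intro γ
    classical
    obtain ⟨δ, hδ⟩ := hB x hx
    rw [weightedHomogeneousComponent_of_mem hδ]
    split_ifs
    · exact Ideal.subset_span hx
    · exact Ideal.zero_mem _
  | zero => intro γ; rw [map_zero]; exact Ideal.zero_mem _
  | add x y _ _ hx hy => intro γ; rw [map_add]; exact Ideal.add_mem _ (hx γ) (hy γ)
  | smul r x _ hx =>
    rw [smul_eq_mul]
    induction r using MvPolynomial.induction_on with
    | C c =>
      intro γ
      rw [weightedHomogeneousComponent_C_mul]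
      exact Ideal.mul_mem_left _ _ (hx γ)
    | add p q hp hq => intro γ; rw [add_mul, map_add]; exact Ideal.add_mem _ (hp γ) (hq γ)
    | mul_X p s hp =>
      intro γ
      rw [mul_right_comm, weightedHomogeneousComponent_mul_X]
      exact Ideal.mul_mem_right _ _ (hp _)

variable [Fintype ι]

/-- The pieces are independent because an element of I has its components in I; they span because
monomials are homogeneous. -/
lemma isGrading_quotientGrading {a : σ → ι → ℤ} {I : Ideal (MvPolynomial σ k)}
    (hI : IsGradedIdeal a I) : IsGrading a (quotientGrading a I) := by
  refine ⟨?_, ?_⟩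
  · rw [DirectSum.isInternal_submodule_iff_iSupIndep_and_iSup_eq_top]
    refine ⟨fun γ => ?_, ?_⟩
    · rw [Submodule.disjoint_def]
      rintro _ ⟨f, hf, rfl⟩ hx
      simp only [quotientGrading, ← Submodule.map_iSup] at hx
      obtain ⟨g, hg, hgf⟩ := hx
      have hg0 : weightedHomogeneousComponent a γ g = 0 := by
        have hle : (⨆ δ, ⨆ (_ : δ ≠ γ), weightedHomogeneousSubmodule k a δ) ≤
            (weightedHomogeneousComponent a γ).ker := iSup₂_le fun δ hδ h hh =>
          IsWeightedHomogeneous.weightedHomogeneousComponent_ne _ hh hδ.symm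
        exact hle hg
      have hmem := hI (g - f) (Ideal.Quotient.eq.1 hgf) γ
      rw [map_sub, hg0, IsWeightedHomogeneous.weightedHomogeneousComponent_same hf, zero_sub,
        neg_mem_iff] at hmem
      exact Ideal.Quotient.eq_zero_iff_mem.2 hmem
    · rw [eq_top_iff]
      rintro x -
      obtain ⟨f, rfl⟩ := Ideal.Quotient.mk_surjective x
      induction f using MvPolynomial.induction_on' with
      | add p q hp hq => rw [map_add]; exact Submodule.add_mem _ hp hq
      | monomial d c =>
        exact Submodule.mem_iSup_of_mem (Finsupp.weight a d)
          ⟨monomial d c, isWeightedHomogeneous_monomial a d c rfl, rfl⟩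
  · rintro α β p _ hp ⟨f, hf, rfl⟩
    refine ⟨p * f, hp.mul hf, ?_⟩
    rfl

end QuotientGrading

/-! ### Hilbert's syzygy theorem for homogeneous ideals -/

/-! ## Regular sequences on quotients of free modules -/

section Regular

variable {R F F' : Type*} [CommRing R] [AddCommGroup F] [Module R F] [AddCommGroup F'] [Module R F']

/-- The ideal generated by the first `t` members of a sequence. -/
def initialIdeal (x : ℕ → R) (t : ℕ) : Ideal R := Ideal.span (x '' Set.Iio t)

/-- The first `t` members of the sequence `x` form a weakly regular sequence on `F/N`. -/
def RegularOn (x : ℕ → R) (t : ℕ) (N : Submodule R F) : Prop :=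
  ∀ s < t, ∀ u : F, x s • u ∈ N ⊔ initialIdeal x s • ⊤ → u ∈ N ⊔ initialIdeal x s • ⊤

lemma initialIdeal_succ (x : ℕ → R) (t : ℕ) :
    initialIdeal x (t + 1) = initialIdeal x t ⊔ Ideal.span {x t} := by
  have h : Set.Iio (t + 1) = Set.Iio t ∪ {t} := by
    ext s
    simp only [Set.mem_Iio, Set.mem_union, Set.mem_singleton_iff]
    omega
  rw [initialIdeal, h, Set.image_union, Set.image_singleton, Ideal.span_union]
  rfl

/-- This is Tor₁(F/N, R/J_s) = 0 in elementary form. If n = y + x_s v with y ∈ J_s F, regularity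
gives v = n' + y' with n' ∈ N and y' ∈ J_s F, and n − x_s n' is covered by the case of s. -/
lemma RegularOn.inf_smul_top_le {x : ℕ → R} {t : ℕ} {N : Submodule R F} (h : RegularOn x t N) :
    ∀ s ≤ t, N ⊓ initialIdeal x s • ⊤ ≤ initialIdeal x s • N := by
  intro s
  induction s with
  | zero =>
    intro _
    simp [initialIdeal]
  | succ s ih =>
    rintro hs n ⟨hn, hn'⟩
    rw [initialIdeal_succ, Submodule.sup_smul] at hn' ⊢
    obtain ⟨y, hy, z, hz, rfl⟩ := Submodule.mem_sup.1 hn'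
    rw [Submodule.ideal_span_singleton_smul] at hz
    obtain ⟨v, -, rfl⟩ := (Submodule.mem_smul_pointwise_iff_exists _ _ _).1 hz
    have hv : x s • v ∈ N ⊔ initialIdeal x s • (⊤ : Submodule R F) := by
      rw [← add_sub_cancel_left y (x s • v)]
      exact sub_mem (Submodule.mem_sup_left hn) (Submodule.mem_sup_right hy)
    obtain ⟨n', hn'', y', hy', rfl⟩ := Submodule.mem_sup.1 (h s (by omega) v hv)
    have h1 : y + x s • y' ∈ initialIdeal x s • N := by
      refine ih (by omega) ⟨?_, add_mem hy (Submodule.smul_mem _ _ hy')⟩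
      have := sub_mem hn (N.smul_mem (x s) hn'')
      rwa [smul_add, add_sub_assoc, add_sub_cancel_left] at this
    have h2 : x s • n' ∈ Ideal.span {x s} • N :=
      Submodule.smul_mem_smul (Ideal.mem_span_singleton_self _) hn''
    have h3 : y + x s • (n' + y') = (y + x s • y') + x s • n' := by rw [smul_add]; abel
    rw [h3]
    exact add_mem (Submodule.mem_sup_left h1) (Submodule.mem_sup_right h2)

/-- If the sequence is regular on the free module `F`, it is one step more regular on the first
syzygy module of `F/N` than on `F/N`. -/
lemma RegularOn.ker {x : ℕ → R} {t : ℕ} {N : Submodule R F} (h : RegularOn x t N)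
    (hF : RegularOn x (t + 1) (⊥ : Submodule R F)) (ψ : F' →ₗ[R] F) (hψ : ψ.range = N) :
    RegularOn x (t + 1) ψ.ker := by
  intro s hs u hu
  obtain ⟨n, hn, y, hy, hny⟩ := Submodule.mem_sup.1 hu
  have h1 : ψ y ∈ initialIdeal x s • (⊤ : Submodule R F) := by
    have := Submodule.mem_map_of_mem (f := ψ) hy
    rw [Submodule.map_smul''] at this
    exact Submodule.smul_mono le_rfl le_top this
  have h2 : ψ u ∈ initialIdeal x s • (⊤ : Submodule R F) := by
    have := hF s hs (ψ u)
    rw [bot_sup_eq] at this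
    refine this ?_
    rw [← map_smul, ← hny, map_add, LinearMap.mem_ker.1 hn, zero_add]
    exact h1
  -- ψ(u) lies in N ∩ J_s F ⊆ J_s N = ψ(J_s F'), so u agrees with an element of J_s F' up to the
  -- kernel.
  have h3 := h.inf_smul_top_le s (by omega) ⟨hψ ▸ ⟨u, rfl⟩, h2⟩
  rw [← hψ, LinearMap.range_eq_map, ← Submodule.map_smul''] at h3
  obtain ⟨y', hy', hyu⟩ := h3
  rw [← sub_add_cancel u y']
  exact add_mem (Submodule.mem_sup_left (by simp [hyu])) (Submodule.mem_sup_right hy')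

lemma mem_smul_top_pi {r : ℕ} {J : Ideal R} {u : Fin r → R} :
    u ∈ J • (⊤ : Submodule R (Fin r → R)) ↔ ∀ i, u i ∈ J := by
  constructor
  · intro h i
    induction h using Submodule.smul_induction_on' with
    | smul c hc v _ => exact Ideal.mul_mem_right _ _ hc
    | add v _ w _ hv hw => exact add_mem hv hw
  · intro h
    rw [pi_eq_sum_univ u]
    exact sum_mem fun i _ => Submodule.smul_mem_smul (h i) trivial

/-- Iterating gives N ⊆ J^m F for all m, and Krull's intersection theorem in a domain finishes; no
local hypothesis is needed. -/
lemma eq_bot_of_le_smul [IsDomain R] [IsNoetherianRing R] {J : Ideal R} (hJ : J ≠ ⊤) {r : ℕ}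
    {N : Submodule R (Fin r → R)} (h : N ≤ J • N) : N = ⊥ := by
  have hpow : ∀ m : ℕ, N ≤ J ^ m • ⊤ := by
    intro m
    induction m with
    | zero =>
      rw [pow_zero, Ideal.one_eq_top, Submodule.top_smul]
      exact le_top
    | succ m ih =>
      rw [pow_succ', Submodule.mul_smul]
      exact h.trans (Submodule.smul_mono le_rfl ih)
  rw [Submodule.eq_bot_iff]
  intro v hv
  funext i
  have : v i ∈ (⨅ m : ℕ, J ^ m : Ideal R) :=
    (Submodule.mem_iInf _).2 fun m => mem_smul_top_pi.1 (hpow m hv) i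
  rwa [Ideal.iInf_pow_eq_bot_of_isDomain _ hJ] at this

end Regular

/-! ## Minimal graded covers -/

section Covers

variable {k σ ι : Type*} [Field k]

/-- A graded submodule of a graded free module. -/
structure GradedSubmodule (k : Type*) [Field k] (a : σ → ι → ℤ) where
  /-- The rank of the free module. -/
  r : ℕ
  /-- The degrees of the generators of the free module. -/
  b : Fin r → ι → ℤ
  /-- The submodule. -/
  N : Submodule (MvPolynomial σ k) (Fin r → MvPolynomial σ k)
  graded : ∀ v ∈ N, ∀ γ, freeComponent a b γ v ∈ N

lemma mem_span_freeComponent (a : σ → ι → ℤ) {r : ℕ} (b : Fin r → ι → ℤ)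
    (v : Fin r → MvPolynomial σ k) :
    v ∈ Submodule.span (MvPolynomial σ k) (Set.range fun γ => freeComponent a b γ v) := by
  classical
  have hv : v = ∑ γ ∈ Finset.univ.biUnion fun j => (v j).support.image
      fun d => Finsupp.weight a d + b j, freeComponent a b γ v := by
    funext j
    ext d
    rw [Finset.sum_apply, coeff_sum]
    simp only [freeComponent_apply, coeff_weightedHomogeneousComponent]
    by_cases hd : coeff d (v j) = 0
    · simp [hd]
    · rw [Finset.sum_eq_single (Finsupp.weight a d + b j)]
      · simp
      · intro γ _ hγ
        rw [if_neg]
        intro h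
        exact hγ (by rw [h]; simp)
      · intro h
        refine absurd (Finset.mem_biUnion.2 ⟨j, Finset.mem_univ _, ?_⟩) h
        exact Finset.mem_image_of_mem _ (mem_support_iff.2 hd)
  nth_rw 2 [hv]
  exact sum_mem fun γ _ => Submodule.subset_span ⟨γ, rfl⟩

lemma smul_mem_freePieceSubmodule {a : σ → ι → ℤ} {r : ℕ} {b : Fin r → ι → ℤ} {γ δ : ι → ℤ}
    {p : MvPolynomial σ k} (hp : IsWeightedHomogeneous a p γ) {v : Fin r → MvPolynomial σ k}
    (hv : v ∈ freePieceSubmodule k a b δ) : p • v ∈ freePieceSubmodule k a b (γ + δ) := by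
  refine mem_freePieceSubmodule.2 fun j => ?_
  have := hp.mul (mem_freePieceSubmodule.1 hv j)
  rwa [← add_sub_assoc] at this

/-- A homogeneous family of `t` generators. -/
def GradedSubmodule.HasGenerators {a : σ → ι → ℤ} (G : GradedSubmodule k a) (t : ℕ) : Prop :=
  ∃ (b : Fin t → ι → ℤ) (g : Fin t → Fin G.r → MvPolynomial σ k),
    (∀ j, g j ∈ freePieceSubmodule k a G.b (b j)) ∧
      Submodule.span (MvPolynomial σ k) (Set.range g) = G.N

lemma GradedSubmodule.exists_hasGenerators [Finite σ] {a : σ → ι → ℤ} (G : GradedSubmodule k a) :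
    ∃ t, G.HasGenerators t := by
  set S : Set (Fin G.r → MvPolynomial σ k) :=
    {v | v ∈ G.N ∧ ∃ γ, v ∈ freePieceSubmodule k a G.b γ} with hS
  have hspan : Submodule.span (MvPolynomial σ k) S = G.N := by
    apply le_antisymm
    · exact Submodule.span_le.2 fun v hv => hv.1
    · intro v hv
      refine Submodule.span_mono ?_ (mem_span_freeComponent a G.b v)
      rintro _ ⟨γ, rfl⟩
      exact ⟨G.graded v hv γ, γ, freeComponent_mem _ _ _ _⟩
  have hfg : (Submodule.span (MvPolynomial σ k) S).FG := IsNoetherian.noetherian _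
  obtain ⟨T, hTS, hT⟩ := (Submodule.fg_span_iff_fg_span_finset_subset S).1 hfg
  have hg : ∀ j : Fin T.card, ∃ γ, (T.equivFin.symm j : Fin G.r → MvPolynomial σ k) ∈
      freePieceSubmodule k a G.b γ := fun j => (hTS (T.equivFin.symm j).2).2
  choose b hb using hg
  refine ⟨T.card, b, fun j => T.equivFin.symm j, hb, ?_⟩
  rw [← hspan, hT]
  congr 1
  ext v
  constructor
  · rintro ⟨j, rfl⟩
    exact (T.equivFin.symm j).2
  · intro hv
    exact ⟨T.equivFin ⟨v, hv⟩, by simp⟩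

/-- Take the least possible number of homogeneous generators. A relation with a nonzero constant
term in one coordinate would express that generator by the others, so the syzygies lie in the ideal
of the variables times the free module. -/
lemma GradedSubmodule.exists_cover [Finite σ] {a : σ → ι → ℤ} (ha : RefinesStandard a)
    (G : GradedSubmodule k a) :
    ∃ (G' : GradedSubmodule k a)
      (ψ : (Fin G'.r → MvPolynomial σ k) →ₗ[MvPolynomial σ k] (Fin G.r → MvPolynomial σ k)),
      (∀ γ, ∀ v ∈ freePieceSubmodule k a G'.b γ, ψ v ∈ freePieceSubmodule k a G.b γ) ∧
      ψ.range = G.N ∧ ψ.ker = G'.N ∧ ∀ u ∈ G'.N, ∀ j, constantCoeff (u j) = 0 := by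
  classical
  have hmin := fun t => Nat.find_min' (m := t) G.exists_hasGenerators
  obtain ⟨b, g, hg, hspan⟩ := Nat.find_spec G.exists_hasGenerators
  revert b g
  generalize Nat.find G.exists_hasGenerators = t at hmin
  intro b g hg hspan
  set ψ := Fintype.linearCombination (MvPolynomial σ k) g with hψ
  have hgr : ∀ γ, ∀ v ∈ freePieceSubmodule k a b γ, ψ v ∈ freePieceSubmodule k a G.b γ := by
    intro γ v hv
    rw [hψ, Fintype.linearCombination_apply]
    refine sum_mem fun j _ => ?_
    have := smul_mem_freePieceSubmodule (mem_freePieceSubmodule.1 hv j) (hg j)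
    rwa [sub_add_cancel] at this
  have hker : ∀ v ∈ ψ.ker, ∀ γ, freeComponent a b γ v ∈ ψ.ker := by
    intro v hv γ
    rw [LinearMap.mem_ker] at hv ⊢
    have := map_freeComponent (𝒲 := freePieceSubmodule k a G.b) (π := freeComponent a G.b)
      (fun _ _ => freeComponent_of_mem) (fun _ _ hδ _ => freeComponent_of_mem_ne hδ)
      (ψ.restrictScalars k) hgr γ v
    simp only [LinearMap.coe_restrictScalars] at this
    rw [this, hv, map_zero]
  refine ⟨⟨t, b, ψ.ker, hker⟩, ψ, hgr, ?_, rfl, fun u hu j => ?_⟩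
  · exact (Fintype.range_linearCombination _ _).trans hspan
  · by_contra hc
    set c := constantCoeff (u j) with hcdef
    have hu' := hker u hu (b j)
    set u' := freeComponent a b (b j) u with hu'def
    -- In degree b j the j-th coordinate has weight zero, and only constants have weight zero.
    have huj : u' j = C c := by
      ext d
      rw [hu'def, freeComponent_apply, coeff_weightedHomogeneousComponent, sub_self, coeff_C]
      by_cases hd : d = 0
      · subst hd
        simp [hcdef, constantCoeff_eq]
      · rw [if_neg fun h => hd (ha.eq_zero_of_weight h), if_neg (Ne.symm hd)]
    change Fin t at j
    obtain ⟨t, rfl⟩ : ∃ t', t = t' + 1 := ⟨t - 1, by have := j.2; omega⟩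
    have hle := hmin t ⟨b ∘ j.succAbove, g ∘ j.succAbove, fun i => hg _, ?_⟩
    · omega
    · rw [← hspan]
      apply le_antisymm
      · exact Submodule.span_mono (Set.range_comp_subset_range _ _)
      · rw [Submodule.span_le]
        rintro _ ⟨i, rfl⟩
        rcases Fin.eq_self_or_eq_succAbove j i with rfl | ⟨i, rfl⟩
        · rw [LinearMap.mem_ker, hψ, Fintype.linearCombination_apply,
            Fin.sum_univ_succAbove _ i, huj] at hu'
          have hgi : g i = -((C c⁻¹ : MvPolynomial σ k) •
              ∑ l, u' (i.succAbove l) • g (i.succAbove l)) := by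
            have h1 : (C c⁻¹ : MvPolynomial σ k) • ((C c : MvPolynomial σ k) • g i) = g i := by
              rw [smul_smul, ← C_mul, inv_mul_cancel₀ hc, C_1, one_smul]
            rw [← h1, eq_neg_iff_add_eq_zero, ← smul_add, hu', smul_zero]
          rw [hgi, SetLike.mem_coe]
          refine neg_mem (Submodule.smul_mem _ _ (sum_mem fun l _ => Submodule.smul_mem _ _ ?_))
          exact Submodule.subset_span ⟨l, rfl⟩
        · exact Submodule.subset_span ⟨i, rfl⟩

end Covers

/-! ## Finite graded free resolutions -/

section Resolutions

variable {k σ ι : Type*} [Field k]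

/-- The variables, in some order, as a sequence that ends with ones. -/
def variableSequence (k σ : Type*) [Field k] [Fintype σ] (s : ℕ) : MvPolynomial σ k :=
  if h : s < Fintype.card σ then X ((Fintype.equivFin σ).symm ⟨s, h⟩) else 1

lemma initialIdeal_variableSequence [Fintype σ] {t : ℕ} (ht : t ≤ Fintype.card σ) :
    initialIdeal (variableSequence k σ) t =
      Ideal.span (X '' {s : σ | (Fintype.equivFin σ s : ℕ) < t}) := by
  rw [initialIdeal]
  congr 1
  ext f
  constructor
  · rintro ⟨s, hs, rfl⟩
    have hs' : s < Fintype.card σ := lt_of_lt_of_le hs ht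
    exact ⟨(Fintype.equivFin σ).symm ⟨s, hs'⟩, by simpa using hs, by simp [variableSequence, hs']⟩
  · rintro ⟨s, hs, rfl⟩
    exact ⟨Fintype.equivFin σ s, hs, by simp [variableSequence]⟩

/-- Setting the earlier variables to zero lands in a domain in which the next variable is nonzero.
-/
lemma regularOn_bot [Fintype σ] (t r : ℕ) : RegularOn (variableSequence k σ) t
    (⊥ : Submodule (MvPolynomial σ k) (Fin r → MvPolynomial σ k)) := by
  intro s _ u hu
  rw [bot_sup_eq] at hu ⊢
  by_cases hs : s < Fintype.card σ
  · rw [mem_smul_top_pi] at hu ⊢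
    intro i
    have := hu i
    rw [initialIdeal_variableSequence hs.le, ← ker_setZero, RingHom.mem_ker] at this ⊢
    rw [Pi.smul_apply, smul_eq_mul, map_mul] at this
    refine (mul_eq_zero.1 this).resolve_left ?_
    rw [variableSequence, dif_pos hs, setZero, aeval_X, if_neg (by simp)]
    exact X_ne_zero _
  -- Past the last variable the sequence is 1, and multiplication by 1 is harmless. This lets the
  -- regularity length exceed the number of variables.
  · rwa [variableSequence, dif_neg hs, one_smul] at hu

lemma mem_initialIdeal_iff [Fintype σ] {f : MvPolynomial σ k} :
    f ∈ initialIdeal (variableSequence k σ) (Fintype.card σ) ↔ constantCoeff f = 0 := by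
  classical
  rw [initialIdeal_variableSequence le_rfl, ← ker_setZero, RingHom.mem_ker]
  have h : setZero k {s : σ | (Fintype.equivFin σ s : ℕ) < Fintype.card σ} f =
      C (constantCoeff f) := by
    ext d
    rw [coeff_setZero, coeff_C]
    by_cases hd : d = 0
    · subst hd
      simp [constantCoeff_eq]
    · rw [if_neg (Ne.symm hd), if_neg]
      intro h
      exact hd (Finsupp.ext fun s => h s (Fin.is_lt _))
  rw [h, C_eq_zero]

/-- Hilbert's syzygy theorem for quotients by homogeneous ideals. -/
theorem nonempty_gradedFreeResolution [Finite σ] {a : σ → ι → ℤ} (ha : RefinesStandard a)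
    {I : Ideal (MvPolynomial σ k)} (hI : IsGradedIdeal a I) :
    Nonempty (GradedFreeResolution a (quotientGrading a I)) := by
  have := Fintype.ofFinite σ
  choose next ψ hgr hrange hker hmin using fun G : GradedSubmodule k a => G.exists_cover ha
  set ε : (Fin 1 → MvPolynomial σ k) →ₗ[MvPolynomial σ k] (MvPolynomial σ k ⧸ I) :=
    (Submodule.mkQ I).comp (LinearMap.proj 0) with hε
  have hεker : ∀ v, v ∈ ε.ker ↔ v 0 ∈ I := fun v => by
    rw [LinearMap.mem_ker, hε, LinearMap.comp_apply, LinearMap.proj_apply, Submodule.mkQ_apply,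
      Submodule.Quotient.mk_eq_zero]
  let G₀ : GradedSubmodule k a := ⟨1, 0, ε.ker, fun v hv γ =>
    (hεker _).2 (hI _ ((hεker v).1 hv) _)⟩
  let G : ℕ → GradedSubmodule k a := fun i => Nat.rec G₀ (fun _ => next) i
  have hreg : ∀ i, RegularOn (variableSequence k σ) i (G i).N := by
    intro i
    induction i with
    | zero => exact fun s hs => absurd hs (Nat.not_lt_zero s)
    | succ i ih =>
      have := ih.ker (regularOn_bot _ _) (ψ (G i)) (hrange (G i))
      rwa [hker] at this
  -- Each cover adds one step of regularity. Here N ⊆ 𝔪F because the cover is minimal, and N ∩ 𝔪F ⊆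
  -- 𝔪N by regularity, so N = 𝔪N = 0. The extra +1 ensures that at least one cover has been made,
  -- since the starting module need not be minimal.
  have hbot : (G (Fintype.card σ + 1)).N = ⊥ := by
    refine eq_bot_of_le_smul (J := initialIdeal (variableSequence k σ) (Fintype.card σ)) ?_ ?_
    · rw [Ne, Ideal.eq_top_iff_one, mem_initialIdeal_iff]
      simp
    · refine le_trans (le_inf le_rfl ?_)
        ((hreg (Fintype.card σ + 1)).inf_smul_top_le _ (Nat.le_succ _))
      intro u hu
      exact mem_smul_top_pi.2 fun j => mem_initialIdeal_iff.2 (hmin _ u hu j)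
  -- A minimal cover of zero has rank zero: otherwise a basis vector would be a syzygy with constant
  -- term 1.
  have hnext : ∀ H : GradedSubmodule k a, H.N = ⊥ → (next H).r = 0 ∧ (next H).N = ⊥ := by
    intro H hH
    have hr : (next H).r = 0 := by
      by_contra h
      let j : Fin (next H).r := ⟨0, Nat.pos_of_ne_zero h⟩
      have h1 : (Pi.single j 1 : Fin (next H).r → MvPolynomial σ k) ∈ (next H).N := by
        have h2 : ψ H (Pi.single j 1) ∈ (ψ H).range := ⟨_, rfl⟩
        rw [hrange, hH, Submodule.mem_bot] at h2
        rw [← hker]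
        exact LinearMap.mem_ker.2 h2
      have := hmin H _ h1 j
      simp at this
    refine ⟨hr, (Submodule.eq_bot_iff _).2 fun v _ => ?_⟩
    have : IsEmpty (Fin (next H).r) := by rw [hr]; infer_instance
    exact Subsingleton.elim _ _
  have hzero : ∀ i, (G (Fintype.card σ + 1 + i)).N = ⊥ := by
    intro i
    induction i with
    | zero => exact hbot
    | succ i ih => exact (hnext _ ih).2
  refine ⟨{ len := Fintype.card σ + 1
            rank := fun i => (G i).r
            rank_eq_zero := fun i hi => ?_
            b := fun i => (G i).b
            d := fun i => ψ (G i)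
            ε := ε
            d_graded := fun i γ v hv => mem_freePieceSubmodule.1
              (hgr (G i) γ v (mem_freePieceSubmodule.2 hv))
            ε_graded := fun γ v hv => ?_
            ε_surjective := fun m => ?_
            exact_zero := LinearMap.exact_iff.2 (hrange G₀).symm
            exact_succ := fun i => LinearMap.exact_iff.2 ?_ }⟩
  · obtain ⟨m, rfl⟩ : ∃ m, i = Fintype.card σ + 1 + m + 1 := ⟨i - (Fintype.card σ + 2), by omega⟩
    exact (hnext _ (hzero m)).1
  · refine ⟨v 0, ?_, rfl⟩
    have := hv 0
    rwa [show (G 0).b 0 = 0 from rfl, sub_zero] at this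
  · obtain ⟨f, rfl⟩ := Ideal.Quotient.mk_surjective m
    exact ⟨fun _ => f, rfl⟩
  · rw [hker]
    exact (hrange (G (i + 1))).symm

end Resolutions

/-! ### The recursion of Hilbert functions along an ascent -/

/-! ## Exchanging two rows in the generators of a Schubert determinantal ideal -/

section Exchange

variable {n : ℕ} {k : Type*} [Field k]

/-- The product factors through fewer than N indices. Padding both factors with zeros makes them
square, one with a zero column. -/
lemma det_mul_eq_zero {R β : Type*} [CommRing R] [Fintype β] [DecidableEq β] {N : ℕ}
    (A : Matrix (Fin N) β R) (B : Matrix β (Fin N) R) (T : Finset β) (hT : T.card < N)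
    (h : ∀ s b t, b ∉ T → A s b * B b t = 0) : (A * B).det = 0 := by
  have e : Fin N ≃ T ⊕ Fin (N - T.card) := Fintype.equivOfCardEq (by simp; omega)
  have hAB : A * B = (Matrix.fromCols (A.submatrix id ((↑) : T → β)) 0).submatrix id e *
      (Matrix.fromRows (B.submatrix ((↑) : T → β) id) (0 : Matrix (Fin (N - T.card)) _ R)).submatrix
        e id := by
    rw [Matrix.submatrix_mul_equiv, Matrix.fromCols_mul_fromRows]
    ext s t
    simp only [Matrix.mul_apply, Matrix.submatrix_apply, id, Matrix.zero_mul, add_zero]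
    rw [Finset.sum_coe_sort T fun b => A s b * B b t]
    refine (Finset.sum_subset (Finset.subset_univ _) fun b _ hb => h s b t hb).symm
  rw [hAB, Matrix.det_mul, Matrix.det_eq_zero_of_column_eq_zero (e.symm (Sum.inr ⟨0, by omega⟩)),
    zero_mul]
  simp

lemma minor_mem_schubertIdeal {w : Equiv.Perm (Fin n)} {q p : Fin n} {m : ℕ}
    (hm : m = nwRank w q p) (r c : Fin (1 + m) ↪o Fin n) (hr : ∀ s, r s ≤ q) (hc : ∀ s, c s ≤ p) :
    ((genericMatrix k n).submatrix r c).det ∈ schubertIdeal k w := by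
  subst hm
  exact Ideal.subset_span ⟨q, p, r, c, hr, hc, rfl⟩

lemma schubertIdeal_le_of_ascent {w : Equiv.Perm (Fin n)} {i : Fin (n - 1)}
    (hw : w (lo i) < w (hi i)) : schubertIdeal k w ≤ schubertIdeal k (w * simple i) := by
  rw [schubertIdeal_eq_orbitIdeal, schubertIdeal_eq_orbitIdeal]
  exact orbitIdeal_le_of_swap (lo_lt_hi i) hw

/-- The ideals of w and w s_i differ only through boxes whose last row is `lo i` and whose width
separates w(i) from w(i+1). In L w U, the combination ℓ_{i+1,i}·(row i) − ℓ_{i,i}·(row i+1) has no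
contribution from the index `lo i`. Putting it in place of row i therefore lowers the rank and kills
the minor; expanding in that row gives the relation. -/
lemma orbitMap_exchange {w : Equiv.Perm (Fin n)} {i : Fin (n - 1)} (hw : w (lo i) < w (hi i))
    {g : MvPolynomial (Fin n × Fin n) k} (hg : g ∈ schubertGenerators k (w * simple i)) :
    g ∈ schubertIdeal k w ∨ orbitMap k w g * X (Sum.inl (hi i, lo i)) =
      orbitMap k w (swapRows k i g) * X (Sum.inl (lo i, lo i)) := by
  obtain ⟨q, p, r, c, hr, hc, rfl⟩ := hg
  have hrank := nwRank_swap (lo_lt_hi i) hw q p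
  rw [← simple] at hrank
  by_cases hcond : lo i ≤ q ∧ q < hi i ∧ w (lo i) ≤ p ∧ p < w (hi i)
  swap
  · rw [if_neg hcond, add_zero] at hrank
    exact .inl (minor_mem_schubertIdeal hrank r c hr hc)
  obtain rfl : q = lo i := le_antisymm
    (by have := hcond.2.1; simp only [lo, hi, Fin.lt_def, Fin.le_def] at *; omega) hcond.1
  have hp := hcond.2.2.2
  -- T is the set of indices that can still contribute once `lo i` is eliminated. It has at most
  -- nwRank (w s_i) elements, fewer than the size of the minor.
  set T : Finset (Fin n) := Finset.univ.filter fun b => b < lo i ∧ w b ≤ p with hT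
  have hcard : T.card < 1 + nwRank (w * simple i) (lo i) p := by
    rw [add_comm, Nat.lt_succ_iff]
    refine Finset.card_le_card fun b hb => ?_
    simp only [hT, Finset.mem_filter, Finset.mem_univ, true_and] at hb ⊢
    refine ⟨hb.1.le, ?_⟩
    rw [Equiv.Perm.mul_apply, simple_of_ne hb.1.ne (hb.1.trans (lo_lt_hi i)).ne]
    exact hb.2
  have hU : ∀ b t, ¬ w b ≤ p → genericUpper k n (w b) (c t) = 0 := fun b t hb =>
    isUpper_genericUpper _ _ ((hc t).trans_lt (not_le.1 hb))
  have hmem : ∀ b, b ∉ T → w b ≤ p → lo i ≤ b := by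
    intro b hb hbp
    by_contra hlt
    exact hb (Finset.mem_filter.2 ⟨Finset.mem_univ _, not_le.1 hlt, hbp⟩)
  set L := genericLower k n with hL
  set U := (genericUpper k n).submatrix w id with hUdef
  by_cases hlo : ∃ s, r s = lo i
  swap
  -- A minor without row `lo i` uses only rows above it, which involve only the indices in T.
  · left
    rw [schubertIdeal_eq_orbitIdeal, mem_orbitIdeal, orbitMap, evalAt_minor,
      ← Matrix.submatrix_mul_equiv _ _ _ (Equiv.refl _)]
    refine det_mul_eq_zero _ _ T hcard fun s b t hb => ?_
    simp only [Matrix.submatrix_apply, Equiv.refl_apply, id]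
    by_cases hbp : w b ≤ p
    · refine mul_eq_zero_of_left (isLower_genericLower _ _ ?_) _
      exact (lt_of_le_of_ne (hr s) fun h => hlo ⟨s, h⟩).trans_le (hmem b hb hbp)
    · rw [hU b t hbp, mul_zero]
  · right
    obtain ⟨s, hs⟩ := hlo
    have hrt : ∀ t, t ≠ s → r t < lo i := fun t ht =>
      lt_of_le_of_ne (hr t) fun h => ht (r.injective (h.trans hs.symm))
    rw [orbitMap, evalAt_swapRows, evalAt_minor, evalAt_minor, Matrix.submatrix_submatrix]
    set M := (L * U).submatrix r c with hM
    have h1 : (L * U).submatrix (simple i ∘ r) (id ∘ c) =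
        M.updateRow s fun t => (L * U) (hi i) (c t) := by
      ext t y
      rw [Matrix.updateRow_apply]
      split_ifs with ht
      · subst ht
        simp [hs]
      · have := hrt t ht
        simp [hM, simple_of_ne this.ne (this.trans (lo_lt_hi i)).ne]
    have h2 : L (hi i) (lo i) = X (Sum.inl (hi i, lo i)) := by
      simp [hL, genericLower, (lo_lt_hi i).le]
    have h3 : L (lo i) (lo i) = X (Sum.inl (lo i, lo i)) := by simp [hL, genericLower]
    -- Row s is replaced by the combination in which the index `lo i` cancels. The index `hi i` is
    -- excluded by p < w (hi i), and later indices vanish by triangularity.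
    have h4 : (M.updateRow s (L (hi i) (lo i) • M s - L (lo i) (lo i) •
        fun t => (L * U) (hi i) (c t))).det = 0 := by
      have : M.updateRow s (L (hi i) (lo i) • M s - L (lo i) (lo i) •
          fun t => (L * U) (hi i) (c t)) = (L.submatrix r id).updateRow s
          (L (hi i) (lo i) • L (lo i) - L (lo i) (lo i) • L (hi i)) * U.submatrix id c := by
        ext t y
        rw [Matrix.mul_apply, Matrix.updateRow_apply]
        by_cases ht : t = s
        · subst ht
          simp [hM, hs, Matrix.mul_apply, Finset.mul_sum, sub_mul, mul_assoc]
        · simp [ht, hM, Matrix.mul_apply]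
      rw [this]
      refine det_mul_eq_zero _ _ T hcard fun t b y hb => ?_
      simp only [Matrix.submatrix_apply, hUdef, id]
      by_cases hbp : w b ≤ p
      swap
      · rw [hU b y hbp, mul_zero]
      have hlb := hmem b hb hbp
      by_cases ht : t = s
      · subst ht
        rw [Matrix.updateRow_self]
        rcases hlb.eq_or_lt with rfl | hlt
        · simp [mul_comm]
        · have hbhi : hi i < b := by
            refine lt_of_le_of_ne ?_ ?_
            · simp only [lo, hi, Fin.lt_def, Fin.le_def] at *; omega
            · rintro rfl; exact absurd hbp (not_le.2 hp)
          simp [hL, isLower_genericLower _ _ hlt, isLower_genericLower _ _ hbhi]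
      · rw [Matrix.updateRow_ne ht]
        exact mul_eq_zero_of_left (isLower_genericLower _ _ ((hrt t ht).trans_le hlb)) _
    rw [sub_eq_add_neg, ← smul_neg, ← neg_one_smul (PairRing k n), Matrix.det_updateRow_add,
      Matrix.det_updateRow_smul, Matrix.det_updateRow_smul, Matrix.det_updateRow_smul,
      Matrix.updateRow_eq_self, ← h1] at h4
    rw [← h2, ← h3]
    linear_combination h4

lemma swapRows_mem_schubertIdeal {w : Equiv.Perm (Fin n)} {i : Fin (n - 1)}
    (hw : w (lo i) < w (hi i)) {f : MvPolynomial (Fin n × Fin n) k} (hf : f ∈ schubertIdeal k w) :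
    swapRows k i f ∈ schubertIdeal k w := by
  rw [schubertIdeal_eq_orbitIdeal] at hf ⊢
  exact swapRows_mem_orbitIdeal hw hf

lemma orbitMap_eq_zero_iff {w : Equiv.Perm (Fin n)} {f : MvPolynomial (Fin n × Fin n) k} :
    orbitMap k w f = 0 ↔ f ∈ schubertIdeal k w := by
  rw [schubertIdeal_eq_orbitIdeal, mem_orbitIdeal]

/-- Together with `exists_mul_orbitMap_eq`, this extends the exchange from generators to the ideal:
the images of I_{w s_i} and s_i I_{w s_i} agree after multiplication by ℓ_{i+1,i} and ℓ_{i,i}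
respectively. -/
lemma exists_orbitMap_mul_eq {w : Equiv.Perm (Fin n)} {i : Fin (n - 1)}
    (hw : w (lo i) < w (hi i)) {f : MvPolynomial (Fin n × Fin n) k}
    (hf : f ∈ schubertIdeal k (w * simple i)) :
    ∃ g ∈ schubertIdeal k (w * simple i), orbitMap k w f * X (Sum.inl (hi i, lo i)) =
      orbitMap k w (swapRows k i g) * X (Sum.inl (lo i, lo i)) := by
  rw [schubertIdeal_eq_span] at hf
  induction hf using Submodule.span_induction with
  | mem g hg =>
    rcases orbitMap_exchange hw hg with h | h
    · exact ⟨0, zero_mem _, by rw [orbitMap_eq_zero_iff.2 h]; simp⟩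
    · exact ⟨g, Ideal.subset_span hg, h⟩
  | zero => exact ⟨0, zero_mem _, by simp⟩
  | add f₁ f₂ _ _ h₁ h₂ =>
    obtain ⟨g₁, hg₁, e₁⟩ := h₁
    obtain ⟨g₂, hg₂, e₂⟩ := h₂
    exact ⟨g₁ + g₂, add_mem hg₁ hg₂, by simp only [map_add, add_mul, e₁, e₂]⟩
  | smul r f _ h =>
    obtain ⟨g, hg, e⟩ := h
    -- Since g is about to be row-swapped, its multiplier must be swapped beforehand.
    refine ⟨swapRows k i r * g, Ideal.mul_mem_left _ _ hg, ?_⟩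
    rw [smul_eq_mul, map_mul, mul_assoc, e, map_mul, swapRows_swapRows, map_mul, mul_assoc]

lemma exists_mul_orbitMap_eq {w : Equiv.Perm (Fin n)} {i : Fin (n - 1)}
    (hw : w (lo i) < w (hi i)) {g : MvPolynomial (Fin n × Fin n) k}
    (hg : g ∈ schubertIdeal k (w * simple i)) :
    ∃ f ∈ schubertIdeal k (w * simple i), orbitMap k w f * X (Sum.inl (hi i, lo i)) =
      orbitMap k w (swapRows k i g) * X (Sum.inl (lo i, lo i)) := by
  rw [schubertIdeal_eq_span] at hg
  induction hg using Submodule.span_induction with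
  | mem g hg =>
    rcases orbitMap_exchange hw hg with h | h
    · exact ⟨0, zero_mem _, by
        rw [orbitMap_eq_zero_iff.2 (swapRows_mem_schubertIdeal hw h)]; simp⟩
    · exact ⟨g, Ideal.subset_span hg, h⟩
  | zero => exact ⟨0, zero_mem _, by simp⟩
  | add g₁ g₂ _ _ h₁ h₂ =>
    obtain ⟨f₁, hf₁, e₁⟩ := h₁
    obtain ⟨f₂, hf₂, e₂⟩ := h₂
    exact ⟨f₁ + f₂, add_mem hf₁ hf₂, by simp only [map_add, add_mul, e₁, e₂]⟩
  | smul r g _ h =>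
    obtain ⟨f, hf, e⟩ := h
    refine ⟨swapRows k i r * f, Ideal.mul_mem_left _ _ hf, ?_⟩
    rw [smul_eq_mul, map_mul, mul_assoc, e, map_mul, map_mul, mul_assoc]

end Exchange

/-! ## Homogeneous algebra maps -/

section HomogeneousMaps

variable {σ σ' M M' k : Type*} [CommRing k] [AddCommGroup M] [AddCommGroup M']

lemma isWeightedHomogeneous_aeval {a : σ → M} {a' : σ' → M'} (T : M →+ M')
    {g : σ → MvPolynomial σ' k} (hg : ∀ s, IsWeightedHomogeneous a' (g s) (T (a s)))
    {f : MvPolynomial σ k} {γ : M} (hf : IsWeightedHomogeneous a f γ) :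
    IsWeightedHomogeneous a' (aeval g f) (T γ) := by
  rw [aeval_def, eval₂_eq]
  refine IsWeightedHomogeneous.sum _ _ _ fun d hd => ?_
  rw [← hf (mem_support_iff.1 hd), Finsupp.weight_apply, Finsupp.sum, map_sum,
    ← zero_add (∑ _ ∈ _, _)]
  refine (isWeightedHomogeneous_C _ _).mul (IsWeightedHomogeneous.prod _ _ _ fun s _ => ?_)
  rw [map_nsmul]
  exact (hg s).pow _

lemma weightedHomogeneousComponent_map {a : σ → M} {a' : σ' → M'} {T : M → M'}
    (hT : Function.Injective T) {ψ : MvPolynomial σ k →ₗ[k] MvPolynomial σ' k}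
    (hψ : ∀ γ f, IsWeightedHomogeneous a f γ → IsWeightedHomogeneous a' (ψ f) (T γ))
    (γ : M) (f : MvPolynomial σ k) :
    weightedHomogeneousComponent a' (T γ) (ψ f) = ψ (weightedHomogeneousComponent a γ f) := by
  classical
  induction f using MvPolynomial.induction_on' with
  | add p q hp hq => simp only [map_add, hp, hq]
  | monomial d c =>
    have h := isWeightedHomogeneous_monomial a d c rfl
    rw [weightedHomogeneousComponent_of_mem h, weightedHomogeneousComponent_of_mem (hψ _ _ h)]
    by_cases hd : γ = Finsupp.weight a d
    · rw [if_pos hd, if_pos (congrArg T hd)]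
    · rw [if_neg hd, if_neg fun h => hd (hT h), map_zero]

end HomogeneousMaps

/-! ## Images of graded ideals -/

section Images

variable {k : Type*} [Field k]

lemma finrank_map_of_injective {V W : Type*} [AddCommGroup V] [Module k V] [AddCommGroup W]
    [Module k W] {f : V →ₗ[k] W} (hf : Function.Injective f) (p : Submodule k V) :
    Module.finrank k (p.map f) = Module.finrank k p :=
  (LinearEquiv.finrank_eq (Submodule.equivMapOfInjective f hf p)).symm

/-- The difference is the dimension of the degree γ part of J/I. The map φ with kernel I is free to
choose, so this quotient can be compared inside the ring of pairs. -/
lemma hilbert_sub_hilbert {σ ι W : Type*} [Finite σ] [AddCommGroup W] [Module k W] {a : σ → ι → ℤ}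
    (ha : RefinesStandard a) {I J : Ideal (MvPolynomial σ k)} (hIJ : I ≤ J)
    (φ : MvPolynomial σ k →ₗ[k] W) (hφ : φ.ker = I.restrictScalars k) (γ : ι → ℤ) :
    hilbert a I γ - hilbert a J γ = Module.finrank k ((idealPiece a J γ).map φ) := by
  have := finite_weightedHomogeneousSubmodule (k := k) ha γ
  have : Module.Finite k (idealPiece a J γ) :=
    Submodule.finiteDimensional_of_le (inf_le_left : _ ≤ weightedHomogeneousSubmodule k a γ)
  have h := finrank_map_add_finrank_inf_ker (idealPiece a J γ) φ
  have hker : idealPiece a J γ ⊓ φ.ker = idealPiece a I γ := by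
    rw [hφ, idealPiece, idealPiece, inf_assoc]
    congr 1
    exact inf_eq_right.2 hIJ
  rw [hker] at h
  have h1 := hilbert_add_finrank_idealPiece ha I γ
  have h2 := hilbert_add_finrank_idealPiece ha J γ
  omega

end Images

/-! ## Gradings by rows -/

section RowGradings

variable {n : ℕ} {k ι : Type*} [Field k] [DecidableEq ι]

/-- The weights `t^{e x + β y}` of the variables `z_{xy}`. -/
def rowWeight (e : Fin n → ι) (β : Fin n → ι → ℤ) (s : Fin n × Fin n) : ι → ℤ :=
  Pi.single (e s.1) 1 + β s.2

/-- The sum of the coordinates at the rows takes the value 1 on every variable. -/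
lemma refinesStandard_rowWeight {e : Fin n → ι} {β : Fin n → ι → ℤ} (he : Function.Injective e)
    (hβ : ∀ y x, β y (e x) = 0) : RefinesStandard (rowWeight e β) := by
  refine ⟨∑ x, Pi.evalAddMonoidHom (fun _ => ℤ) (e x), fun s => ?_⟩
  simp [rowWeight, hβ, Pi.single_apply, he.eq_iff]

/-- The interchange of the exponents at `e (lo i)` and `e (hi i)`. -/
def swapExponents (e : Fin n → ι) (i : Fin (n - 1)) : (ι → ℤ) →+ (ι → ℤ) where
  toFun γ := γ ∘ Equiv.swap (e (lo i)) (e (hi i))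
  map_zero' := rfl
  map_add' _ _ := rfl

@[simp] lemma swapExponents_swapExponents (e : Fin n → ι) (i : Fin (n - 1)) (γ : ι → ℤ) :
    swapExponents e i (swapExponents e i γ) = γ := by
  funext j
  simp [swapExponents]

lemma swapExponents_injective (e : Fin n → ι) (i : Fin (n - 1)) :
    Function.Injective (swapExponents e i) :=
  Function.LeftInverse.injective (swapExponents_swapExponents e i)

lemma swapExponents_single {e : Fin n → ι} (he : Function.Injective e) (i : Fin (n - 1))
    (x : Fin n) : swapExponents e i (Pi.single (e x) 1) = Pi.single (e (simple i x)) 1 := by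
  have hs : e (simple i x) = Equiv.swap (e (lo i)) (e (hi i)) (e x) := by
    rw [simple, he.swap_apply]
  funext j
  simp only [swapExponents, AddMonoidHom.coe_mk, ZeroHom.coe_mk, Function.comp_apply,
    Pi.single_apply, hs]
  congr 1
  rw [Equiv.swap_apply_eq_iff]

lemma swapExponents_eq_self {e : Fin n → ι} (i : Fin (n - 1)) {β : ι → ℤ}
    (hβ : ∀ x, β (e x) = 0) : swapExponents e i β = β := by
  funext j
  simp only [swapExponents, AddMonoidHom.coe_mk, ZeroHom.coe_mk, Function.comp_apply,
    Equiv.swap_apply_def]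
  split_ifs with h1 h2
  · rw [h1, hβ, hβ]
  · rw [h2, hβ, hβ]
  · rfl

lemma isWeightedHomogeneous_minor (e : Fin n → ι) (β : Fin n → ι → ℤ) {m : ℕ}
    (r c : Fin m → Fin n) : IsWeightedHomogeneous (rowWeight e β)
      ((genericMatrix k n).submatrix r c).det
      (∑ t, Pi.single (e (r t)) 1 + ∑ t, β (c t)) := by
  rw [Matrix.det_apply']
  refine IsWeightedHomogeneous.sum _ _ _ fun π _ => ?_
  rw [← zero_add (_ + _)]
  refine IsWeightedHomogeneous.mul ?_ ?_
  · have : (((Equiv.Perm.sign π : ℤˣ) : ℤ) : MvPolynomial (Fin n × Fin n) k) =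
        C (((Equiv.Perm.sign π : ℤˣ) : ℤ) : k) := by simp
    rw [this]
    exact isWeightedHomogeneous_C _ _
  · rw [← Equiv.sum_comp π fun t => Pi.single (e (r t)) 1, ← Finset.sum_add_distrib]
    refine IsWeightedHomogeneous.prod _ _ _ fun t _ => ?_
    exact isWeightedHomogeneous_X k (rowWeight e β) (r (π t), c t)

lemma isGradedIdeal_schubertIdeal (e : Fin n → ι) (β : Fin n → ι → ℤ)
    (w : Equiv.Perm (Fin n)) : IsGradedIdeal (rowWeight e β) (schubertIdeal k w) := by
  refine isGradedIdeal_span ?_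
  rintro f ⟨q, p, r, c, -, -, rfl⟩
  exact ⟨_, isWeightedHomogeneous_minor e β r c⟩

/-- The grading of the ring of the pairs of matrices that makes `orbitMap` homogeneous. -/
def pairWeight (e : Fin n → ι) (β : Fin n → ι → ℤ) :
    (Fin n × Fin n) ⊕ (Fin n × Fin n) → ι → ℤ :=
  Sum.elim (fun s => Pi.single (e s.1) 1) fun s => β s.2

lemma isWeightedHomogeneous_orbitMap {e : Fin n → ι} {β : Fin n → ι → ℤ}
    (w : Equiv.Perm (Fin n)) {f : MvPolynomial (Fin n × Fin n) k} {γ : ι → ℤ}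
    (hf : IsWeightedHomogeneous (rowWeight e β) f γ) :
    IsWeightedHomogeneous (pairWeight e β) (orbitMap k w f) γ := by
  refine isWeightedHomogeneous_aeval (AddMonoidHom.id _) (fun s => ?_) hf
  rw [Matrix.mul_apply]
  refine IsWeightedHomogeneous.sum _ _ _ fun b _ => ?_
  refine IsWeightedHomogeneous.mul ?_ ?_
  · simp only [genericLower, Matrix.of_apply]
    split_ifs
    · exact isWeightedHomogeneous_X k (pairWeight e β) (Sum.inl (s.1, b))
    · exact isWeightedHomogeneous_zero _ _ _
  · simp only [genericUpper, Matrix.of_apply, Matrix.submatrix_apply, id]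
    split_ifs
    · exact isWeightedHomogeneous_X k (pairWeight e β) (Sum.inr (w b, s.2))
    · exact isWeightedHomogeneous_zero _ _ _

lemma isWeightedHomogeneous_swapRows {e : Fin n → ι} {β : Fin n → ι → ℤ}
    (he : Function.Injective e) (hβ : ∀ y x, β y (e x) = 0) (i : Fin (n - 1))
    {f : MvPolynomial (Fin n × Fin n) k} {γ : ι → ℤ}
    (hf : IsWeightedHomogeneous (rowWeight e β) f γ) :
    IsWeightedHomogeneous (rowWeight e β) (swapRows k i f) (swapExponents e i γ) := by
  rw [aeval_unique (swapRows k i)]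
  refine isWeightedHomogeneous_aeval (swapExponents e i) (fun s => ?_) hf
  rw [Function.comp_apply, swapRows, rename_X, rowWeight, map_add, swapExponents_single he,
    swapExponents_eq_self i (hβ _)]
  exact isWeightedHomogeneous_X k (rowWeight e β) (simple i s.1, s.2)

lemma swapRows_injective (i : Fin (n - 1)) : Function.Injective (swapRows k i) :=
  Function.LeftInverse.injective (swapRows_swapRows i)

lemma map_swapRows_weightedHomogeneousSubmodule {e : Fin n → ι} {β : Fin n → ι → ℤ}
    (he : Function.Injective e) (hβ : ∀ y x, β y (e x) = 0) (i : Fin (n - 1)) (γ : ι → ℤ) :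
    (weightedHomogeneousSubmodule k (rowWeight e β) (swapExponents e i γ)).map
      (swapRows k i).toLinearMap = weightedHomogeneousSubmodule k (rowWeight e β) γ := by
  apply le_antisymm
  · rintro _ ⟨f, hf, rfl⟩
    have := isWeightedHomogeneous_swapRows he hβ i hf
    rwa [swapExponents_swapExponents] at this
  · intro f hf
    exact ⟨swapRows k i f, isWeightedHomogeneous_swapRows he hβ i hf, swapRows_swapRows i f⟩

lemma monomialCount_swapExponents {e : Fin n → ι} {β : Fin n → ι → ℤ}
    (he : Function.Injective e) (hβ : ∀ y x, β y (e x) = 0) (i : Fin (n - 1)) (γ : ι → ℤ) :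
    monomialCount (rowWeight e β) ∅ (swapExponents e i γ) = monomialCount (rowWeight e β) ∅ γ := by
  -- The count does not involve a field, so any field may be used to read it as a dimension.
  rw [← finrank_weightedHomogeneousSubmodule (k := ℚ), ← finrank_weightedHomogeneousSubmodule
    (k := ℚ), ← map_swapRows_weightedHomogeneousSubmodule he hβ i γ,
    finrank_map_of_injective (swapRows_injective i)]

/-- The Hilbert function at an ascent `w (lo i) < w (hi i)` is symmetric. -/
lemma hilbert_swapExponents {e : Fin n → ι} {β : Fin n → ι → ℤ}
    (he : Function.Injective e) (hβ : ∀ y x, β y (e x) = 0) {w : Equiv.Perm (Fin n)}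
    {i : Fin (n - 1)} (hw : w (lo i) < w (hi i)) (γ : ι → ℤ) :
    hilbert (rowWeight e β) (schubertIdeal k w) (swapExponents e i γ) =
      hilbert (rowWeight e β) (schubertIdeal k w) γ := by
  have ha := refinesStandard_rowWeight he hβ
  have h1 : (orbitMap k w).toLinearMap.ker = (schubertIdeal k w).restrictScalars k := by
    ext f
    exact orbitMap_eq_zero_iff
  have h2 : ((orbitMap k w).toLinearMap ∘ₗ (swapRows k i).toLinearMap).ker =
      (schubertIdeal k w).restrictScalars k := by
    ext f
    refine orbitMap_eq_zero_iff.trans ⟨fun h => ?_, swapRows_mem_schubertIdeal hw⟩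
    rw [← swapRows_swapRows i f]
    exact swapRows_mem_schubertIdeal hw h
  rw [hilbert_eq_finrank_map ha _ _ h2 (swapExponents e i γ),
    hilbert_eq_finrank_map ha _ _ h1 γ, Submodule.map_comp,
    map_swapRows_weightedHomogeneousSubmodule he hβ]

/-- The change of the Hilbert function along an ascent `w (lo i) < w (hi i)`. -/
lemma hilbert_sub_hilbert_swapExponents {e : Fin n → ι} {β : Fin n → ι → ℤ}
    (he : Function.Injective e) (hβ : ∀ y x, β y (e x) = 0) {w : Equiv.Perm (Fin n)}
    {i : Fin (n - 1)} (hw : w (lo i) < w (hi i)) (γ : ι → ℤ) :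
    let δ := swapExponents e i (γ + Pi.single (e (hi i)) 1 - Pi.single (e (lo i)) 1)
    hilbert (rowWeight e β) (schubertIdeal k w) γ -
        hilbert (rowWeight e β) (schubertIdeal k (w * simple i)) γ =
      hilbert (rowWeight e β) (schubertIdeal k w) δ -
        hilbert (rowWeight e β) (schubertIdeal k (w * simple i)) δ := by
  classical
  intro δ
  have ha := refinesStandard_rowWeight he hβ
  have h1 : (orbitMap k w).toLinearMap.ker = (schubertIdeal k w).restrictScalars k := by
    ext f
    exact orbitMap_eq_zero_iff
  set ψ := (orbitMap k w).toLinearMap ∘ₗ (swapRows k i).toLinearMap with hψ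
  have h2 : ψ.ker = (schubertIdeal k w).restrictScalars k := by
    ext f
    refine orbitMap_eq_zero_iff.trans ⟨fun h => ?_, swapRows_mem_schubertIdeal hw⟩
    rw [← swapRows_swapRows i f]
    exact swapRows_mem_schubertIdeal hw h
  have hψ' : ∀ γ f, IsWeightedHomogeneous (rowWeight e β) f γ →
      IsWeightedHomogeneous (pairWeight e β) (ψ f) (swapExponents e i γ) := fun γ f hf =>
    isWeightedHomogeneous_orbitMap w (isWeightedHomogeneous_swapRows he hβ i hf)
  have hδ : swapExponents e i δ = γ + Pi.single (e (hi i)) 1 - Pi.single (e (lo i)) 1 :=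
    swapExponents_swapExponents _ _ _
  have hle := schubertIdeal_le_of_ascent (k := k) hw
  rw [hilbert_sub_hilbert ha hle _ h1, hilbert_sub_hilbert ha hle _ h2, Nat.cast_inj]
  set p : PairRing k n := X (Sum.inl (hi i, lo i)) with hp
  set q : PairRing k n := X (Sum.inl (lo i, lo i)) with hq
  have hpinj : Function.Injective (LinearMap.mulRight k p) :=
    fun _ _ h => mul_right_cancel₀ (X_ne_zero _) h
  have hqinj : Function.Injective (LinearMap.mulRight k q) :=
    fun _ _ h => mul_right_cancel₀ (X_ne_zero _) h
  have hcp : ∀ α f, weightedHomogeneousComponent (pairWeight e β)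
      (α + Pi.single (e (hi i)) 1) (f * p) =
      weightedHomogeneousComponent (pairWeight e β) α f * p := by
    intro α f
    rw [hp, weightedHomogeneousComponent_mul_X]
    simp [pairWeight]
  have hcq : ∀ f, weightedHomogeneousComponent (pairWeight e β)
      (γ + Pi.single (e (hi i)) 1) (f * q) =
      weightedHomogeneousComponent (pairWeight e β) (swapExponents e i δ) f * q := by
    intro f
    rw [hq, weightedHomogeneousComponent_mul_X, hδ]
    simp [pairWeight]
  -- Multiplication by p or q preserves dimensions. Since p has the degree of row `hi i` and q that
  -- of row `lo i`, both images land in degree γ + e(hi i), where they are compared.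
  rw [← finrank_map_of_injective hpinj, ← finrank_map_of_injective hqinj (Submodule.map ψ _)]
  suffices h : ((idealPiece (rowWeight e β) (schubertIdeal k (w * simple i)) γ).map
      (orbitMap k w).toLinearMap).map (LinearMap.mulRight k p) =
      ((idealPiece (rowWeight e β) (schubertIdeal k (w * simple i)) δ).map ψ).map
        (LinearMap.mulRight k q) by rw [h]
  have hgr := isGradedIdeal_schubertIdeal (k := k) e β (w * simple i)
  apply le_antisymm
  · rintro _ ⟨_, ⟨f, ⟨hf, hfJ⟩, rfl⟩, rfl⟩
    obtain ⟨g, hg, hfg⟩ := exists_orbitMap_mul_eq hw hfJ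
    -- The exchange partner g need not be homogeneous; its component of degree δ does the job.
    refine ⟨_, ⟨weightedHomogeneousComponent (rowWeight e β) δ g,
      ⟨weightedHomogeneousComponent_mem _ _ _, hgr _ hg _⟩, rfl⟩, ?_⟩
    rw [LinearMap.mulRight_apply, LinearMap.mulRight_apply, ← weightedHomogeneousComponent_map
      (swapExponents_injective e i) hψ', ← hcq]
    refine (congrArg _ hfg.symm).trans ?_
    rw [hcp, weightedHomogeneousComponent_of_mem (isWeightedHomogeneous_orbitMap w hf), if_pos rfl]
    rfl
  · rintro _ ⟨_, ⟨g, ⟨hg, hgJ⟩, rfl⟩, rfl⟩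
    obtain ⟨f, hf, hfg⟩ := exists_mul_orbitMap_eq hw hgJ
    refine ⟨_, ⟨weightedHomogeneousComponent (rowWeight e β) γ f,
      ⟨weightedHomogeneousComponent_mem _ _ _, hgr _ hf _⟩, rfl⟩, ?_⟩
    rw [LinearMap.mulRight_apply, LinearMap.mulRight_apply, ← weightedHomogeneousComponent_map
      (T := fun γ => γ) Function.injective_id (ψ := (orbitMap k w).toLinearMap)
      (fun γ f hf => isWeightedHomogeneous_orbitMap w hf), ← hcp]
    refine (congrArg _ hfg).trans ?_
    rw [hcq]
    exact congrArg (· * q)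
      ((weightedHomogeneousComponent_of_mem (hψ' _ _ hg)).trans (if_pos rfl))

end RowGradings

/-! ## `K`-polynomials of matrix Schubert varieties -/

section KPolynomials

lemma laurentMonomial_injective {ι : Type*} : Function.Injective (laurentMonomial (ι := ι)) := by
  intro a b h
  have := congrArg (fun P : Laurent ι => P.coeff a) h
  simp only [laurentMonomial, AddMonoidAlgebra.coeff_single] at this
  by_contra hab
  simp [Ne.symm hab] at this

variable {n : ℕ} {k ι : Type*} [Field k] [DecidableEq ι]

/-- The positions strictly above the antidiagonal. -/
def cornerPositions (n : ℕ) : Finset (Fin n × Fin n) :=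
  Finset.univ.filter fun p => (p.1.1 + 1) + (p.2.1 + 1) ≤ n

lemma mem_cornerPositions {s : Fin n × Fin n} :
    s ∈ cornerPositions n ↔ s.2 < Fin.rev s.1 := by
  simp only [cornerPositions, Finset.mem_filter, Finset.mem_univ, true_and, Fin.lt_def,
    Fin.val_rev]
  omega

/-- Modulo the corner variables, a member of the ideal becomes a corner-free member, and such a
member is zero. -/
lemma schubertIdeal_revPerm : schubertIdeal k (Fin.revPerm : Equiv.Perm (Fin n)) =
    Ideal.span (X '' (cornerPositions n : Set (Fin n × Fin n))) := by
  have hV : (cornerPositions n : Set (Fin n × Fin n)) = {s | s.2 < Fin.rev s.1} := by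
    ext s
    exact mem_cornerPositions
  have hle : Ideal.span (X '' {s : Fin n × Fin n | s.2 < Fin.rev s.1}) ≤
      orbitIdeal k (Fin.revPerm : Equiv.Perm (Fin n)) := by
    rw [Ideal.span_le]
    rintro _ ⟨⟨x, y⟩, hs, rfl⟩
    exact X_mem_orbitIdeal fun b hb => lt_of_lt_of_le hs (Fin.rev_le_rev.2 hb)
  rw [schubertIdeal_eq_orbitIdeal, hV]
  refine le_antisymm (fun f hf => ?_) hle
  have hsub := sub_setZero_mem (k := k) {s : Fin n × Fin n | s.2 < Fin.rev s.1} f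
  have h0 : setZero k {s : Fin n × Fin n | s.2 < Fin.rev s.1} f = 0 := by
    refine eq_zero_of_setZero_eq ?_ ?_
    · have := sub_mem hf (hle hsub)
      rwa [sub_sub_cancel] at this
    · have := sub_setZero_mem (k := k) {s : Fin n × Fin n | s.2 < Fin.rev s.1} f
      rw [← ker_setZero, RingHom.mem_ker, map_sub, sub_eq_zero] at this
      exact this.symm
  rwa [h0, sub_zero] at hsub

/-- The interchange of the variables at `e (lo i)` and `e (hi i)` in Laurent polynomials. -/
def swapLaurent (e : Fin n → ι) (i : Fin (n - 1)) : Laurent ι →+* Laurent ι :=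
  AddMonoidAlgebra.mapDomainRingHom ℤ (swapExponents e i)

@[simp] lemma swapLaurent_laurentMonomial (e : Fin n → ι) (i : Fin (n - 1)) (b : ι → ℤ) :
    swapLaurent e i (laurentMonomial b) = laurentMonomial (swapExponents e i b) := by
  simp [swapLaurent, laurentMonomial]

lemma convolve_swapLaurent (e : Fin n → ι) (i : Fin (n - 1)) (P : Laurent ι)
    (F : (ι → ℤ) → ℤ) (γ : ι → ℤ) : convolve (swapLaurent e i P) F γ =
      convolve P (F ∘ swapExponents e i) (swapExponents e i γ) := by
  induction P using AddMonoidAlgebra.induction_linear with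
  | zero => simp
  | add p q hp hq => simp [hp, hq]
  | single m r =>
    rw [single_eq_smul, map_zsmul, map_zsmul, map_zsmul, swapLaurent_laurentMonomial,
      LinearMap.smul_apply, LinearMap.smul_apply, Pi.smul_apply, Pi.smul_apply,
      convolve_laurentMonomial, convolve_laurentMonomial, Function.comp_apply, map_sub,
      swapExponents_swapExponents]

/-- An extension of `x ↦ t^{e x}` to the polynomials in `x` with invariant coefficients. -/
structure IsRowSpecialization {S : Type*} [CommRing S] (e : Fin n → ι)
    (Φ : MvPolynomial (Fin n) S →+* Laurent ι) : Prop where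
  map_X : ∀ x, Φ (X x) = laurentMonomial (Pi.single (e x) 1)
  map_C : ∀ i c, swapLaurent e i (Φ (C c)) = Φ (C c)

lemma IsRowSpecialization.map_swapVars {S : Type*} [CommRing S] {e : Fin n → ι}
    (he : Function.Injective e) {Φ : MvPolynomial (Fin n) S →+* Laurent ι}
    (hΦ : IsRowSpecialization e Φ) (i : Fin (n - 1)) (f : MvPolynomial (Fin n) S) :
    Φ (swapVars i f) = swapLaurent e i (Φ f) := by
  have : Φ.comp (swapVars i : _ →ₐ[S] MvPolynomial (Fin n) S).toRingHom =
      (swapLaurent e i).comp Φ := by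
    refine MvPolynomial.ringHom_ext (fun c => ?_) fun x => ?_
    · simpa [swapVars] using (hΦ.map_C i c).symm
    · simp [swapVars, hΦ.map_X, swapExponents_single he]
  exact congrArg (fun F : MvPolynomial (Fin n) S →+* Laurent ι => F f) this

lemma IsRowSpecialization.mul_map_demazure {S : Type*} [CommRing S] {e : Fin n → ι}
    (he : Function.Injective e) {Φ : MvPolynomial (Fin n) S →+* Laurent ι}
    (hΦ : IsRowSpecialization e Φ) (i : Fin (n - 1)) (f : MvPolynomial (Fin n) S) :
    (laurentMonomial (Pi.single (e (lo i)) 1) - laurentMonomial (Pi.single (e (hi i)) 1)) *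
      Φ (demazure i f) = laurentMonomial (Pi.single (e (lo i)) 1) * swapLaurent e i (Φ f) -
        laurentMonomial (Pi.single (e (hi i)) 1) * Φ f := by
  have := congrArg Φ (mul_demazure i f)
  simpa only [map_mul, map_sub, hΦ.map_X, hΦ.map_swapVars he] using this

lemma laurent_sub_ne_zero {e : Fin n → ι} (he : Function.Injective e) (i : Fin (n - 1)) :
    (laurentMonomial (Pi.single (e (lo i)) 1) - laurentMonomial (Pi.single (e (hi i)) 1) :
      Laurent ι) ≠ 0 := by
  rw [sub_ne_zero]
  intro h
  have := congrFun (laurentMonomial_injective h) (e (lo i))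
  simp [he.eq_iff, (lo_lt_hi i).ne] at this

/-- Symmetry of H_w and the exchange relation combine to (x_i − x_{i+1}) H_w = x_i s_i H_v − x_{i+1}
H_v for v = w s_i, which is the equation that defines the Demazure operator. -/
theorem convolve_eq_hilbert [Fintype ι] {S : Type*} [CommRing S] {e : Fin n → ι}
    {β : Fin n → ι → ℤ} (he : Function.Injective e) (hβ : ∀ y x, β y (e x) = 0)
    {Φ : MvPolynomial (Fin n) S →+* Laurent ι} (hΦ : IsRowSpecialization e Φ)
    {top : MvPolynomial (Fin n) S}
    (htop : Φ top = ∏ s ∈ cornerPositions n, (1 - laurentMonomial (rowWeight e β s)))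
    {w : Equiv.Perm (Fin n)} {G : MvPolynomial (Fin n) S}
    (h : ObtainedFrom demazure top w G) :
    convolve (Φ G) (monomialCount (rowWeight e β) ∅) =
      hilbert (rowWeight e β) (schubertIdeal k w) := by
  have ha := refinesStandard_rowWeight he hβ
  induction h with
  | long =>
    rw [htop, convolve_prod_monomialCount ha, schubertIdeal_revPerm, hilbert_span_X ha]
  | step v i g _ hlen ih =>
    set w := v * simple i with hw
    have hwv : w * simple i = v := mul_simple_simple v i
    have hasc : w (lo i) < w (hi i) := by simpa [hw] using length_lt_iff.1 hlen
    have hgr := isGradedIdeal_schubertIdeal (k := k) e β w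
    -- The factor x_i − x_{i+1} cannot be cancelled on functions, as it kills constants. A
    -- resolution turns the Hilbert function into a Laurent polynomial, and these form a domain.
    obtain ⟨E⟩ := nonempty_gradedFreeResolution ha hgr
    have hE : convolve E.kPolynomial (monomialCount (rowWeight e β) ∅) =
        hilbert (rowWeight e β) (schubertIdeal k w) := by
      funext γ
      exact (E.finrank_piece ha (isGrading_quotientGrading hgr).1 γ).symm
    suffices hP : E.kPolynomial = Φ (demazure i g) by rw [← hP, hE]
    refine mul_left_cancel₀ (laurent_sub_ne_zero he i) ?_
    rw [hΦ.mul_map_demazure he]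
    refine convolve_monomialCount_injective ha ?_
    funext γ
    have hsymm : monomialCount (rowWeight e β) ∅ ∘ swapExponents e i =
        monomialCount (rowWeight e β) ∅ := funext (monomialCount_swapExponents he hβ i)
    simp only [map_mul, map_sub, Module.End.mul_apply, LinearMap.sub_apply, Pi.sub_apply,
      convolve_laurentMonomial, convolve_swapLaurent, hE, ih, hsymm]
    -- For this degree, δ is the swap of γ − e(lo i), where the symmetry of H_w applies.
    have h1 := hilbert_sub_hilbert_swapExponents (k := k) he hβ hasc
      (γ - Pi.single (e (hi i)) 1)
    have h2 := hilbert_swapExponents (k := k) he hβ hasc (γ - Pi.single (e (lo i)) 1)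
    simp only [hwv, sub_add_cancel, map_sub] at h1 h2
    omega

theorem isKPolynomial_of_obtainedFrom [Fintype ι] {S : Type*} [CommRing S] {e : Fin n → ι}
    {β : Fin n → ι → ℤ} (he : Function.Injective e) (hβ : ∀ y x, β y (e x) = 0)
    {Φ : MvPolynomial (Fin n) S →+* Laurent ι} (hΦ : IsRowSpecialization e Φ)
    {top : MvPolynomial (Fin n) S}
    (htop : Φ top = ∏ s ∈ cornerPositions n, (1 - laurentMonomial (rowWeight e β s)))
    {w : Equiv.Perm (Fin n)} {G : MvPolynomial (Fin n) S}
    (h : ObtainedFrom demazure top w G) :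
    IsKPolynomial (rowWeight e β) (quotientGrading (rowWeight e β) (schubertIdeal k w)) (Φ G) := by
  have ha := refinesStandard_rowWeight he hβ
  have hgr := isGradedIdeal_schubertIdeal (k := k) e β w
  obtain ⟨E⟩ := nonempty_gradedFreeResolution ha hgr
  exact isKPolynomial_of_convolve ha (isGrading_quotientGrading hgr) E
    (convolve_eq_hilbert he hβ hΦ htop h)

end KPolynomials

/-! ### Multidegrees as initial forms -/

/-! ## Lengths -/

section Lengths

variable {n : ℕ}

/-- Besides the pair of positions itself, every inversion of the product comes from one of w. The
exact increment matches the degree drop of the initial forms. -/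
lemma length_mul_simple {w : Equiv.Perm (Fin n)} {i : Fin (n - 1)} (h : w (lo i) < w (hi i)) :
    length (w * simple i) = length w + 1 := by
  refine le_antisymm ?_ (length_lt_of_ascent h)
  have hsub : inversions (w * simple i) ⊆ insert (lo i, hi i)
      ((inversions w).map ((simple i).prodCongr (simple i)).toEmbedding) := by
    rintro ⟨a, b⟩ hab
    replace hab := (Finset.mem_filter.1 hab).2
    rw [Finset.mem_insert]
    by_cases hne : a = lo i ∧ b = hi i
    · exact .inl (Prod.ext hne.1 hne.2)
    · refine .inr (Finset.mem_map.2 ⟨(simple i a, simple i b), ?_, by simp⟩)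
      simp only [inversions, Finset.mem_filter, Finset.mem_univ, true_and]
      exact ⟨simple_lt hab.1 hne, hab.2⟩
  have := (Finset.card_le_card hsub).trans (Finset.card_insert_le _ _)
  simpa [length] using this

lemma length_revPerm : length (Fin.revPerm : Equiv.Perm (Fin n)) = (cornerPositions n).card := by
  rw [length, ← Finset.card_map ((Equiv.refl (Fin n)).prodCongr Fin.revPerm).toEmbedding]
  congr 1
  ext ⟨a, b⟩
  rw [mem_cornerPositions, Finset.mem_map]
  constructor
  · rintro ⟨⟨c, d⟩, hcd, heq⟩
    simp only [inversions, Finset.mem_filter, Finset.mem_univ, true_and] at hcd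
    simp only [Equiv.coe_toEmbedding, Equiv.prodCongr_apply, Prod.map, Equiv.refl_apply,
      Fin.revPerm_apply, Prod.mk.injEq] at heq
    rw [← heq.1, ← heq.2]
    exact Fin.rev_lt_rev.2 hcd.1
  · intro h
    refine ⟨(a, Fin.rev b), ?_, by simp⟩
    simp only [inversions, Finset.mem_filter, Finset.mem_univ, true_and, Fin.revPerm_apply,
      Fin.rev_rev]
    exact ⟨by simpa using Fin.rev_lt_rev.2 h, h⟩

lemma eq_one_of_no_descent {w : Equiv.Perm (Fin n)} (h : ∀ i, w (lo i) < w (hi i)) : w = 1 := by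
  have := eq_revPerm_of_no_ascent (w := Fin.revPerm * w) fun i => by simpa using h i
  simpa using this

end Lengths

/-! ## Terms of lowest degree -/

section LowestTerms

variable {ι : Type*}

/-- All terms of `f` have degree at least `d`, and `p` is the sum of those of degree `d`. -/
def HasInitialForm (f p : MvPowerSeries ι ℤ) (d : ℕ) : Prop :=
  (d : ℕ∞) ≤ f.order ∧ MvPowerSeries.homogeneousComponent d f = p

namespace HasInitialForm

variable {f g p q : MvPowerSeries ι ℤ} {d d' : ℕ}

lemma mul (hf : HasInitialForm f p d) (hg : HasInitialForm g q d') :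
    HasInitialForm (f * g) (p * q) (d + d') := by
  refine ⟨?_, ?_⟩
  · rw [MvPowerSeries.order_mul, Nat.cast_add]
    exact add_le_add hf.1 hg.1
  · rw [MvPowerSeries.homogeneousComponent_mul_of_le_order hf.1 hg.1, hf.2, hg.2]

lemma add (hf : HasInitialForm f p d) (hg : HasInitialForm g q d) :
    HasInitialForm (f + g) (p + q) d :=
  ⟨(le_min hf.1 hg.1).trans MvPowerSeries.min_order_le_add, by rw [map_add, hf.2, hg.2]⟩

lemma neg (hf : HasInitialForm f p d) : HasInitialForm (-f) (-p) d :=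
  ⟨by rw [MvPowerSeries.order_neg]; exact hf.1, by rw [map_neg, hf.2]⟩

lemma sub (hf : HasInitialForm f p d) (hg : HasInitialForm g q d) :
    HasInitialForm (f - g) (p - q) d := by
  rw [sub_eq_add_neg, sub_eq_add_neg]
  exact hf.add hg.neg

lemma of_lt (hf : HasInitialForm f p d) (h : d' < d) : HasInitialForm f 0 d' := by
  have h' : (d' : ℕ∞) < f.order := lt_of_lt_of_le (by exact_mod_cast h) hf.1
  exact ⟨h'.le, MvPowerSeries.homogeneousComponent_of_lt_order_eq_zero h'⟩

lemma of_constantCoeff (h : MvPowerSeries.constantCoeff f = 1) : HasInitialForm f 1 0 := by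
  classical
  refine ⟨by simp, ?_⟩
  ext e
  rw [MvPowerSeries.coeff_homogeneousComponent, MvPowerSeries.coeff_one]
  by_cases he : e = 0
  · subst he
    simpa using h
  · rw [if_neg he, if_neg]
    rwa [Finsupp.degree_eq_zero_iff]

lemma X (j : ι) : HasInitialForm (MvPowerSeries.X j) (MvPowerSeries.X j) 1 := by
  classical
  refine ⟨?_, ?_⟩
  · rw [Nat.cast_one, MvPowerSeries.one_le_order_iff_constCoeff_eq_zero]
    simp
  · ext e
    rw [MvPowerSeries.coeff_homogeneousComponent, MvPowerSeries.coeff_X]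
    split_ifs with h1 h2 h3
    · rfl
    · rfl
    · subst h3
      simp at h1
    · rfl

lemma prod {τ : Type*} {V : Finset τ} {f p : τ → MvPowerSeries ι ℤ}
    (h : ∀ s ∈ V, HasInitialForm (f s) (p s) 1) :
    HasInitialForm (∏ s ∈ V, f s) (∏ s ∈ V, p s) V.card := by
  classical
  induction V using Finset.induction_on with
  | empty => exact of_constantCoeff (by simp)
  | insert s V hs ih =>
    rw [Finset.prod_insert hs, Finset.prod_insert hs, Finset.card_insert_of_notMem hs, add_comm]
    exact (h s (Finset.mem_insert_self _ _)).mul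
      (ih fun t ht => h t (Finset.mem_insert_of_mem ht))

lemma order_eq (hf : HasInitialForm f p d) (hp : p ≠ 0) : f.order = d := by
  refine le_antisymm (not_lt.1 fun h => hp ?_) hf.1
  rw [← hf.2]
  exact MvPowerSeries.homogeneousComponent_of_lt_order_eq_zero h

lemma lowestTerms_eq (hf : HasInitialForm f p d) (hp : p ≠ 0) : lowestTerms f = p := by
  rw [lowestTerms, hf.order_eq hp, ENat.toNat_natCast, hf.2]

/-- Over a domain orders add and lowest terms multiply, so both can be divided out. -/
lemma cancel_left (hg : HasInitialForm g q d') (hq : q ≠ 0)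
    (h : HasInitialForm (g * f) (q * p) (d' + d)) : HasInitialForm f p d := by
  have hf : (d : ℕ∞) ≤ f.order := by
    have := h.1
    rw [MvPowerSeries.order_mul, hg.order_eq hq, Nat.cast_add] at this
    exact (ENat.add_le_add_iff_left (ENat.natCast_ne_top d')).1 this
  refine ⟨hf, mul_left_cancel₀ hq ?_⟩
  rw [← h.2, MvPowerSeries.homogeneousComponent_mul_of_le_order hg.1 hf, hg.2]

lemma rename [Finite ι] (s : Equiv.Perm ι) (hf : HasInitialForm f p d) :
    HasInitialForm (MvPowerSeries.rename s f) (MvPowerSeries.rename s p) d := by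
  have hcoeff : ∀ (f : MvPowerSeries ι ℤ) e, MvPowerSeries.coeff (Finsupp.equivMapDomain s e)
      (MvPowerSeries.rename s f) = MvPowerSeries.coeff e f := by
    intro f e
    have := MvPowerSeries.coeff_embDomain_rename s.toEmbedding f e
    rw [Finsupp.embDomain_eq_mapDomain] at this
    rw [Finsupp.equivMapDomain_eq_mapDomain]
    exact this
  have hdeg : ∀ e, Finsupp.degree (Finsupp.equivMapDomain s e) = Finsupp.degree (e : ι →₀ ℕ) := by
    intro e
    rw [Finsupp.equivMapDomain_eq_mapDomain, Finsupp.degree_mapDomain]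
  have hsurj : ∀ e : ι →₀ ℕ, ∃ e', Finsupp.equivMapDomain s e' = e := fun e =>
    ⟨Finsupp.equivMapDomain s.symm e, by ext; simp⟩
  refine ⟨MvPowerSeries.le_order fun e he => ?_, ?_⟩
  · obtain ⟨e, rfl⟩ := hsurj e
    rw [hcoeff]
    rw [hdeg] at he
    exact MvPowerSeries.coeff_of_lt_order (lt_of_lt_of_le he hf.1)
  · ext e
    obtain ⟨e, rfl⟩ := hsurj e
    rw [MvPowerSeries.coeff_homogeneousComponent, hcoeff, hcoeff, hdeg, ← hf.2,
      MvPowerSeries.coeff_homogeneousComponent]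

end HasInitialForm

variable [Fintype ι]

lemma substOneSub_laurentMonomial (b : ι → ℤ) : substOneSub (laurentMonomial b) =
    ((∏ j, (isUnit_one_sub_X j).unit ^ b j : (MvPowerSeries ι ℤ)ˣ) : MvPowerSeries ι ℤ) := by
  rw [substOneSub, laurentMonomial, AddMonoidAlgebra.lift_single]
  exact one_smul ℤ _

variable [DecidableEq ι]

lemma substOneSub_single (j : ι) (m : ℤ) : substOneSub (laurentMonomial (Pi.single j m)) =
    ((((isUnit_one_sub_X j).unit : (MvPowerSeries ι ℤ)ˣ) ^ m : (MvPowerSeries ι ℤ)ˣ) :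
      MvPowerSeries ι ℤ) := by
  rw [substOneSub_laurentMonomial, Finset.prod_eq_single j]
  · rw [Pi.single_eq_same]
  · intro l _ hl
    rw [Pi.single_eq_of_ne hl, zpow_zero]
  · simp

lemma substOneSub_single_one (j : ι) : substOneSub (laurentMonomial (Pi.single j 1)) =
    1 - MvPowerSeries.X j := by
  rw [substOneSub_single, zpow_one, IsUnit.unit_spec]

lemma substOneSub_swapLaurent {n : ℕ} (e : Fin n → ι) (i : Fin (n - 1)) (P : Laurent ι) :
    substOneSub (swapLaurent e i P) =
      MvPowerSeries.rename (Equiv.swap (e (lo i)) (e (hi i))) (substOneSub P) := by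
  induction P using AddMonoidAlgebra.induction_linear with
  | zero => simp
  | add p q hp hq => simp only [map_add, hp, hq]
  | single m r =>
    rw [single_eq_smul, map_zsmul, map_zsmul, map_zsmul, map_zsmul, swapLaurent_laurentMonomial,
      substOneSub_laurentMonomial, substOneSub_laurentMonomial]
    congr 1
    set s := Equiv.swap (e (lo i)) (e (hi i)) with hs
    have h : ∀ j, Units.map
        (MvPowerSeries.rename (R := ℤ) s : _ →ₐ[ℤ] MvPowerSeries ι ℤ).toMonoidHom
        (isUnit_one_sub_X j).unit = (isUnit_one_sub_X (s j)).unit := by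
      intro j
      ext1
      simp
    have h2 : Units.map
        (MvPowerSeries.rename (R := ℤ) s : _ →ₐ[ℤ] MvPowerSeries ι ℤ).toMonoidHom
        (∏ j, (isUnit_one_sub_X j).unit ^ m j) =
        ∏ j, (isUnit_one_sub_X j).unit ^ (swapExponents e i m j) := by
      rw [map_prod, ← Equiv.prod_comp s]
      refine Finset.prod_congr rfl fun j _ => ?_
      rw [map_zpow, h]
      simp [swapExponents, hs]
    exact (congrArg Units.val h2).symm

end LowestTerms

/-! ## Multidegrees -/

section Multidegrees

variable {n : ℕ} {ι : Type*}

/-- The identity has full rank min(q, p) + 1 (with indices from 0) in each box, so no larger minor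
fits. -/
lemma schubertIdeal_one (k : Type*) [Field k] : schubertIdeal k (1 : Equiv.Perm (Fin n)) = ⊥ := by
  rw [schubertIdeal, Ideal.span_eq_bot]
  rintro f ⟨q, p, r, c, hr, hc, -⟩
  exfalso
  have hrank : nwRank (1 : Equiv.Perm (Fin n)) q p = min q.1 p.1 + 1 := by
    have : (Finset.univ.filter fun i : Fin n => i ≤ q ∧ (1 : Equiv.Perm (Fin n)) i ≤ p) =
        Finset.Iic (min q p) := by
      ext i
      rw [Finset.mem_filter, Finset.mem_Iic, le_min_iff]
      simp
    rw [nwRank, this, Fin.card_Iic]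
    rcases le_total q p with h | h
    · rw [min_eq_left h, min_eq_left (Fin.le_def.1 h)]
    · rw [min_eq_right h, min_eq_right (Fin.le_def.1 h)]
  have hbound : ∀ {m : ℕ} (r : Fin m ↪o Fin n) (q : Fin n), (∀ s, r s ≤ q) → m ≤ q.1 + 1 := by
    intro m r q hr
    have : Finset.univ.map r.toEmbedding ⊆ Finset.Iic q := by
      intro x hx
      obtain ⟨s, -, rfl⟩ := Finset.mem_map.1 hx
      exact Finset.mem_Iic.2 (hr s)
    simpa using Finset.card_le_card this
  have h1 := hbound r q hr
  have h2 := hbound c p hc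
  omega

/-- An extension of `x ↦ X (e x)` to the polynomials in `x` with invariant coefficients. -/
structure IsRowSubstitution [Finite ι] [DecidableEq ι] {S : Type*} [CommRing S] (e : Fin n → ι)
    (Ψ : MvPolynomial (Fin n) S →+* MvPowerSeries ι ℤ) : Prop where
  map_X : ∀ x, Ψ (X x) = MvPowerSeries.X (e x)
  map_C : ∀ i c, MvPowerSeries.rename (Equiv.swap (e (lo i)) (e (hi i))) (Ψ (C c)) = Ψ (C c)

lemma IsRowSubstitution.map_swapVars [Finite ι] [DecidableEq ι] {S : Type*} [CommRing S]
    {e : Fin n → ι} (he : Function.Injective e)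
    {Ψ : MvPolynomial (Fin n) S →+* MvPowerSeries ι ℤ} (hΨ : IsRowSubstitution e Ψ)
    (i : Fin (n - 1)) (f : MvPolynomial (Fin n) S) :
    Ψ (swapVars i f) = MvPowerSeries.rename (Equiv.swap (e (lo i)) (e (hi i))) (Ψ f) := by
  have : Ψ.comp (swapVars i : _ →ₐ[S] MvPolynomial (Fin n) S).toRingHom =
      (MvPowerSeries.rename (R := ℤ) (Equiv.swap (e (lo i)) (e (hi i)))).toRingHom.comp Ψ := by
    refine MvPolynomial.ringHom_ext (fun c => ?_) fun x => ?_
    · simpa [swapVars] using (hΨ.map_C i c).symm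
    · simp [swapVars, hΨ.map_X, simple, he.swap_apply]
  exact congrArg (fun F : MvPolynomial (Fin n) S →+* MvPowerSeries ι ℤ => F f) this

lemma IsRowSubstitution.mul_map_dividedDifference [Finite ι] [DecidableEq ι] {S : Type*}
    [CommRing S] {e : Fin n → ι} (he : Function.Injective e)
    {Ψ : MvPolynomial (Fin n) S →+* MvPowerSeries ι ℤ} (hΨ : IsRowSubstitution e Ψ)
    (i : Fin (n - 1)) (f : MvPolynomial (Fin n) S) :
    (MvPowerSeries.X (e (lo i)) - MvPowerSeries.X (e (hi i))) * Ψ (dividedDifference i f) =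
      Ψ f - MvPowerSeries.rename (Equiv.swap (e (lo i)) (e (hi i))) (Ψ f) := by
  have := congrArg Ψ (mul_dividedDifference i f)
  simpa only [map_mul, map_sub, hΨ.map_X, hΨ.map_swapVars he] using this

lemma powerSeries_X_sub_X_ne_zero {a b : ι} (h : a ≠ b) :
    (MvPowerSeries.X a - MvPowerSeries.X b : MvPowerSeries ι ℤ) ≠ 0 := by
  rw [sub_ne_zero]
  intro h'
  exact h ((MvPowerSeries.X_inj).1 h')

/-- If the member at w vanished, so would its divided differences, all the way down to the identity.
Only the value there needs to be checked. -/
lemma IsRowSubstitution.ne_zero [Finite ι] [DecidableEq ι] {S : Type*}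
    [CommRing S] [IsDomain S] {e : Fin n → ι} (he : Function.Injective e)
    {Ψ : MvPolynomial (Fin n) S →+* MvPowerSeries ι ℤ} (hΨ : IsRowSubstitution e Ψ)
    {top : MvPolynomial (Fin n) S} (h1 : Ψ (dividedDifferenceFamily top 1) ≠ 0)
    (w : Equiv.Perm (Fin n)) : Ψ (dividedDifferenceFamily top w) ≠ 0 := by
  induction hl : length w using Nat.strong_induction_on generalizing w with
  | h l ih =>
    by_cases hw : ∀ i, w (lo i) < w (hi i)
    · rwa [eq_one_of_no_descent hw]
    · push Not at hw
      obtain ⟨i, hi'⟩ := hw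
      have hlt : length (w * simple i) < length w := length_lt_iff.2
        (lt_of_le_of_ne hi' fun h => (lo_lt_hi i).ne' (w.injective h))
      intro h0
      refine ih _ (hl ▸ hlt) (w * simple i) rfl ?_
      rw [dividedDifferenceFamily_step _ hlt]
      have := hΨ.mul_map_dividedDifference he i (dividedDifferenceFamily top w)
      rw [h0, map_zero, sub_zero] at this
      exact (mul_eq_zero.1 this).resolve_left
        (powerSeries_X_sub_X_ne_zero (he.ne (lo_lt_hi i).ne))

variable [Fintype ι] [DecidableEq ι] {R S : Type*} [CommRing R] [CommRing S] [IsDomain S]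
  {e : Fin n → ι} {β : Fin n → ι → ℤ} {Φ : MvPolynomial (Fin n) R →+* Laurent ι}
  {Ψ : MvPolynomial (Fin n) S →+* MvPowerSeries ι ℤ} {topG : MvPolynomial (Fin n) R}
  {topS : MvPolynomial (Fin n) S} {form : Fin n × Fin n → MvPowerSeries ι ℤ}

/-- After x ↦ 1 − x the Demazure operator is the divided difference plus terms of higher order, so
initial forms follow the divided difference recursion. The form might still be zero here; this is
excluded separately. -/
theorem hasInitialForm_of_obtainedFrom (he : Function.Injective e)
    (hΦ : IsRowSpecialization e Φ) (hΨ : IsRowSubstitution e Ψ)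
    (htopG : Φ topG = ∏ s ∈ cornerPositions n, (1 - laurentMonomial (rowWeight e β s)))
    (htopS : Ψ topS = ∏ s ∈ cornerPositions n, form s)
    (hform : ∀ s, HasInitialForm (1 - substOneSub (laurentMonomial (rowWeight e β s))) (form s) 1)
    {w : Equiv.Perm (Fin n)} {G : MvPolynomial (Fin n) R}
    (h : ObtainedFrom demazure topG w G) :
    HasInitialForm (substOneSub (Φ G)) (Ψ (dividedDifferenceFamily topS w)) (length w) := by
  induction h with
  | long =>
    rw [htopG, dividedDifferenceFamily_long, htopS, map_prod, length_revPerm]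
    refine HasInitialForm.prod fun s _ => ?_
    rw [map_sub, map_one]
    exact hform s
  | step v i g _ hlen ih =>
    have hl : length v = 1 + length (v * simple i) := by
      have := length_mul_simple (w := v * simple i) (i := i) (by simpa using length_lt_iff.1 hlen)
      rw [mul_simple_simple] at this
      omega
    rw [hl] at ih
    have ihs := ih.rename (Equiv.swap (e (lo i)) (e (hi i)))
    refine HasInitialForm.cancel_left ((HasInitialForm.X (e (lo i))).sub (.X (e (hi i))))
      (powerSeries_X_sub_X_ne_zero (he.ne (lo_lt_hi i).ne)) ?_
    have hG := congrArg substOneSub (hΦ.mul_map_demazure he i g)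
    simp only [map_mul, map_sub, substOneSub_single_one, substOneSub_swapLaurent] at hG
    -- The last bracket gains a factor of degree one, so it does not contribute in the degree of g.
    have hG' : (MvPowerSeries.X (e (lo i)) - MvPowerSeries.X (e (hi i))) *
        substOneSub (Φ (demazure i g)) = substOneSub (Φ g) -
          MvPowerSeries.rename (Equiv.swap (e (lo i)) (e (hi i))) (substOneSub (Φ g)) +
        (MvPowerSeries.X (e (lo i)) *
          MvPowerSeries.rename (Equiv.swap (e (lo i)) (e (hi i))) (substOneSub (Φ g)) -
          MvPowerSeries.X (e (hi i)) * substOneSub (Φ g)) := by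
      linear_combination -hG
    rw [hG', dividedDifferenceFamily_step _ hlen, hΨ.mul_map_dividedDifference he]
    have := (ih.sub ihs).add ((((HasInitialForm.X (e (lo i))).mul ihs).of_lt (by omega)).sub
      (((HasInitialForm.X (e (hi i))).mul ih).of_lt (by omega)))
    rwa [sub_zero, add_zero] at this

theorem isMultidegree_of_obtainedFrom (k : Type*) [Field k] (he : Function.Injective e)
    (hβ : ∀ y x, β y (e x) = 0) (hΦ : IsRowSpecialization e Φ) (hΨ : IsRowSubstitution e Ψ)
    (htopG : Φ topG = ∏ s ∈ cornerPositions n, (1 - laurentMonomial (rowWeight e β s)))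
    (htopS : Ψ topS = ∏ s ∈ cornerPositions n, form s)
    (hform : ∀ s, HasInitialForm (1 - substOneSub (laurentMonomial (rowWeight e β s))) (form s) 1)
    (w : Equiv.Perm (Fin n)) {Q : MvPolynomial ι ℤ}
    (hQ : (Q : MvPowerSeries ι ℤ) = Ψ (dividedDifferenceFamily topS w)) :
    IsMultidegree (rowWeight e β) (quotientGrading (rowWeight e β) (schubertIdeal k w)) Q := by
  obtain ⟨G, hG⟩ := exists_obtained demazure topG w
  refine ⟨Φ G, isKPolynomial_of_obtainedFrom he hβ hΦ htopG hG, ?_⟩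
  rw [hQ, (hasInitialForm_of_obtainedFrom he hΦ hΨ htopG htopS hform hG).lowestTerms_eq]
  refine hΨ.ne_zero he ?_ w
  -- At the identity the ideal is zero and the K-polynomial is 1, so the Schubert side, as its
  -- constant term, is 1 as well.
  obtain ⟨G₁, hG₁⟩ := exists_obtained demazure topG (1 : Equiv.Perm (Fin n))
  have h1 : Φ G₁ = 1 := by
    refine convolve_monomialCount_injective (refinesStandard_rowWeight he hβ) ?_
    rw [convolve_eq_hilbert (k := k) he hβ hΦ htopG hG₁, schubertIdeal_one,
      hilbert_bot (refinesStandard_rowWeight he hβ), map_one]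
    rfl
  have h2 := hasInitialForm_of_obtainedFrom he hΦ hΨ htopG htopS hform hG₁
  have h3 : length (1 : Equiv.Perm (Fin n)) = 0 := by
    rw [length, Finset.card_eq_zero, inversions, Finset.filter_eq_empty_iff]
    rintro p - ⟨ha, hb⟩
    exact lt_asymm ha hb
  have h4 : HasInitialForm (1 : MvPowerSeries ι ℤ) 1 0 := .of_constantCoeff (map_one _)
  rw [h1, map_one, h3] at h2
  rw [← h2.2, h4.2]
  exact one_ne_zero

end Multidegrees

/-! ## The gradings by rows and by rows and columns -/

section Gradings

variable {n : ℕ}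

lemma prod_cornerPositions_fst {A : Type*} [CommMonoid A] (F : Fin n → A) :
    ∏ s ∈ cornerPositions n, F s.1 = ∏ x, F x ^ (n - (x.1 + 1)) := by
  rw [cornerPositions, Finset.prod_filter, Fintype.prod_prod_type]
  refine Finset.prod_congr rfl fun x _ => ?_
  rw [← Finset.prod_filter]
  dsimp only
  rw [Finset.prod_const]
  congr 1
  have : (Finset.univ.filter fun y : Fin n => (x.1 + 1) + (y.1 + 1) ≤ n) =
      Finset.univ.filter fun y : Fin n => y.1 < n - (x.1 + 1) := by
    ext y
    simp only [Finset.mem_filter, Finset.mem_univ, true_and]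
    omega
  rw [this, Fin.card_filter_val_lt]
  omega

lemma weightX_eq_rowWeight : (weightX : Fin n × Fin n → Fin n → ℤ) = rowWeight id 0 := by
  funext s
  simp [weightX, rowWeight]

lemma isRowSpecialization_toLaurent : IsRowSpecialization (id : Fin n → Fin n) toLaurent where
  map_X x := by simp [toLaurent]
  map_C i c := by simp [toLaurent]

lemma isRowSubstitution_coe : IsRowSubstitution (id : Fin n → Fin n)
    (coeToMvPowerSeries.ringHom : MvPolynomial (Fin n) ℤ →+* MvPowerSeries (Fin n) ℤ) where
  map_X x := by simp
  map_C i c := by simp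

lemma toLaurent_top : toLaurent (∏ i : Fin n, (1 - X i) ^ (n - (i.1 + 1))) =
    ∏ s ∈ cornerPositions n, (1 - laurentMonomial (rowWeight id 0 s)) := by
  rw [← prod_cornerPositions_fst, map_prod]
  refine Finset.prod_congr rfl fun s _ => ?_
  simp [toLaurent, rowWeight]

lemma coe_top : coeToMvPowerSeries.ringHom (∏ i : Fin n, X i ^ (n - (i.1 + 1)) : MvPolynomial _ ℤ) =
    ∏ s ∈ cornerPositions n, MvPowerSeries.X s.1 := by
  rw [← prod_cornerPositions_fst, map_prod]
  simp

lemma hasInitialForm_rowWeight_id (s : Fin n × Fin n) : HasInitialForm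
    (1 - substOneSub (laurentMonomial (rowWeight id 0 s))) (MvPowerSeries.X s.1) 1 := by
  have : rowWeight id 0 s = Pi.single s.1 1 := by simp [rowWeight]
  rw [this, substOneSub_single_one, sub_sub_cancel]
  exact .X _

/-- The weights of the columns in the `ℤ^{2n}`-grading. -/
def columnWeight (y : Fin n) : Fin n ⊕ Fin n → ℤ := -Pi.single (Sum.inr y) 1

lemma columnWeight_inl (y x : Fin n) : columnWeight y (Sum.inl x) = 0 := by
  simp [columnWeight]

lemma weightXY_eq_rowWeight : (weightXY : Fin n × Fin n → _) = rowWeight Sum.inl columnWeight := by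
  funext s
  rw [weightXY, rowWeight, columnWeight, sub_eq_add_neg]

lemma isRowSpecialization_toDoubleLaurent :
    IsRowSpecialization (Sum.inl : Fin n → Fin n ⊕ Fin n) toDoubleLaurent where
  map_X x := by simp [toDoubleLaurent]
  map_C i c := by
    simp only [toDoubleLaurent, coe_eval₂Hom, eval₂_C]
    induction c using AddMonoidAlgebra.induction_linear with
    | zero => simp
    | add p q hp hq => rw [map_add, map_add, hp, hq]
    | single m r =>
      rw [single_eq_smul, map_zsmul, map_zsmul]
      congr 1
      have : AddMonoidAlgebra.mapDomainRingHom ℤ yExponents (laurentMonomial m) =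
          laurentMonomial (yExponents m) := by
        simp [laurentMonomial]
      rw [this, swapLaurent_laurentMonomial, swapExponents_eq_self]
      intro x
      rfl

lemma toDoubleLaurent_top : toDoubleLaurent (∏ p : Fin n × Fin n with (p.1.1 + 1) + (p.2.1 + 1) ≤ n,
      (1 - X p.1 * C (laurentMonomial (-Pi.single p.2 1)))) =
    ∏ s ∈ cornerPositions n, (1 - laurentMonomial (rowWeight Sum.inl columnWeight s)) := by
  rw [map_prod]
  refine Finset.prod_congr rfl fun s _ => ?_
  have : AddMonoidAlgebra.mapDomainRingHom ℤ yExponents (laurentMonomial (-Pi.single s.2 1)) =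
      laurentMonomial (columnWeight s.2) := by
    have h : yExponents (-Pi.single s.2 1) = columnWeight s.2 := by
      funext j
      rcases j with j | j
      · exact (columnWeight_inl _ _).symm
      · simp [yExponents, columnWeight, Pi.single_apply]
    simp [laurentMonomial, h]
  rw [map_sub, map_one, map_mul, isRowSpecialization_toDoubleLaurent.map_X, toDoubleLaurent,
    coe_eval₂Hom, eval₂_C, this, ← laurentMonomial_add]
  rfl

/-- The inclusion `ℤ[y][x] → ℤ⟦x, y⟧`. -/
def toDoublePowerSeries :
    MvPolynomial (Fin n) (MvPolynomial (Fin n) ℤ) →+* MvPowerSeries (Fin n ⊕ Fin n) ℤ :=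
  coeToMvPowerSeries.ringHom.comp toDoublePolynomial

lemma toDoublePowerSeries_X (x : Fin n) :
    toDoublePowerSeries (X x) = MvPowerSeries.X (Sum.inl x) := by
  simp [toDoublePowerSeries, toDoublePolynomial]

lemma toDoublePowerSeries_C_X (y : Fin n) :
    toDoublePowerSeries (C (X y)) = MvPowerSeries.X (Sum.inr y) := by
  simp [toDoublePowerSeries, toDoublePolynomial]

lemma isRowSubstitution_toDoublePowerSeries :
    IsRowSubstitution (Sum.inl : Fin n → Fin n ⊕ Fin n) toDoublePowerSeries where
  map_X := toDoublePowerSeries_X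
  map_C i c := by
    have : ((MvPowerSeries.rename (R := ℤ) (Equiv.swap (Sum.inl (lo i) : Fin n ⊕ Fin n)
        (Sum.inl (hi i)))).toRingHom.comp toDoublePowerSeries).comp C =
        toDoublePowerSeries.comp C := by
      refine MvPolynomial.ringHom_ext (fun c => by simp) fun y => ?_
      simp only [RingHom.comp_apply, toDoublePowerSeries_C_X, AlgHom.toRingHom_eq_coe,
        RingHom.coe_coe, MvPowerSeries.rename_X]
      rw [Equiv.swap_apply_of_ne_of_ne] <;> simp
    exact congrArg (fun F : MvPolynomial (Fin n) ℤ →+* _ => F c) this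

lemma toDoublePowerSeries_top : toDoublePowerSeries
    (∏ p : Fin n × Fin n with (p.1.1 + 1) + (p.2.1 + 1) ≤ n, (X p.1 - C (X p.2))) =
    ∏ s ∈ cornerPositions n, (MvPowerSeries.X (Sum.inl s.1) - MvPowerSeries.X (Sum.inr s.2)) := by
  rw [map_prod]
  refine Finset.prod_congr rfl fun s _ => ?_
  rw [map_sub, toDoublePowerSeries_X, toDoublePowerSeries_C_X]

/-- 1 − (1 − x)/(1 − y) = (x − y)/(1 − y), and 1/(1 − y) has constant term 1. -/
lemma hasInitialForm_rowWeight_inl (s : Fin n × Fin n) : HasInitialForm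
    (1 - substOneSub (laurentMonomial (rowWeight Sum.inl columnWeight s)))
    (MvPowerSeries.X (Sum.inl s.1) - MvPowerSeries.X (Sum.inr s.2)) 1 := by
  set u : (MvPowerSeries (Fin n ⊕ Fin n) ℤ)ˣ := (isUnit_one_sub_X (Sum.inr s.2)).unit with hu
  have hu' : (u : MvPowerSeries (Fin n ⊕ Fin n) ℤ) = 1 - MvPowerSeries.X (Sum.inr s.2) :=
    IsUnit.unit_spec _
  have h1 : substOneSub (laurentMonomial (rowWeight Sum.inl columnWeight s)) =
      (1 - MvPowerSeries.X (Sum.inl s.1) : MvPowerSeries (Fin n ⊕ Fin n) ℤ) *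
        (u⁻¹ : (MvPowerSeries (Fin n ⊕ Fin n) ℤ)ˣ) := by
    rw [rowWeight, columnWeight, ← Pi.single_neg, laurentMonomial_add, map_mul,
      substOneSub_single_one, substOneSub_single, zpow_neg_one]
  have h2 : (1 : MvPowerSeries (Fin n ⊕ Fin n) ℤ) -
      (1 - MvPowerSeries.X (Sum.inl s.1) : MvPowerSeries (Fin n ⊕ Fin n) ℤ) *
      (u⁻¹ : (MvPowerSeries (Fin n ⊕ Fin n) ℤ)ˣ) =
      (MvPowerSeries.X (Sum.inl s.1) - MvPowerSeries.X (Sum.inr s.2) :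
        MvPowerSeries (Fin n ⊕ Fin n) ℤ) *
        (u⁻¹ : (MvPowerSeries (Fin n ⊕ Fin n) ℤ)ˣ) := by
    have := Units.mul_inv u
    rw [hu'] at this
    linear_combination -this
  rw [h1, h2]
  have hinv : HasInitialForm ((u⁻¹ : (MvPowerSeries (Fin n ⊕ Fin n) ℤ)ˣ) :
      MvPowerSeries (Fin n ⊕ Fin n) ℤ) 1 0 := by
    refine .of_constantCoeff ?_
    have := congrArg MvPowerSeries.constantCoeff (Units.mul_inv u)
    rw [hu'] at this
    simpa using this
  simpa using ((HasInitialForm.X (Sum.inl s.1)).sub (.X (Sum.inr s.2))).mul hinv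

end Gradings

end MatrixSchubert

end

open MatrixSchubert
theorem theorem1p1 (k K : Type*) [Field k] [Field K] [Algebra k K] [Infinite K]
    (n : ℕ) (w : Equiv.Perm (Fin n)) :
    (schubertIdeal k w).IsPrime ∧
    schubertIdeal k w = varietyIdeal k K w ∧
    IsKPolynomial weightX (quotientGrading weightX (varietyIdeal k K w))
      (toLaurent (grothendieck w)) ∧
    IsKPolynomial weightXY (quotientGrading weightXY (varietyIdeal k K w))
      (toDoubleLaurent (doubleGrothendieck w)) ∧
    IsMultidegree weightX (quotientGrading weightX (varietyIdeal k K w))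
      (schubert w) ∧
    IsMultidegree weightXY (quotientGrading weightXY (varietyIdeal k K w))
      (toDoublePolynomial (doubleSchubert w)) := by
  rw [← schubertIdeal_eq_varietyIdeal (k := k) (K := K) w, weightX_eq_rowWeight,
    weightXY_eq_rowWeight]
  refine ⟨schubertIdeal_eq_orbitIdeal (k := k) w ▸ orbitIdeal_isPrime w, rfl, ?_, ?_, ?_, ?_⟩
  · exact isKPolynomial_of_obtainedFrom Function.injective_id (fun _ _ => rfl)
      isRowSpecialization_toLaurent toLaurent_top
      (existsUnique_obtainedFrom demazure_coxeter _ w).choose_spec.1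
  · exact isKPolynomial_of_obtainedFrom Sum.inl_injective columnWeight_inl
      isRowSpecialization_toDoubleLaurent toDoubleLaurent_top
      (existsUnique_obtainedFrom demazure_coxeter _ w).choose_spec.1
  · exact isMultidegree_of_obtainedFrom k Function.injective_id (fun _ _ => rfl)
      isRowSpecialization_toLaurent isRowSubstitution_coe toLaurent_top coe_top
      hasInitialForm_rowWeight_id w rfl
  · exact isMultidegree_of_obtainedFrom k Sum.inl_injective columnWeight_inl
      isRowSpecialization_toDoubleLaurent isRowSubstitution_toDoublePowerSeries
      toDoubleLaurent_top toDoublePowerSeries_top hasInitialForm_rowWeight_inl w rfl
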